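/- **Setting.** An episodic leader–follower Markov game has horizon $H\ge 1$, measurable spaces $\mathcal S,\mathcal A,\mathcal B$ of states, leader's actions and follower's actions, initial law $\rho_0$, transition kernels $P_h(\cdot\mid s,a,b)$, and measurable rewards $u_h,r_h:\mathcal S\times\mathcal A\times\mathcal B\to[0,1]$ of the leader and the follower. A leader's policy is $\pi=(\pi_h)_{h\in[H]}$ with kernels $\pi_h(\cdot\mid s,b)$ on $\mathcal A$. The follower's actions carry a reference measure of finite total mass $|\mathcal B|\ge 1$ (counting measure if $\mathcal B$ is finite); densities on $\mathcal B$ and sums over $b$ are with respect to it. The follower is myopic with parameter $\eta>0$: for a reward $r^\theta$ put $r_h^{\pi,\theta}(s,b)=\langle\pi_h(\cdot\mid s,b),r_h^\theta(s,\cdot,b)\rangle$; his quantal response has density $\nu_h^{\pi,\theta}(b\mid s)=\exp\big(\eta\, (r_h^{\pi,\theta}(s,b)-V_h^{\pi,\theta}(s))\big)$ with $V_h^{\pi,\theta}(s)=\eta^{-1}\log\sum_b\exp(\eta r_h^{\pi,\theta}(s,b))$; $\nu^\pi$ is the response under the true reward $r$. Let $\pi_h\otimes\nu_h(a,b\mid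 s)=\pi_h(a\mid s,b)\nu_h(b\mid s)$, $(T_h^{\pi,\theta}f)(s)=\langle f(s,\cdot,\cdot),\pi_h\otimes\nu_h^{\pi,\theta}(\cdot,\cdot\mid s)\rangle$, $(\mathbb T_h^{\pi,\theta}f)(s,a,b)=u_h(s,a,b)+\mathbb E_{s'\sim P_h(\cdot\mid s,a,b)}[(T_{h+1}^{\pi,\theta}f)(s')]$, $(\Upsilon_h^\pi f)(s,b)=\langle\pi_h(\cdot\mid s,b),f(s,\cdot,b)\rangle-\langle\pi_h\otimes\nu_h^\pi(\cdot,\cdot\mid s),f(s,\cdot,\cdot)\rangle$, $J(\pi)=\mathbb E^{\pi,\nu^\pi}[\sum_{h}u_h(s_h,a_h,b_h)]$, $B_A=2(\eta^{-1}\log|\mathcal B|+1)$ and $C_\eta=\eta^{-1}+B_A$. **Classes.** Let $\Pi=\prod_h\Pi_h$ be a class of leader's policies, $\Theta=\prod_h\Theta_h$ a class of parameters with measurable rewards $r_h^{\theta}=r_h^{\theta_h}$ with values in $[0,1]$, and $\mathcal U=\prod_h\mathcal U_h$ with $\mathcal U_h$ a class of measurable functions $\mathcal S\times\mathcal A\times\mathcal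 B\to[-H,H]$; put $U_{H+1}=0$ for $U\in\mathcal U$. Assume * (realizability) there is $\theta^*\in\Theta$ with $r_h^{\theta^*}=r_h$ for all $h$, and for all $\pi\in\Pi$, $\theta\in\Theta$ there is $U\in\mathcal U$ with $U_h=\mathbb T_h^{\pi,\theta}U_{h+1}$ for all $h\in[H]$; * (completeness) $\mathbb T_h^{\pi,\theta}U_{h+1}\in\mathcal U_h$ for all $U\in\mathcal U$, $\pi\in\Pi$, $\theta\in\Theta$, $h\in[H]$. Let $\pi^*\in\Pi$ maximize $J$ over $\Pi$, and $\mathrm{Subopt}(\pi)=J(\pi^*)-J(\pi)$. **Data.** There are $T\ge1$ independent trajectories $(s_h^i,a_h^i,b_h^i,u_h^i)_{h\in[H]}$ with final state $s_{H+1}^i$; trajectory $i$ is generated in the game by an announced (possibly random) policy $\pi^i$ and its quantal response $\nu^{\pi^i}$. Expectations under $\mathcal D$ are $\mathbb E_{\mathcal D}=T^{-1}\sum_{i=1}^T\mathbb E[\,\cdot\,]$ over the data-generating distribution. **Algorithm (MLE-BCP).** Let $\mathcal L_h(\theta_h)=-\sum_i\log\nu_h^{\pi^i,\theta}(b_h^i\mid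 s_h^i)$ and $\ell_h(U',U_{h+1},\theta_{h+1},\pi)=\sum_i\big(U'(s_h^i,a_h^i,b_h^i)-u_h^i-(T_{h+1}^{\pi,\theta}U_{h+1})(s_{h+1}^i)\big)^2$, and let $\mathcal C^\pi(\beta)$ be the set of $(U,\theta)\in\mathcal U\times\Theta$ such that for all $h\in[H]$ $$\mathcal L_h(\theta_h)-\inf_{\theta'\in\Theta_h}\mathcal L_h(\theta')\le\beta,\qquad \ell_h(U_h,U_{h+1},\theta_{h+1},\pi)-\inf_{U'\in\mathcal U_h}\ell_h(U',U_{h+1},\theta_{h+1},\pi)\le H^2\beta .$$ The output $\hat\pi$ is any maximizer over $\pi\in\Pi$ of $\inf_{(U,\theta)\in\mathcal C^\pi(\beta)}\mathbb E_{s_1\sim\rho_0}[(T_1^{\pi,\theta}U_1)(s_1)]$. **Covering numbers.** $\mathcal N(\Theta)=\max_h\mathcal N(\Theta_h)$ and $\mathcal N(\mathcal Y)=\max_h\mathcal N(\mathcal Y_h)$ are (internal) $T^{-1}$-covering numbers, for the distance $\max_{s,\,\pi\in\Pi}\{(1+\eta)\|r_h^\theta-r_h^{\tilde\theta}\|_\infty,\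 D_{\mathrm H}(\nu_h^{\pi,\theta}(\cdot\mid s),\nu_h^{\pi,\tilde\theta}(\cdot\mid s))\}$ on $\Theta_h$ ($D_{\mathrm H}$ is the Hellinger distance, $D_{\mathrm H}^2(p,q)=\frac12\sum_b(\sqrt{p}-\sqrt{q})^2$) and the distance $\max\{\|U_h-\tilde U_h\|_\infty,\ \|U_{h+1}-\tilde U_{h+1}\|_\infty,\ \sup_{s}\|(\pi_{h+1}\otimes\nu_{h+1}^{\pi,\theta}-\tilde\pi_{h+1}\otimes\nu_{h+1}^{\tilde\pi,\tilde\theta})(\cdot,\cdot\mid s)\|_1\}$ on $\mathcal Y_h=\mathcal U_h\times\mathcal U_{h+1}\times\Pi_{h+1}\times\Theta_{h+1}$ (only the first term if $h=H$). **Theorem.** There are universal constants $c,C>0$ such that the following holds for every game, classes and data as above and every $\delta\in(0,1)$. If $\mathcal N(\Theta),\mathcal N(\mathcal Y)<\infty$ and $\beta\ge c\log\big(eH\,\mathcal N(\Theta)\,\mathcal N(\mathcal Y)/\delta\big)$, then with probability at least $1-\delta$ every output $\hat\pi$ of MLE-BCP satisfies $$\mathrm{Subopt}(\hat\pi)\le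 C\Big(C_L\,H^2\sqrt{\beta/T}+C_F\,H^2(1+\eta B_A)\sqrt{\beta/T}+C_F^2\,H^2e^{4\eta B_A}(\eta C_\eta)^3\,\beta/T\Big),$$ where, with $0/0=0$ and $x/0=\infty$ for $x>0$, and $\mathbb E^{\pi^*}$ the expectation under $(\pi^*,\nu^{\pi^*})$, $$C_L=\sup_{U\in\mathcal U,\theta\in\Theta,h\in[H]}\sqrt{\frac{\mathbb E^{\pi^*}\big[(U_h-\mathbb T_h^{\pi^*,\theta}U_{h+1})(s_h,a_h,b_h)^2\big]}{\mathbb E_{\mathcal D}\big[(U_h-\mathbb T_h^{\pi^*,\theta}U_{h+1})(s_h^i,a_h^i,b_h^i)^2\big]}},\qquad C_F=\sup_{\theta\in\Theta,h\in[H]}\sqrt{\frac{\mathbb E^{\pi^*}\big[(\Upsilon_h^{\pi^*}(r_h^\theta-r_h))(s_h,b_h)^2\big]}{\mathbb E_{\mathcal D}\big[(\Upsilon_h^{\pi^i}(r_h^\theta-r_h))(s_h^i,b_h^i)^2\big]}} .$$ -/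

import Mathlib

open MeasureTheory ProbabilityTheory Set
open scoped ENNReal NNReal

noncomputable section

namespace LeaderFollower

/-! ### Quantal responses -/

section Response

variable {Z A B : Type*} [MeasurableSpace Z] [MeasurableSpace A] [MeasurableSpace B]

/-- The reward `f^α(z, b) = ⟨α(· | z, b), f(z, ·, b)⟩` that the follower faces in context `z`
for the action `b`, when the leader announces the prescription `α`. -/
def avgReward (α : Kernel (Z × B) A) (f : Z × A × B → ℝ) (z : Z) (b : B) : ℝ :=
  ∫ a, f (z, a, b) ∂(α (z, b))

/-- The soft value `V(z) = η⁻¹ log ∑_b exp (η f^α(z, b))`. The sum over the follower's actions is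
the integral against the reference measure `base` (the counting measure when there are finitely many
actions, Lebesgue measure when the actions form an interval). -/
def softValue (η : ℝ) (base : Measure B) (α : Kernel (Z × B) A) (f : Z × A × B → ℝ) (z : Z) : ℝ :=
  η⁻¹ * Real.log (∫ b, Real.exp (η * avgReward α f z b) ∂base)

/-- The advantage of a myopic follower: `A = Q - V`, where `Q` is the immediate reward `f^α`. -/
def advantage (η : ℝ) (base : Measure B) (α : Kernel (Z × B) A) (f : Z × A × B → ℝ)
    (z : Z) (b : B) : ℝ :=
  avgReward α f z b - softValue η base α f z

/-- The density `ν(b | z) = exp (η A(z, b))` of the quantal response w.r.t. `base`. -/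
def responseDensity (η : ℝ) (base : Measure B) (α : Kernel (Z × B) A) (f : Z × A × B → ℝ)
    (z : Z) (b : B) : ℝ :=
  Real.exp (η * advantage η base α f z b)

/-- The quantal response `ν` of a myopic follower with reward `f` to the prescription `α`. -/
def quantalResponse (η : ℝ) (base : Measure B) [SFinite base] (α : Kernel (Z × B) A)
    (f : Z × A × B → ℝ) : Kernel Z B :=
  Kernel.withDensity (Kernel.const Z base)
    (fun z b => ENNReal.ofReal (responseDensity η base α f z b))

/-- The joint law `α ⊗ ν` of both actions `(b, a)` given the context: `b ~ ν(· | z)`,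
then `a ~ α(· | z, b)`. -/
def jointResponse (η : ℝ) (base : Measure B) [SFinite base] (α : Kernel (Z × B) A)
    (f : Z × A × B → ℝ) : Kernel Z (B × A) :=
  (quantalResponse η base α f) ⊗ₖ α

/-- The integral operator `(T U)(z) = ⟨U(z, ·, ·), α ⊗ ν(·, · | z)⟩`, where `ν` is the quantal
response to `α` under the follower's reward `f`. -/
def respOp (η : ℝ) (base : Measure B) [SFinite base] (α : Kernel (Z × B) A)
    (f : Z × A × B → ℝ) (U : Z × A × B → ℝ) (z : Z) : ℝ :=
  ∫ q, U (z, q.2, q.1) ∂(jointResponse η base α f z)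

/-- The operator `(Υ g)(z, b) = ⟨α(· | z, b), g(z, ·, b)⟩ - ⟨α ⊗ ν(·, · | z), g(z, ·, ·)⟩`, where
`ν` is the quantal response to `α` under the follower's reward `f`. -/
def upsilon (η : ℝ) (base : Measure B) [SFinite base] (α : Kernel (Z × B) A)
    (f : Z × A × B → ℝ) (g : Z × A × B → ℝ) (z : Z) (b : B) : ℝ :=
  avgReward α g z b - respOp η base α f g z

end Response

/-! ### Distances and covering numbers -/

/-- The sup-distance of two real functions. -/
def supDist {X : Type*} (f g : X → ℝ) : ℝ≥0∞ := ⨆ x, ENNReal.ofReal |f x - g x|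

/-- The Hellinger distance of the probability laws with densities `p`, `q` w.r.t. `base`:
`D_H² = (1/2) ∫ (√p - √q)²`. -/
def hellingerDist {B : Type*} [MeasurableSpace B] (base : Measure B) (p q : B → ℝ) : ℝ :=
  Real.sqrt ((1 / 2) * ∫ b, (Real.sqrt (p b) - Real.sqrt (q b)) ^ 2 ∂base)

/-- The `ℓ¹` (total variation norm) distance `‖μ - ν‖₁ = sup_{|f| ≤ 1} (∫ f dμ - ∫ f dν)` of two
probability measures (it is the `L¹`-distance of their densities w.r.t. a common base). -/
def l1Dist {X : Type*} [MeasurableSpace X] (μ ν : Measure X) : ℝ≥0∞ :=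
  ⨆ (f : X → ℝ) (_ : Measurable f ∧ ∀ x, |f x| ≤ 1), ENNReal.ofReal (∫ x, f x ∂μ - ∫ x, f x ∂ν)

/-- The `ε`-covering number of `K` for the distance `ρ`: the least size of a finite set of centres
in `K` such that each point of `K` has distance at most `ε` to one of them (`⊤` if there is no
such finite set). -/
def coveringNumber {X : Type*} (ρ : X → X → ℝ≥0∞) (K : Set X) (ε : ℝ≥0∞) : ℕ∞ :=
  ⨅ (C : Finset X) (_ : (C : Set X) ⊆ K ∧ ∀ x ∈ K, ∃ y ∈ C, ρ x y ≤ ε), (C.card : ℕ∞)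

/-! ### The game -/

/-- An episodic leader-follower Markov game with a myopic quantal follower. The steps are
`0, …, H - 1`; whatever is indexed by a step `≥ H` plays no role. -/
structure Game (S A B : Type*) [MeasurableSpace S] [MeasurableSpace A] [MeasurableSpace B] where
  /-- the horizon -/
  H : ℕ
  H_pos : 0 < H
  /-- the initial law -/
  init : Measure S
  init_prob : IsProbabilityMeasure init
  /-- the transition kernels -/
  P : ℕ → Kernel (S × A × B) S
  P_markov : ∀ h, IsMarkovKernel (P h)
  /-- the leader's rewards -/
  u : ℕ → S × A × B → ℝ
  u_meas : ∀ h, Measurable (u h)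
  u_mem : ∀ h x, u h x ∈ Icc (0 : ℝ) 1
  /-- the follower's rewards -/
  r : ℕ → S × A × B → ℝ
  r_meas : ∀ h, Measurable (r h)
  r_mem : ∀ h x, r h x ∈ Icc (0 : ℝ) 1
  /-- the inverse temperature of the follower -/
  η : ℝ
  η_pos : 0 < η
  /-- the reference measure on the follower's actions, with total mass `|B|` -/
  base : Measure B
  base_fin : IsFiniteMeasure base
  one_le_base : 1 ≤ base univ

attribute [instance] Game.init_prob Game.P_markov Game.base_fin

/-- A policy of the leader: at step `h` in state `s`, if the follower plays `b`, she
draws her action from `π h (s, b)`. -/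
abbrev Policy (S A B : Type*) [MeasurableSpace S] [MeasurableSpace A] [MeasurableSpace B] :=
  ℕ → Kernel (S × B) A

namespace Game

variable {S A B : Type*} [MeasurableSpace S] [MeasurableSpace A] [MeasurableSpace B]
variable (M : Game S A B)

/-- `B_A = (1 + eff_H(0)) (η⁻¹ log |B| + 1)` with `eff_H(0) = 1`. -/
def BA : ℝ := 2 * (M.η⁻¹ * Real.log (M.base.real univ) + 1)

/-- `C_η = η⁻¹ + B_A`. -/
def Ceta : ℝ := M.η⁻¹ + M.BA

/-- Law of `(s_h, a_h, b_h)` if `s_h ~ μ`, the leader uses the prescription `α` at step `h` and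
the follower plays his true quantal response. -/
def stepLaw (h : ℕ) (μ : Measure S) (α : Kernel (S × B) A) : Measure (S × A × B) :=
  (μ ⊗ₘ jointResponse M.η M.base α (M.r h)).map (fun q => (q.1, q.2.2, q.2.1))

/-- Law of the state `s_h` under `(π, ν^π)`. -/
def stateLaw (π : Policy S A B) : ℕ → Measure S
  | 0 => M.init
  | h + 1 => (M.stepLaw h (stateLaw π h) (π h)).bind (M.P h)

/-- Law of `(s_h, a_h, b_h)` under `(π, ν^π)`. -/
def occupancy (π : Policy S A B) (h : ℕ) : Measure (S × A × B) :=
  M.stepLaw h (M.stateLaw π h) (π h)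

/-- The leader's value `J(π) = E^{π, ν^π} [∑_h u_h(s_h, a_h, b_h)]`. -/
def J (π : Policy S A B) : ℝ :=
  ∑ h ∈ Finset.range M.H, ∫ x, M.u h x ∂(M.occupancy π h)

/-- The quantal Bellman operator of the leader, for the next-step prescription `α` and the
next-step reward `f` of the follower:
`(𝕋_h U)(s, a, b) = u_h(s, a, b) + E_{s' ~ P_h(· | s, a, b)} [(T_{h+1} U)(s')]`. -/
def bellman (h : ℕ) (α : Kernel (S × B) A) (f : S × A × B → ℝ) (U : S × A × B → ℝ)
    (x : S × A × B) : ℝ :=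
  M.u h x + ∫ s', respOp M.η M.base α f U s' ∂(M.P h x)

end Game

/-! ### Function classes -/

/-- The classes that the learner works with: for each step a class of prescriptions of the
leader, a class of parameters of the follower's reward `rew h θ`, and a class of candidate
values of the leader. -/
structure Classes (S A B Θ : Type*) [MeasurableSpace S] [MeasurableSpace A]
    [MeasurableSpace B] where
  pol : ℕ → Set (Kernel (S × B) A)
  par : ℕ → Set Θ
  rew : ℕ → Θ → S × A × B → ℝ
  val : ℕ → Set (S × A × B → ℝ)

namespace Classes

variable {S A B Θ : Type*} [MeasurableSpace S] [MeasurableSpace A] [MeasurableSpace B]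
variable (F : Classes S A B Θ) (M : Game S A B)

/-- The leader's policies `π = (π_h)` with `π_h` in the class of step `h`. -/
def Pol : Set (Policy S A B) := {π | ∀ h < M.H, π h ∈ F.pol h}

/-- The parameters `θ = (θ_h)` with `θ_h` in the class of step `h`. -/
def Par : Set (ℕ → Θ) := {θ | ∀ h < M.H, θ h ∈ F.par h}

/-- The candidate values `U = (U_h)` with `U_h` in the class of step `h`, and `U = 0` after the
last step. -/
def Val : Set (ℕ → S × A × B → ℝ) :=
  {U | (∀ h < M.H, U h ∈ F.val h) ∧ ∀ h, M.H ≤ h → U h = 0}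

/-- `U_h - 𝕋_h^{π, θ} U_{h+1}`. -/
def residual (π : Policy S A B) (U : ℕ → S × A × B → ℝ) (θ : ℕ → Θ) (h : ℕ)
    (x : S × A × B) : ℝ :=
  U h x - M.bellman h (π (h + 1)) (F.rew (h + 1) (θ (h + 1))) (U (h + 1)) x

/-- Well-posedness of the classes: prescriptions are probability kernels, the follower's candidate
rewards are measurable with values in `[0, 1]`, the leader's candidate values are measurable and
bounded by `H`. -/
structure Admissible : Prop where
  pol_markov : ∀ h < M.H, ∀ α ∈ F.pol h, IsMarkovKernel α
  rew_meas : ∀ h < M.H, ∀ θ ∈ F.par h, Measurable (F.rew h θ)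
  rew_mem : ∀ h < M.H, ∀ θ ∈ F.par h, ∀ x, F.rew h θ x ∈ Icc (0 : ℝ) 1
  val_meas : ∀ h < M.H, ∀ U ∈ F.val h, Measurable U
  val_le : ∀ h < M.H, ∀ U ∈ F.val h, ∀ x, |U x| ≤ M.H

/-- Realizability: the true reward of the follower is in the class, and for all `π`, `θ` the class
of the leader's values contains the solution of `U_h = 𝕋_h^{π, θ} U_{h+1}`. -/
def Realizable : Prop :=
  (∃ θ ∈ F.Par M, ∀ h < M.H, F.rew h (θ h) = M.r h) ∧
  ∀ π ∈ F.Pol M, ∀ θ ∈ F.Par M, ∃ U ∈ F.Val M, ∀ h < M.H, ∀ x, F.residual M π U θ h x = 0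

/-- Completeness: the class of the leader's values is closed under the operators
`𝕋_h^{π, θ}`. -/
def Complete : Prop :=
  ∀ U ∈ F.Val M, ∀ π ∈ F.Pol M, ∀ θ ∈ F.Par M, ∀ h < M.H,
    M.bellman h (π (h + 1)) (F.rew (h + 1) (θ (h + 1))) (U (h + 1)) ∈ F.val h

/-- The distance on the parameters of step `h`:
`max_{s, π} {(1 + η) ‖r_h^θ - r_h^{θ'}‖_∞, D_H(ν_h^{π, θ}(· | s), ν_h^{π, θ'}(· | s))}`. -/
def parDist (h : ℕ) (θ θ' : Θ) : ℝ≥0∞ :=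
  max (ENNReal.ofReal (1 + M.η) * supDist (F.rew h θ) (F.rew h θ'))
    (⨆ α ∈ F.pol h, ⨆ s : S, ENNReal.ofReal (hellingerDist M.base
      (responseDensity M.η M.base α (F.rew h θ) s) (responseDensity M.η M.base α (F.rew h θ') s)))

/-- The distance of the joint class at step `h`: the maximum of `‖U_h - U'_h‖_∞`,
`‖U_{h+1} - U'_{h+1}‖_∞` and the sup over the next state of the `ℓ¹`-distance of
`π_{h+1} ⊗ ν_{h+1}^{π, θ}` and `π'_{h+1} ⊗ ν_{h+1}^{π', θ'}`. At the last step there is no next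
step, and only the first term is left. -/
def jointDist (h : ℕ) (y y' : (ℕ → S × A × B → ℝ) × Policy S A B × (ℕ → Θ)) : ℝ≥0∞ :=
  max (supDist (y.1 h) (y'.1 h))
    (if h + 1 < M.H then
      max (supDist (y.1 (h + 1)) (y'.1 (h + 1)))
        (⨆ s : S, l1Dist
          (jointResponse M.η M.base (y.2.1 (h + 1)) (F.rew (h + 1) (y.2.2 (h + 1))) s)
          (jointResponse M.η M.base (y'.2.1 (h + 1)) (F.rew (h + 1) (y'.2.2 (h + 1))) s))
    else 0)

/-- `N(Θ, ε) = max_h N(Θ_h, ε)`. -/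
def parCover (ε : ℝ≥0∞) : ℕ∞ :=
  ⨆ h : Fin M.H, coveringNumber (F.parDist M h) (F.par h) ε

/-- `N(𝒴, ε) = max_h N(𝒴_h, ε)`, where `𝒴_h` is the class of all `(U_h, U_{h+1}, π_{h+1}, θ_{h+1})`
(the distance sees nothing else of `U`, `π` and `θ`). -/
def jointCover (ε : ℝ≥0∞) : ℕ∞ :=
  ⨆ h : Fin M.H, coveringNumber (F.jointDist M h) (F.Val M ×ˢ F.Pol M ×ˢ F.Par M) ε

end Classes

/-! ### Offline data -/

/-- `T` random trajectories. The policy announced in trajectory `i` may be random: it is the policy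
with prescriptions `beh h ((label i ω, ·), ·)`, where `label i` is a random label. -/
structure Data (Ω X S A B : Type*) [MeasurableSpace X] [MeasurableSpace S] [MeasurableSpace A]
    [MeasurableSpace B] (T : ℕ) where
  beh : ℕ → Kernel ((X × S) × B) A
  label : Fin T → Ω → X
  s : Fin T → ℕ → Ω → S
  a : Fin T → ℕ → Ω → A
  b : Fin T → ℕ → Ω → B

namespace Data

variable {Ω X S A B Θ : Type*} [MeasurableSpace Ω] [MeasurableSpace X] [MeasurableSpace S]
  [MeasurableSpace A] [MeasurableSpace B] {T : ℕ}
variable (D : Data Ω X S A B T)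

/-- The policy `π^i` announced in trajectory `i`. -/
def policy (i : Fin T) (ω : Ω) : Policy S A B := fun h =>
  (D.beh h).comap (fun q : S × B => ((D.label i ω, q.1), q.2)) (by fun_prop)

/-- The triple `(s_h, a_h, b_h)` of trajectory `i`. -/
def sab (i : Fin T) (h : ℕ) (ω : Ω) : S × A × B := (D.s i h ω, D.a i h ω, D.b i h ω)

/-- What happened in trajectory `i` before the actions of step `h` are taken: the label (hence
the announced policy), the triples of the earlier steps, and the state `s_h`. -/
def hist (i : Fin T) (h : ℕ) (ω : Ω) : X × (Fin h → S × A × B) × S :=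
  (D.label i ω, fun k => D.sab i k ω, D.s i h ω)

/-- The whole trajectory `i`, with its label. -/
def record (H : ℕ) (i : Fin T) (ω : Ω) : X × (Fin H → S × A × B) × S := D.hist i H ω

/-- The conditional law of `((b_h, a_h), s_{h+1})` given the label and the state `s_h`: the
follower plays the quantal response to the announced policy, the leader follows that policy,
and the state moves according to the game. -/
def stepKernel (M : Game S A B) (h : ℕ) : Kernel (X × S) ((B × A) × S) :=
  (jointResponse M.η M.base (D.beh h) (fun q => M.r h (q.1.2, q.2.1, q.2.2))) ⊗ₖ
    ((M.P h).comap (fun q : (X × S) × (B × A) => (q.1.2, q.2.2, q.2.1)) (by fun_prop))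

/-- The data consist of independent trajectories of the game, each generated by its announced policy
and the quantal response to it. -/
structure IsGenerated (M : Game S A B) (Pr : Measure Ω) : Prop where
  beh_markov : ∀ h, IsMarkovKernel (D.beh h)
  label_meas : ∀ i, Measurable (D.label i)
  s_meas : ∀ i h, Measurable (D.s i h)
  a_meas : ∀ i h, Measurable (D.a i h)
  b_meas : ∀ i h, Measurable (D.b i h)
  init_law : ∀ i, Pr.map (fun ω => (D.label i ω, D.s i 0 ω)) = (Pr.map (D.label i)).prod M.init
  step_law : ∀ i, ∀ h < M.H,
    Pr.map (fun ω => (D.hist i h ω, (D.b i h ω, D.a i h ω), D.s i (h + 1) ω)) =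
      (Pr.map (D.hist i h)) ⊗ₘ
        ((D.stepKernel M h).comap (fun w => (w.1, w.2.2)) (by fun_prop))
  indep : iIndepFun (fun i => D.record M.H i) Pr

variable (F : Classes S A B Θ) (M : Game S A B)

/-- Negative log-likelihood `ℒ_h(θ_h) = - ∑_i log ν_h^{π^i, θ}(b_h^i | s_h^i)`. -/
def negLogLik (ω : Ω) (h : ℕ) (θ : Θ) : ℝ :=
  - ∑ i : Fin T, Real.log
      (responseDensity M.η M.base (D.policy i ω h) (F.rew h θ) (D.s i h ω) (D.b i h ω))

/-- The Bellman loss `ℓ_h(V, U, θ, π)` of the leader, with `V` in the role of `U_h` and `U` in the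
role of `U_{h+1}`:
`∑_i (V(s_h^i, a_h^i, b_h^i) - u_h^i - (T_{h+1}^{π, θ} U)(s_{h+1}^i))²`, where `u_h^i` is the reward
that the leader received. -/
def bellmanLoss (ω : Ω) (h : ℕ) (V U : S × A × B → ℝ) (θ : ℕ → Θ) (π : Policy S A B) : ℝ :=
  ∑ i : Fin T, (V (D.sab i h ω) - M.u h (D.sab i h ω) -
    respOp M.η M.base (π (h + 1)) (F.rew (h + 1) (θ (h + 1))) U (D.s i (h + 1) ω)) ^ 2

/-- The joint confidence set for `(U, θ)` under the policy `π`. -/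
def confSet (β : ℝ) (ω : Ω) (π : Policy S A B) : Set ((ℕ → S × A × B → ℝ) × (ℕ → Θ)) :=
  {p | p.1 ∈ F.Val M ∧ p.2 ∈ F.Par M ∧ ∀ h < M.H,
    D.negLogLik F M ω h (p.2 h) ≤ (⨅ θ' : F.par h, D.negLogLik F M ω h θ') + β ∧
    D.bellmanLoss F M ω h (p.1 h) (p.1 (h + 1)) p.2 π ≤
      (⨅ V : F.val h, D.bellmanLoss F M ω h V (p.1 (h + 1)) p.2 π) + (M.H : ℝ) ^ 2 * β}

/-- The pessimistic value of `π`: the infimum over the confidence set of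
`J(π, U, θ) = E_{s_1 ~ ρ_0} [⟨U_1(s_1, ·, ·), π_1 ⊗ ν_1^{π, θ}(·, · | s_1)⟩]`. -/
def pessValue (β : ℝ) (ω : Ω) (π : Policy S A B) : ℝ :=
  ⨅ p : D.confSet F M β ω π,
    ∫ s, respOp M.η M.base (π 0) (F.rew 0 (p.1.2 0)) (p.1.1 0) s ∂M.init

/-- `π̂` is a possible output of the algorithm: it maximizes the pessimistic value over the policies
of the class. -/
def IsOutput (β : ℝ) (ω : Ω) (π : Policy S A B) : Prop :=
  π ∈ F.Pol M ∧ ∀ π' ∈ F.Pol M, D.pessValue F M β ω π' ≤ D.pessValue F M β ω π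

/-- The concentrability of the leader's Bellman residuals, with `π` in the role of the optimal policy:
`max_{U, θ, h} √(‖U_h - 𝕋_h^{π, θ} U_{h+1}‖²_{2, d^π} / ‖U_h - 𝕋_h^{π, θ} U_{h+1}‖²_{2, 𝒟})`.
In `ℝ≥0∞`, with `0 / 0 = 0` and `x / 0 = ∞` for `x > 0`. -/
def CL (Pr : Measure Ω) (π : Policy S A B) : ℝ≥0∞ :=
  ⨆ U ∈ F.Val M, ⨆ θ ∈ F.Par M, ⨆ h : Fin M.H,
    (ENNReal.ofReal (∫ x, F.residual M π U θ h x ^ 2 ∂(M.occupancy π h)) /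
      ENNReal.ofReal ((T : ℝ)⁻¹ * ∑ i : Fin T,
        ∫ ω, F.residual M π U θ h (D.sab i h ω) ^ 2 ∂Pr)) ^ (1 / 2 : ℝ)

/-- The concentrability of the quantal response errors, with `π` in the role of the optimal policy:
`max_{θ, h} √(‖Υ_h^π (r_h^θ - r_h)‖²_{2, d^π} / ‖Υ_h^{π^i} (r_h^θ - r_h)‖²_{2, 𝒟})`, where
`Υ_h` is formed with the true quantal responses. -/
def CF (Pr : Measure Ω) (π : Policy S A B) : ℝ≥0∞ :=
  ⨆ θ ∈ F.Par M, ⨆ h : Fin M.H,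
    (ENNReal.ofReal (∫ x, upsilon M.η M.base (π h) (M.r h)
        (fun y => F.rew h (θ h) y - M.r h y) x.1 x.2.2 ^ 2 ∂(M.occupancy π h)) /
      ENNReal.ofReal ((T : ℝ)⁻¹ * ∑ i : Fin T,
        ∫ ω, upsilon M.η M.base (D.policy i ω h) (M.r h)
          (fun y => F.rew h (θ h) y - M.r h y) (D.s i h ω) (D.b i h ω) ^ 2 ∂Pr)) ^ (1 / 2 : ℝ)

end Data

end LeaderFollower

end

/-!
Fix a step and write `L_i = log (ν^{π^i, θ} / ν^{π^i})(b^i | s^i)` for the log-likelihood ratio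
of a parameter on trajectory `i`. Since the follower is a quantal responder, `η Υ (r^θ - r)` is
`L` centred under the true response `ν` (`mul_upsilon_eq`), and everything about the follower is
a statement about the bounded function `L`, which satisfies `|L| ≤ 2 η` and `∫ exp L dν = 1`.

*Likelihood.* The elementary bound `∫ L² ≤ 8 (1 + η)² (1 - ∫ exp (L / 2))`
(`integral_sq_logRatio_le`; `1 - ∫ exp (L / 2)` is a squared Hellinger distance) turns the
Chernoff bound for `∑ L_i / 2` into `∑ L_i ≤ O(ι) - ∑ E[L_i²] / (8 (1 + η)²)`, uniformly over a
net and hence over all parameters (`Data.IsGenerated.measure_logLik_uniform`).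

*Bellman loss.* For a tuple `(U, π, θ)` with Bellman error `d = U_h - 𝕋_h U_{h+1}` the excess
squared loss at a transition is `d² - 2 d w`, where `w` is the centred value of the next state
and is bounded, so Hoeffding's lemma gives `E exp (-Z / (4 H²)) ≤ exp (-E[d²] / (16 H²))`, and `∑
Z_i ≥ ∑ E[d_i²] / 4 - O(H² ι)` uniformly over the tuples
(`Data.IsGenerated.measure_excess_uniform`).

On the event where both hold, the true parameter together with the value of a policy under it
lies in the confidence set of that policy (`Data.mem_confSet`), and the elements of a confidence
set have `∑ E[L_i²] = O((1 + η)² β)` and `∑ E[d_i²] = O(H² β)`. Pessimism reduces the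
suboptimality of an output to `J(π*) - J(π*, U, θ)` for `(U, θ)` in the confidence set of `π*`.
This difference telescopes along the true trajectory (`integral_stateValue_zero`) into Bellman
errors, controlled by `C_L` and Cauchy-Schwarz, and response errors `(T^{π*, θ} - T^{π*}) U_h`.
The latter are at most `H (E|η Υ (r^θ - r)| + 2 exp (2 η) E[(η Υ (r^θ - r))²])`
(`abs_respOp_sub_le`), whose first-order term has no exponential factor, and are controlled by
`C_F`.
-/

noncomputable section

namespace LeaderFollower

/-! ### Exponentials of bounded log-likelihood ratios -/

section Scalar

theorem integrable_of_abs_le {X : Type*} [MeasurableSpace X] {μ : Measure X} [IsFiniteMeasure μ]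
    {f : X → ℝ} {K : ℝ} (hf : Measurable f) (h : ∀ x, |f x| ≤ K) : Integrable f μ :=
  Integrable.of_bound hf.aestronglyMeasurable K (ae_of_all _ h)

theorem abs_integral_le {X : Type*} [MeasurableSpace X] {μ : Measure X} [IsProbabilityMeasure μ]
    {f : X → ℝ} {K : ℝ} (h : ∀ x, |f x| ≤ K) : |∫ x, f x ∂μ| ≤ K := by
  have := norm_integral_le_of_norm_le_const (μ := μ) (f := f) (C := K) (ae_of_all _ h)
  simpa using this

theorem sq_integral_le {X : Type*} [MeasurableSpace X] {μ : Measure X} [IsProbabilityMeasure μ]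
    {f : X → ℝ} {K : ℝ} (hf : Measurable f) (h : ∀ x, |f x| ≤ K) :
    (∫ x, f x ∂μ) ^ 2 ≤ ∫ x, f x ^ 2 ∂μ := by
  have hm : MemLp f 2 μ := MemLp.of_bound hf.aestronglyMeasurable K (ae_of_all _ h)
  have h1 := variance_nonneg f μ
  rw [variance_eq_sub hm] at h1
  simpa using h1

theorem integral_sub_mean_sq_le {X : Type*} [MeasurableSpace X] {μ : Measure X}
    [IsProbabilityMeasure μ] {f : X → ℝ} {K : ℝ} (hf : Measurable f) (h : ∀ x, |f x| ≤ K) :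
    ∫ x, (f x - ∫ y, f y ∂μ) ^ 2 ∂μ ≤ ∫ x, f x ^ 2 ∂μ := by
  have hm : MemLp f 2 μ := MemLp.of_bound hf.aestronglyMeasurable K (ae_of_all _ h)
  have h1 := variance_eq_sub hm
  rw [variance_eq_integral hf.aemeasurable] at h1
  have h2 : (∫ x, (f ^ 2) x ∂μ) = ∫ x, f x ^ 2 ∂μ := rfl
  nlinarith [sq_nonneg (∫ x, f x ∂μ)]

theorem abs_le_mul_abs_exp_sub_one {η t : ℝ} (ht : |t| ≤ η) :
    |t| ≤ (1 + η) * |Real.exp t - 1| := by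
  have hη : 0 ≤ η := (abs_nonneg t).trans ht
  rcases le_total 0 t with h | h
  · have h1 := Real.add_one_le_exp t
    rw [abs_of_nonneg h, abs_of_nonneg (by linarith)]
    nlinarith
  · have h1 : Real.exp t ≤ 1 := Real.exp_le_one_iff.2 h
    have h2 : (1 + -t) * Real.exp t ≤ 1 := by
      have h3 := Real.add_one_le_exp (-t)
      have h4 : Real.exp (-t) * Real.exp t = 1 := by rw [← Real.exp_add]; simp
      nlinarith [Real.exp_pos t]
    rw [abs_of_nonpos h] at ht ⊢
    rw [abs_of_nonpos (by linarith)]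
    nlinarith

theorem exp_sub_one_sub_le {x m : ℝ} (hx : |x| ≤ m) :
    Real.exp x - 1 - x ≤ Real.exp m * x ^ 2 := by
  have h := Complex.norm_exp_sub_sum_le_norm_mul_exp (x : ℂ) 2
  have h2 : Complex.exp x - ∑ k ∈ Finset.range 2, (x : ℂ) ^ k / (k.factorial : ℂ)
      = ((Real.exp x - 1 - x : ℝ) : ℂ) := by
    simp [Finset.sum_range_succ]; ring
  rw [h2, Complex.norm_real, Complex.norm_real, Real.norm_eq_abs, Real.norm_eq_abs, sq_abs] at h
  have h3 := Real.exp_le_exp.2 hx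
  nlinarith [le_abs_self (Real.exp x - 1 - x), sq_nonneg x]

theorem abs_exp_sub_one_le {x m : ℝ} (hx : |x| ≤ m) :
    |Real.exp x - 1| ≤ |x| + Real.exp m * x ^ 2 := by
  have h1 := exp_sub_one_sub_le hx
  have h2 := Real.add_one_le_exp x
  have h3 := le_abs_self x
  have h4 := neg_abs_le x
  have h5 : 0 ≤ Real.exp m * x ^ 2 := by positivity
  rw [abs_le]
  constructor <;> linarith

variable {X : Type*} [MeasurableSpace X] {ν : Measure X} [IsProbabilityMeasure ν]
  {L : X → ℝ} {η : ℝ}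

/-- The second moment of a bounded log-likelihood ratio is controlled by the squared Hellinger
distance `1 - ∫ exp (L / 2)` of the two laws; since `|log y| ≤ (1 + η) |y - 1|` for
`y ∈ [exp (-η), exp η]`, the constant is polynomial in `η`. -/
theorem integral_sq_logRatio_le (hL : Measurable L) (hb : ∀ x, |L x| ≤ 2 * η)
    (h1 : ∫ x, Real.exp (L x) ∂ν = 1) :
    ∫ x, L x ^ 2 ∂ν ≤ 8 * (1 + η) ^ 2 * (1 - ∫ x, Real.exp (L x / 2) ∂ν) := by
  have i1 : Integrable (fun x => Real.exp (L x)) ν := by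
    refine integrable_of_abs_le (K := Real.exp (2 * η)) (by fun_prop) fun x => ?_
    rw [Real.abs_exp]
    exact Real.exp_le_exp.2 ((le_abs_self _).trans (hb x))
  have i2 : Integrable (fun x => Real.exp (L x / 2)) ν := by
    refine integrable_of_abs_le (K := Real.exp η) (by fun_prop) fun x => ?_
    rw [Real.abs_exp]
    exact Real.exp_le_exp.2 (by linarith [(le_abs_self _).trans (hb x)])
  have i3 : Integrable (fun x => L x ^ 2) ν := by
    refine integrable_of_abs_le (K := (2 * η) ^ 2) (by fun_prop) fun x => ?_
    rw [abs_pow]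
    exact pow_le_pow_left₀ (abs_nonneg _) (hb x) 2
  have key : ∀ x, L x ^ 2 ≤ 4 * (1 + η) ^ 2 *
      (Real.exp (L x) - 2 * Real.exp (L x / 2) + 1) := by
    intro x
    have h2 : |L x / 2| ≤ η := by
      rw [abs_div, abs_two]; linarith [hb x]
    have h3 := pow_le_pow_left₀ (abs_nonneg _) (abs_le_mul_abs_exp_sub_one h2) 2
    rw [mul_pow, sq_abs, sq_abs] at h3
    have h4 : Real.exp (L x) = Real.exp (L x / 2) ^ 2 := by
      rw [← Real.exp_nat_mul]; congr 1; push_cast; ring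
    rw [h4]
    nlinarith
  have h5 := integral_mono i3
    ((((i1.sub (i2.const_mul 2)).add (integrable_const 1))).const_mul (4 * (1 + η) ^ 2)) key
  have h6 : ∫ x, (Real.exp (L x) - 2 * Real.exp (L x / 2) + 1) ∂ν
      = 2 * (1 - ∫ x, Real.exp (L x / 2) ∂ν) := by
    have i4 : Integrable (fun x => Real.exp (L x) - 2 * Real.exp (L x / 2)) ν :=
      i1.sub (i2.const_mul 2)
    rw [integral_add i4 (integrable_const 1),
      integral_sub i1 (i2.const_mul 2), integral_const_mul, h1]
    simp; ring
  calc _ ≤ _ := h5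
    _ = _ := by
      simp only [Pi.add_apply, Pi.sub_apply]
      rw [integral_const_mul, h6]; ring

/-- The total variation distance of two laws in terms of the centred log-likelihood ratio `L - m`.
The first-order term carries no exponential factor; this uses that the normalization
`∫ exp (L - m) = exp (-m)` is at least `1`. -/
theorem integral_abs_exp_sub_one_le {m : ℝ} (hL : Measurable L) (hm : m = ∫ x, L x ∂ν)
    (hb : ∀ x, |L x - m| ≤ 2 * η) (h1 : ∫ x, Real.exp (L x) ∂ν = 1) :
    ∫ x, |Real.exp (L x) - 1| ∂ν ≤
      ∫ x, |L x - m| ∂ν + 2 * Real.exp (2 * η) * ∫ x, (L x - m) ^ 2 ∂ν := by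
  have iΔ : Integrable (fun x => L x - m) ν := integrable_of_abs_le (by fun_prop) hb
  have iL : Integrable L ν := by
    have := iΔ.add (integrable_const m)
    refine this.congr (ae_of_all _ fun x => ?_)
    simp
  have iE : Integrable (fun x => Real.exp (L x - m)) ν := by
    refine integrable_of_abs_le (K := Real.exp (2 * η)) (by fun_prop) fun x => ?_
    rw [Real.abs_exp]
    exact Real.exp_le_exp.2 ((le_abs_self _).trans (hb x))
  have i2 : Integrable (fun x => (L x - m) ^ 2) ν := by
    refine integrable_of_abs_le (K := (2 * η) ^ 2) (by fun_prop) fun x => ?_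
    rw [abs_pow]
    exact pow_le_pow_left₀ (abs_nonneg _) (hb x) 2
  have hexp : ∀ x, Real.exp (L x) = Real.exp m * Real.exp (L x - m) := fun x => by
    rw [← Real.exp_add]; congr 1; ring
  have hmean : ∫ x, (L x - m) ∂ν = 0 := by
    rw [integral_sub iL (integrable_const m)]; simp [hm]
  have hnorm : ∫ x, Real.exp (L x - m) ∂ν = Real.exp (-m) := by
    have : Real.exp m * ∫ x, Real.exp (L x - m) ∂ν = 1 := by
      rw [← integral_const_mul, ← h1]; simp_rw [hexp]
    rw [Real.exp_neg]
    exact eq_inv_of_mul_eq_one_right this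
  set V := ∫ x, (L x - m) ^ 2 ∂ν with hV
  have hlow : Real.exp (-m) - 1 ≤ Real.exp (2 * η) * V := by
    have := integral_mono ((iE.sub (integrable_const 1)).sub iΔ)
      (i2.const_mul (Real.exp (2 * η))) fun x => exp_sub_one_sub_le (hb x)
    rw [integral_const_mul] at this
    simp only [Pi.sub_apply] at this
    have h7 : ∫ x, (Real.exp (L x - m) - 1 - (L x - m)) ∂ν = Real.exp (-m) - 1 := by
      have i4 : Integrable (fun x => Real.exp (L x - m) - 1) ν := iE.sub (integrable_const 1)
      rw [integral_sub i4 iΔ, integral_sub iE (integrable_const 1),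
        hmean, hnorm]
      simp
    rwa [h7] at this
  have hge : 1 ≤ Real.exp (-m) := by
    have := integral_mono (iΔ.add (integrable_const 1)) iE
      fun x => Real.add_one_le_exp (L x - m)
    simp only [Pi.add_apply] at this
    rw [integral_add iΔ (integrable_const 1), hmean, hnorm] at this
    simpa using this
  have hm1 : Real.exp m ≤ 1 := by
    have := Real.exp_pos m
    rw [Real.exp_neg] at hge
    exact (one_le_inv₀ this).1 hge
  have key : ∀ x, |Real.exp (L x) - 1| ≤
      (|L x - m| + Real.exp (2 * η) * (L x - m) ^ 2) + (Real.exp (-m) - 1) := by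
    intro x
    have h8 : Real.exp (L x) - 1 = Real.exp m * (Real.exp (L x - m) - Real.exp (-m)) := by
      rw [hexp, mul_sub, ← Real.exp_add m (-m)]; simp
    rw [h8, abs_mul, Real.abs_exp]
    have h9 : |Real.exp (L x - m) - Real.exp (-m)| ≤
        |Real.exp (L x - m) - 1| + (Real.exp (-m) - 1) := by
      have := abs_sub (Real.exp (L x - m) - 1) (Real.exp (-m) - 1)
      rw [abs_of_nonneg (by linarith : 0 ≤ Real.exp (-m) - 1)] at this
      simpa using this
    have h10 := abs_exp_sub_one_le (hb x)
    nlinarith [abs_nonneg (Real.exp (L x - m) - Real.exp (-m))]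
  have i5 : Integrable (fun x => |Real.exp (L x) - 1|) ν := by
    simp_rw [hexp]
    exact ((iE.const_mul _).sub (integrable_const 1)).abs
  have h11 := integral_mono i5
    ((iΔ.abs.add (i2.const_mul (Real.exp (2 * η)))).add
      (integrable_const (Real.exp (-m) - 1))) key
  have i6 : Integrable (fun x => |L x - m| + Real.exp (2 * η) * (L x - m) ^ 2) ν :=
    iΔ.abs.add (i2.const_mul (Real.exp (2 * η)))
  simp only [Pi.add_apply] at h11
  rw [integral_add i6 (integrable_const _),
    integral_add iΔ.abs (i2.const_mul (Real.exp (2 * η))), integral_const_mul] at h11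
  simp only [integral_const, probReal_univ, one_smul] at h11
  linarith

end Scalar

/-! ### Quantal responses as probability kernels -/

section ResponseLemmas

variable {Z A B : Type*} [MeasurableSpace Z] [MeasurableSpace A] [MeasurableSpace B]

theorem measurable_avgReward {α : Kernel (Z × B) A} [IsSFiniteKernel α] {f : Z × A × B → ℝ}
    (hf : Measurable f) : Measurable (fun p : Z × B => avgReward α f p.1 p.2) := by
  have h : StronglyMeasurable (fun q : (Z × B) × A => f (q.1.1, q.2, q.1.2)) :=
    (hf.comp (by fun_prop)).stronglyMeasurable
  exact (h.integral_kernel_prod_right' (κ := α)).measurable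

theorem measurable_avgReward_right {α : Kernel (Z × B) A} [IsSFiniteKernel α]
    {f : Z × A × B → ℝ} (hf : Measurable f) (z : Z) : Measurable (avgReward α f z) :=
  (measurable_avgReward hf).comp measurable_prodMk_left

variable {η : ℝ} {base : Measure B} [IsFiniteMeasure base]
  {α : Kernel (Z × B) A} [IsMarkovKernel α] {f f' U : Z × A × B → ℝ} {K ε : ℝ}

theorem abs_avgReward_le (hU : ∀ x, |U x| ≤ K) (z : Z) (b : B) : |avgReward α U z b| ≤ K :=
  abs_integral_le fun a => hU (z, a, b)

/-- A candidate reward of the follower: measurable with values in `[0, 1]`. -/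
def IsReward {Y : Type*} [MeasurableSpace Y] (f : Y → ℝ) : Prop :=
  Measurable f ∧ ∀ y, f y ∈ Icc (0 : ℝ) 1

theorem IsReward.abs_le_one {Y : Type*} [MeasurableSpace Y] {f : Y → ℝ} (hf : IsReward f) (y : Y) :
    |f y| ≤ 1 := by
  have := hf.2 y
  rw [abs_le]; constructor <;> linarith [this.1, this.2]

theorem IsReward.abs_sub_le {Y : Type*} [MeasurableSpace Y] {f f' : Y → ℝ} (hf : IsReward f)
    (hf' : IsReward f') (y : Y) : |f y - f' y| ≤ 1 := by
  have h1 := hf.2 y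
  have h2 := hf'.2 y
  rw [abs_le]; constructor <;> linarith [h1.1, h1.2, h2.1, h2.2]

theorem integrable_avgReward_slice (hU : Measurable U) (hK : ∀ x, |U x| ≤ K) (z : Z) (b : B) :
    Integrable (fun a => U (z, a, b)) (α (z, b)) :=
  integrable_of_abs_le (hU.comp (by fun_prop)) fun a => hK _

theorem avgReward_sub (hf : IsReward f) (hf' : IsReward f') (z : Z) (b : B) :
    avgReward α (fun y => f y - f' y) z b = avgReward α f z b - avgReward α f' z b :=
  integral_sub (integrable_avgReward_slice hf.1 hf.abs_le_one z b)
    (integrable_avgReward_slice hf'.1 hf'.abs_le_one z b)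

theorem avgReward_mem (hf : IsReward f) (z : Z) (b : B) : avgReward α f z b ∈ Icc (0 : ℝ) 1 := by
  constructor
  · exact integral_nonneg fun a => (hf.2 _).1
  · exact (le_abs_self _).trans (abs_avgReward_le hf.abs_le_one z b)

/-- The normalizing constant `∑_b exp (η f^α(z, b))` of the quantal response. -/
def partition (η : ℝ) (base : Measure B) (α : Kernel (Z × B) A) (f : Z × A × B → ℝ) (z : Z) : ℝ :=
  ∫ b, Real.exp (η * avgReward α f z b) ∂base

theorem measurable_partition (hf : Measurable f) : Measurable (partition η base α f) := by
  have h : StronglyMeasurable (fun q : Z × B => Real.exp (η * avgReward α f q.1 q.2)) :=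
    (((measurable_avgReward hf).const_mul η).exp).stronglyMeasurable
  exact h.integral_prod_right'.measurable

theorem integrable_exp_avgReward (hη : 0 ≤ η) (hf : IsReward f) (z : Z) :
    Integrable (fun b => Real.exp (η * avgReward α f z b)) base := by
  refine integrable_of_abs_le (K := Real.exp η)
    (((measurable_avgReward_right hf.1 z).const_mul η).exp) fun b => ?_
  rw [Real.abs_exp, Real.exp_le_exp]
  have := avgReward_mem (α := α) hf z b
  nlinarith [this.2]

theorem one_le_partition (hη : 0 ≤ η) (hbase : 1 ≤ base univ) (hf : IsReward f) (z : Z) :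
    1 ≤ partition η base α f z := by
  have h1 : 1 ≤ base.real univ := by
    have := ENNReal.toReal_mono (measure_ne_top base univ) hbase
    simpa [Measure.real] using this
  have h2 := integral_mono (integrable_const (μ := base) (1 : ℝ))
    (integrable_exp_avgReward (α := α) hη hf z) fun b => by
      have := avgReward_mem (α := α) hf z b
      exact Real.one_le_exp (mul_nonneg hη this.1)
  simp only [integral_const, smul_eq_mul, mul_one] at h2
  exact h1.trans h2

omit [IsFiniteMeasure base] [IsMarkovKernel α] in
theorem mul_softValue (hη : 0 < η) (z : Z) :
    η * softValue η base α f z = Real.log (partition η base α f z) := by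
  unfold softValue partition
  field_simp

theorem measurable_advantage (hf : Measurable f) :
    Measurable (fun p : Z × B => advantage η base α f p.1 p.2) := by
  have h := (measurable_partition (η := η) (base := base) (α := α) hf).log.const_mul η⁻¹
  exact (measurable_avgReward hf).sub (h.comp measurable_fst)

theorem responseDensity_eq (hη : 0 < η) (hbase : 1 ≤ base univ) (hf : IsReward f) (z : Z) (b : B) :
    responseDensity η base α f z b =
      Real.exp (η * avgReward α f z b) / partition η base α f z := by
  have h1 := one_le_partition (α := α) hη.le hbase hf z
  rw [responseDensity, advantage, mul_sub, mul_softValue hη, Real.exp_sub,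
    Real.exp_log (by linarith)]

theorem measurable_responseDensity (hf : Measurable f) :
    Measurable (fun p : Z × B => responseDensity η base α f p.1 p.2) :=
  ((measurable_advantage hf).const_mul η).exp

theorem integrable_responseDensity (hη : 0 < η) (hbase : 1 ≤ base univ) (hf : IsReward f) (z : Z) :
    Integrable (responseDensity η base α f z) base := by
  have : responseDensity η base α f z =
      fun b => Real.exp (η * avgReward α f z b) / partition η base α f z :=
    funext fun b => responseDensity_eq hη hbase hf z b
  rw [this]
  exact (integrable_exp_avgReward hη.le hf z).div_const _

theorem integral_responseDensity (hη : 0 < η) (hbase : 1 ≤ base univ) (hf : IsReward f) (z : Z) :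
    ∫ b, responseDensity η base α f z b ∂base = 1 := by
  have h1 := one_le_partition (α := α) hη.le hbase hf z
  simp_rw [responseDensity_eq hη hbase hf]
  rw [integral_div]
  exact div_self (zero_lt_one.trans_le h1).ne'

theorem measurable_uncurry_ofReal_responseDensity (hf : Measurable f) :
    Measurable (Function.uncurry fun z b => ENNReal.ofReal (responseDensity η base α f z b)) :=
  (measurable_responseDensity hf).ennreal_ofReal

theorem quantalResponse_apply (hf : Measurable f) (z : Z) :
    quantalResponse η base α f z =
      base.withDensity fun b => ENNReal.ofReal (responseDensity η base α f z b) := by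
  rw [quantalResponse, Kernel.withDensity_apply _ (measurable_uncurry_ofReal_responseDensity hf),
    Kernel.const_apply]

theorem isMarkovKernel_quantalResponse (hη : 0 < η) (hbase : 1 ≤ base univ) (hf : IsReward f) :
    IsMarkovKernel (quantalResponse η base α f) := by
  refine ⟨fun z => ⟨?_⟩⟩
  rw [quantalResponse_apply hf.1, withDensity_apply _ MeasurableSet.univ, Measure.restrict_univ,
    ← ofReal_integral_eq_lintegral_ofReal (integrable_responseDensity hη hbase hf z)
      (ae_of_all _ fun b => (Real.exp_pos _).le), integral_responseDensity hη hbase hf]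
  simp

theorem isMarkovKernel_jointResponse (hη : 0 < η) (hbase : 1 ≤ base univ) (hf : IsReward f) :
    IsMarkovKernel (jointResponse η base α f) := by
  have := isMarkovKernel_quantalResponse (α := α) hη hbase hf
  unfold jointResponse
  infer_instance

theorem integral_quantalResponse (hf : Measurable f) (z : Z) (φ : B → ℝ) :
    ∫ b, φ b ∂(quantalResponse η base α f z) = ∫ b, responseDensity η base α f z b * φ b ∂base := by
  have hm : Measurable (fun b => ENNReal.ofReal (responseDensity η base α f z b)) :=
    ((measurable_responseDensity hf).comp measurable_prodMk_left).ennreal_ofReal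
  rw [quantalResponse_apply hf, integral_withDensity_eq_integral_toReal_smul hm
    (ae_of_all _ fun b => ENNReal.ofReal_lt_top)]
  refine integral_congr_ae (ae_of_all _ fun b => ?_)
  simp only [smul_eq_mul]
  rw [ENNReal.toReal_ofReal (show 0 ≤ responseDensity η base α f z b from (Real.exp_pos _).le)]

theorem respOp_eq (hη : 0 < η) (hbase : 1 ≤ base univ) (hf : IsReward f) (hU : Measurable U)
    (hK : ∀ x, |U x| ≤ K) (z : Z) :
    respOp η base α f U z = ∫ b, avgReward α U z b ∂(quantalResponse η base α f z) := by
  have := isMarkovKernel_quantalResponse (α := α) hη hbase hf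
  unfold respOp jointResponse
  rw [integral_compProd]
  · rfl
  · exact integrable_of_abs_le (hU.comp (by fun_prop)) fun q => hK _

theorem measurable_respOp (hη : 0 < η) (hbase : 1 ≤ base univ) (hf : IsReward f)
    (hU : Measurable U) : Measurable (respOp η base α f U) := by
  have := isMarkovKernel_jointResponse (α := α) hη hbase hf
  have h : StronglyMeasurable (fun q : Z × (B × A) => U (q.1, q.2.2, q.2.1)) :=
    (hU.comp (by fun_prop)).stronglyMeasurable
  exact (h.integral_kernel_prod_right' (κ := jointResponse η base α f)).measurable

theorem abs_respOp_le (hη : 0 < η) (hbase : 1 ≤ base univ) (hf : IsReward f)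
    (hK : ∀ x, |U x| ≤ K) (z : Z) : |respOp η base α f U z| ≤ K := by
  have := isMarkovKernel_jointResponse (α := α) hη hbase hf
  exact abs_integral_le fun q => hK _

/-! ### The log-likelihood ratio of two quantal responses -/

/-- The log-likelihood ratio `log (ν^f(b | z) / ν^{f'}(b | z))` of the quantal responses to the same
prescription under the rewards `f` and `f'`. -/
def logRatio (η : ℝ) (base : Measure B) (α : Kernel (Z × B) A) (f f' : Z × A × B → ℝ)
    (z : Z) (b : B) : ℝ :=
  η * advantage η base α f z b - η * advantage η base α f' z b

theorem measurable_logRatio (hf : Measurable f) (hf' : Measurable f') :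
    Measurable (fun p : Z × B => logRatio η base α f f' p.1 p.2) :=
  ((measurable_advantage hf).const_mul η).sub ((measurable_advantage hf').const_mul η)

theorem measurable_logRatio_right (hf : Measurable f) (hf' : Measurable f') (z : Z) :
    Measurable (logRatio η base α f f' z) :=
  (measurable_logRatio hf hf').comp measurable_prodMk_left

omit [IsFiniteMeasure base] [IsMarkovKernel α] in
theorem logRatio_eq (hη : 0 < η) (z : Z) (b : B) :
    logRatio η base α f f' z b = η * (avgReward α f z b - avgReward α f' z b) -
      (Real.log (partition η base α f z) - Real.log (partition η base α f' z)) := by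
  rw [logRatio, advantage, advantage, mul_sub, mul_sub, mul_softValue hη, mul_softValue hη]
  ring

theorem log_partition_le (hη : 0 < η) (hbase : 1 ≤ base univ) (hf : IsReward f)
    (hf' : IsReward f') (hε : ∀ x, |f x - f' x| ≤ ε) (z : Z) :
    Real.log (partition η base α f z) ≤ Real.log (partition η base α f' z) + η * ε := by
  have h1 := one_le_partition (α := α) hη.le hbase hf z
  have h2 := one_le_partition (α := α) hη.le hbase hf' z
  rw [← Real.log_exp (η * ε), ← Real.log_mul (by linarith) (Real.exp_pos _).ne']
  refine Real.log_le_log (by linarith) ?_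
  unfold partition
  rw [← integral_mul_const]
  refine integral_mono (integrable_exp_avgReward hη.le hf z)
    ((integrable_exp_avgReward hη.le hf' z).mul_const _) fun b => ?_
  simp only
  rw [← Real.exp_add, Real.exp_le_exp, ← mul_add]
  have h3 := (le_abs_self _).trans (abs_avgReward_le (α := α) hε z b)
  rw [avgReward_sub hf hf'] at h3
  exact mul_le_mul_of_nonneg_left (by linarith) hη.le

theorem abs_logRatio_le (hη : 0 < η) (hbase : 1 ≤ base univ) (hf : IsReward f)
    (hf' : IsReward f') (hε : ∀ x, |f x - f' x| ≤ ε) (z : Z) (b : B) :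
    |logRatio η base α f f' z b| ≤ 2 * η * ε := by
  have h1 := log_partition_le (α := α) hη hbase hf hf' hε z
  have h2 := log_partition_le (α := α) hη hbase hf' hf
    (fun x => by rw [abs_sub_comm]; exact hε x) z
  have h3 := abs_avgReward_le (α := α) hε z b
  rw [avgReward_sub hf hf', abs_le] at h3
  rw [logRatio_eq hη, abs_le]
  constructor
  · nlinarith [h3.1]
  · nlinarith [h3.2]

theorem abs_logRatio_le_two_mul (hη : 0 < η) (hbase : 1 ≤ base univ) (hf : IsReward f)
    (hf' : IsReward f') (z : Z) (b : B) : |logRatio η base α f f' z b| ≤ 2 * η := by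
  simpa using abs_logRatio_le hη hbase hf hf' (hf.abs_sub_le hf') z b

omit [IsFiniteMeasure base] [IsMarkovKernel α] in
theorem responseDensity_mul_exp_logRatio (z : Z) (b : B) :
    responseDensity η base α f' z b * Real.exp (logRatio η base α f f' z b) =
      responseDensity η base α f z b := by
  rw [responseDensity, responseDensity, logRatio, ← Real.exp_add]
  congr 1; ring

theorem integral_exp_logRatio (hη : 0 < η) (hbase : 1 ≤ base univ) (hf : IsReward f)
    (hf' : Measurable f') (z : Z) :
    ∫ b, Real.exp (logRatio η base α f f' z b) ∂(quantalResponse η base α f' z) = 1 := by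
  rw [integral_quantalResponse hf']
  simp_rw [responseDensity_mul_exp_logRatio]
  exact integral_responseDensity hη hbase hf z

/-- `η Υ (f - f')` is the log-likelihood ratio, centred under the quantal response to `f'`. -/
theorem mul_upsilon_eq (hη : 0 < η) (hbase : 1 ≤ base univ) (hf : IsReward f)
    (hf' : IsReward f') (z : Z) (b : B) :
    η * upsilon η base α f' (fun y => f y - f' y) z b =
      logRatio η base α f f' z b -
        ∫ b', logRatio η base α f f' z b' ∂(quantalResponse η base α f' z) := by
  have := isMarkovKernel_quantalResponse (α := α) hη hbase hf'
  have hi : ∀ {g : Z × A × B → ℝ}, IsReward g →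
      Integrable (avgReward α g z) (quantalResponse η base α f' z) := fun hg =>
    integrable_of_abs_le (measurable_avgReward_right hg.1 z) (abs_avgReward_le hg.abs_le_one z)
  rw [upsilon, respOp_eq (U := fun y => f y - f' y) hη hbase hf' (hf.1.sub hf'.1)
    (hf.abs_sub_le hf')]
  simp_rw [avgReward_sub hf hf', logRatio_eq hη]
  have i1 : Integrable (fun b => η * (avgReward α f z b - avgReward α f' z b))
      (quantalResponse η base α f' z) := ((hi hf).sub (hi hf')).const_mul η
  rw [integral_sub i1 (integrable_const _), integral_const_mul]
  simp
  ring

theorem abs_upsilon_le (hη : 0 < η) (hbase : 1 ≤ base univ) (hf' : IsReward f')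
    (hK : ∀ x, |U x| ≤ K) (z : Z) (b : B) : |upsilon η base α f' U z b| ≤ 2 * K := by
  have h1 := abs_avgReward_le (α := α) hK z b
  have h2 := abs_respOp_le (α := α) hη hbase hf' hK z
  unfold upsilon
  rw [abs_le] at *
  constructor <;> linarith [h1.1, h1.2, h2.1, h2.2]

theorem measurable_upsilon (hη : 0 < η) (hbase : 1 ≤ base univ) (hf' : IsReward f')
    (hU : Measurable U) : Measurable (fun p : Z × B => upsilon η base α f' U p.1 p.2) :=
  (measurable_avgReward hU).sub ((measurable_respOp hη hbase hf' hU).comp measurable_fst)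

/-- The effect on `T U` of replacing the follower's reward `f'` by `f`: to first order it is
the mean of `|η Υ (f - f')|` under the quantal response to `f'`. -/
theorem abs_respOp_sub_le (hη : 0 < η) (hbase : 1 ≤ base univ) (hf : IsReward f)
    (hf' : IsReward f') (hU : Measurable U) (hK : ∀ x, |U x| ≤ K) (z : Z) :
    |respOp η base α f U z - respOp η base α f' U z| ≤
      K * (∫ b, |η * upsilon η base α f' (fun y => f y - f' y) z b|
          ∂(quantalResponse η base α f' z) +
        2 * Real.exp (2 * η) * ∫ b, (η * upsilon η base α f' (fun y => f y - f' y) z b) ^ 2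
          ∂(quantalResponse η base α f' z)) := by
  have := isMarkovKernel_quantalResponse (α := α) hη hbase hf'
  have hLm := measurable_logRatio_right (η := η) (base := base) (α := α) hf.1 hf'.1 z
  have hLb := abs_logRatio_le_two_mul (base := base) (α := α) hη hbase hf hf' z
  have hL1 := integral_exp_logRatio (base := base) (α := α) hη hbase hf hf'.1 z
  have hυ := abs_upsilon_le (α := α) hη hbase hf' (hf.abs_sub_le hf') z
  have hΔ : ∀ b, |logRatio η base α f f' z b -
      ∫ b', logRatio η base α f f' z b' ∂(quantalResponse η base α f' z)| ≤ 2 * η := fun b => by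
    rw [← mul_upsilon_eq hη hbase hf hf', abs_mul, abs_of_pos hη]
    nlinarith [hυ b]
  have key := integral_abs_exp_sub_one_le hLm rfl hΔ hL1
  simp_rw [← mul_upsilon_eq hη hbase hf hf'] at key
  obtain ⟨b0⟩ : Nonempty B := by
    by_contra hne
    rw [not_nonempty_iff] at hne
    have : base univ = 0 := by rw [univ_eq_empty_iff.2 hne, measure_empty]
    simp [this] at hbase
  have hUm := measurable_avgReward_right (α := α) hU z
  have hUb := abs_avgReward_le (α := α) hK z
  have hK0 : 0 ≤ K := (abs_nonneg _).trans (hUb b0)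
  have iU : Integrable (avgReward α U z) (quantalResponse η base α f' z) :=
    integrable_of_abs_le hUm hUb
  have hEb : ∀ b, |Real.exp (logRatio η base α f f' z b)| ≤ Real.exp (2 * η) := fun b => by
    rw [Real.abs_exp, Real.exp_le_exp]
    exact (le_abs_self _).trans (hLb b)
  have iE : Integrable (fun b => Real.exp (logRatio η base α f f' z b))
      (quantalResponse η base α f' z) := integrable_of_abs_le hLm.exp hEb
  have iEU : Integrable (fun b => Real.exp (logRatio η base α f f' z b) * avgReward α U z b)
      (quantalResponse η base α f' z) := by
    refine integrable_of_abs_le (K := Real.exp (2 * η) * K) (hLm.exp.mul hUm) fun b => ?_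
    rw [abs_mul]
    exact mul_le_mul (hEb b) (hUb b) (abs_nonneg _) (Real.exp_pos _).le
  have h1 : respOp η base α f U z = ∫ b, Real.exp (logRatio η base α f f' z b) * avgReward α U z b
      ∂(quantalResponse η base α f' z) := by
    rw [respOp_eq hη hbase hf hU hK, integral_quantalResponse hf.1,
      integral_quantalResponse hf'.1]
    simp_rw [← mul_assoc, responseDensity_mul_exp_logRatio]
  rw [h1, respOp_eq hη hbase hf' hU hK, ← integral_sub iEU iU]
  refine (abs_integral_le_integral_abs).trans (le_trans ?_ (mul_le_mul_of_nonneg_left key hK0))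
  rw [← integral_const_mul]
  refine integral_mono (iEU.sub iU).abs ((iE.sub (integrable_const 1)).abs.const_mul K) fun b => ?_
  rw [← sub_one_mul, abs_mul, mul_comm K]
  exact mul_le_mul_of_nonneg_left (hUb b) (abs_nonneg _)

/-- A policy read off from a labelled family at one label has the same `Υ` as the family itself.
Through this the random announced policies become one kernel of the label and the state. -/
theorem upsilon_comap {X : Type*} [MeasurableSpace X] (hη : 0 < η) (hbase : 1 ≤ base univ)
    (κ : Kernel ((X × Z) × B) A) [IsMarkovKernel κ] (hf : IsReward f) (hU : Measurable U)
    (hK : ∀ y, |U y| ≤ K) (x : X) (z : Z) (b : B) :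
    upsilon η base (κ.comap (fun q : Z × B => ((x, q.1), q.2)) (by fun_prop)) f U z b =
      upsilon η base κ (fun q => f (q.1.2, q.2.1, q.2.2)) (fun q => U (q.1.2, q.2.1, q.2.2))
        (x, z) b := by
  have hf' : IsReward (fun q : (X × Z) × A × B => f (q.1.2, q.2.1, q.2.2)) :=
    ⟨hf.1.comp (by fun_prop), fun q => hf.2 _⟩
  have hU' : Measurable (fun q : (X × Z) × A × B => U (q.1.2, q.2.1, q.2.2)) :=
    hU.comp (by fun_prop)
  unfold upsilon
  rw [respOp_eq hη hbase hf hU hK, respOp_eq hη hbase hf' hU' (fun q => hK _),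
    integral_quantalResponse hf.1, integral_quantalResponse hf'.1]
  rfl

end ResponseLemmas

/-! ### The law of the data -/

theorem Game.isReward_r {S A B : Type*} [MeasurableSpace S] [MeasurableSpace A]
    [MeasurableSpace B] (M : Game S A B) (h : ℕ) : IsReward (M.r h) := ⟨M.r_meas h, M.r_mem h⟩

theorem Game.one_le_H {S A B : Type*} [MeasurableSpace S] [MeasurableSpace A]
    [MeasurableSpace B] (M : Game S A B) : (1 : ℝ) ≤ M.H := by exact_mod_cast M.H_pos

/-- A function of `(s, a, b)`, seen as a function of the labelled state and the actions. -/
def lift (X : Type*) {S A B : Type*} (f : S × A × B → ℝ) (q : (X × S) × A × B) : ℝ :=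
  f (q.1.2, q.2.1, q.2.2)

section Lift

variable {X S A B : Type*} [MeasurableSpace X] [MeasurableSpace S] [MeasurableSpace A]
  [MeasurableSpace B] {f : S × A × B → ℝ}

theorem measurable_lift (hf : Measurable f) : Measurable (lift X f) := hf.comp (by fun_prop)

theorem IsReward.lift (hf : IsReward f) : IsReward (lift X f) :=
  ⟨measurable_lift hf.1, fun _ => hf.2 _⟩

end Lift

namespace Data

variable {Ω X S A B Θ : Type*} [MeasurableSpace Ω] [MeasurableSpace X] [MeasurableSpace S]
  [MeasurableSpace A] [MeasurableSpace B] {T : ℕ}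
  {D : Data Ω X S A B T} {M : Game S A B} {Pr : Measure Ω}

/-- The quantal response to the policy of a labelled trajectory, as a kernel of the label and
the state. -/
def response (D : Data Ω X S A B T) (M : Game S A B) (h : ℕ) : Kernel (X × S) B :=
  quantalResponse M.η M.base (D.beh h) (lift X (M.r h))

theorem IsGenerated.isMarkovKernel_response (hD : D.IsGenerated M Pr) (h : ℕ) :
    IsMarkovKernel (D.response M h) := by
  have := hD.beh_markov h
  exact isMarkovKernel_quantalResponse M.η_pos M.one_le_base (M.isReward_r h).lift

theorem IsGenerated.measurable_sab (hD : D.IsGenerated M Pr) (i : Fin T) (h : ℕ) :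
    Measurable (D.sab i h) :=
  (hD.s_meas i h).prodMk ((hD.a_meas i h).prodMk (hD.b_meas i h))

theorem IsGenerated.measurable_hist (hD : D.IsGenerated M Pr) (i : Fin T) (h : ℕ) :
    Measurable (D.hist i h) :=
  (hD.label_meas i).prodMk
    ((measurable_pi_lambda (fun ω (k : Fin h) => D.sab i k ω) fun k => hD.measurable_sab i k).prodMk
      (hD.s_meas i h))

variable [IsProbabilityMeasure Pr]

/-- The conditional law of one step, with the follower's draw, the leader's draw and the transition
written as iterated integrals. -/
theorem IsGenerated.lintegral_step (hD : D.IsGenerated M Pr) (i : Fin T) {h : ℕ} (hh : h < M.H)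
    {φ : (X × (Fin h → S × A × B) × S) × (B × A) × S → ℝ≥0∞} (hφ : Measurable φ) :
    ∫⁻ ω, φ (D.hist i h ω, (D.b i h ω, D.a i h ω), D.s i (h + 1) ω) ∂Pr =
      ∫⁻ ω, ∫⁻ b, ∫⁻ a, ∫⁻ s', φ (D.hist i h ω, (b, a), s') ∂(M.P h (D.s i h ω, a, b))
        ∂(D.beh h ((D.label i ω, D.s i h ω), b)) ∂(D.response M h (D.label i ω, D.s i h ω))
        ∂Pr := by
  have := hD.beh_markov h
  have := hD.isMarkovKernel_response h
  have hj : IsMarkovKernel (jointResponse M.η M.base (D.beh h)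
      (fun q : (X × S) × A × B => M.r h (q.1.2, q.2.1, q.2.2))) :=
    isMarkovKernel_jointResponse M.η_pos M.one_le_base (M.isReward_r h).lift
  have hq : IsMarkovKernel (quantalResponse M.η M.base (D.beh h)
      (fun q : (X × S) × A × B => M.r h (q.1.2, q.2.1, q.2.2))) := hD.isMarkovKernel_response h
  have hs : IsMarkovKernel (D.stepKernel M h) := by unfold stepKernel; infer_instance
  have hm : Measurable fun ω => (D.hist i h ω, (D.b i h ω, D.a i h ω), D.s i (h + 1) ω) :=
    (hD.measurable_hist i h).prodMk (((hD.b_meas i h).prodMk (hD.a_meas i h)).prodMk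
      (hD.s_meas i (h + 1)))
  rw [← lintegral_map hφ hm, hD.step_law i h hh, Measure.lintegral_compProd hφ,
    lintegral_map ?_ (hD.measurable_hist i h)]
  · refine lintegral_congr fun ω => ?_
    rw [Kernel.comap_apply, stepKernel, Kernel.lintegral_compProd _ _ _
      (f := fun p => φ (D.hist i h ω, p)) (hφ.comp (by fun_prop)),
      jointResponse, Kernel.lintegral_compProd]
    · rfl
    · refine Measurable.lintegral_kernel_prod_right' (κ := Kernel.comap (Kernel.comap (M.P h)
        (fun q : (X × S) × (B × A) => (q.1.2, q.2.2, q.2.1)) (by fun_prop))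
        (fun q : B × A => ((D.label i ω, D.s i h ω), q)) (by fun_prop))
        (f := fun p : (B × A) × S => φ (D.hist i h ω, p)) (hφ.comp (by fun_prop))
  · exact Measurable.lintegral_kernel_prod_right' hφ

theorem IsGenerated.map_response (hD : D.IsGenerated M Pr) (i : Fin T) {h : ℕ} (hh : h < M.H) :
    Pr.map (fun ω => ((D.label i ω, D.s i h ω), D.b i h ω)) =
      (Pr.map fun ω => (D.label i ω, D.s i h ω)) ⊗ₘ D.response M h := by
  have := hD.beh_markov h
  have := hD.isMarkovKernel_response h
  have h1 : Measurable fun ω => (D.label i ω, D.s i h ω) :=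
    (hD.label_meas i).prodMk (hD.s_meas i h)
  refine Measure.ext_of_lintegral _ fun φ hφ => ?_
  rw [lintegral_map hφ (h1.prodMk (hD.b_meas i h)), Measure.lintegral_compProd hφ,
    lintegral_map (Measurable.lintegral_kernel_prod_right' hφ) h1]
  have e := hD.lintegral_step i hh
    (φ := fun q => φ ((q.1.1, q.1.2.2), q.2.1.1)) (hφ.comp (by fun_prop))
  simp only [lintegral_const, measure_univ, mul_one] at e
  exact e

theorem IsGenerated.map_transition (hD : D.IsGenerated M Pr) (i : Fin T) {h : ℕ} (hh : h < M.H) :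
    Pr.map (fun ω => (D.sab i h ω, D.s i (h + 1) ω)) = (Pr.map (D.sab i h)) ⊗ₘ M.P h := by
  have := hD.beh_markov h
  have h1 := hD.measurable_sab i h
  refine Measure.ext_of_lintegral _ fun φ hφ => ?_
  have hi : Measurable fun x => ∫⁻ s', φ (x, s') ∂(M.P h x) :=
    Measurable.lintegral_kernel_prod_right' hφ
  rw [lintegral_map hφ (h1.prodMk (hD.s_meas i (h + 1))), Measure.lintegral_compProd hφ,
    lintegral_map hi h1]
  have e1 := hD.lintegral_step i hh
    (φ := fun q => φ ((q.1.2.2, q.2.1.2, q.2.1.1), q.2.2)) (hφ.comp (by fun_prop))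
  have e2 := hD.lintegral_step i hh
    (φ := fun q => ∫⁻ s', φ ((q.1.2.2, q.2.1.2, q.2.1.1), s') ∂(M.P h (q.1.2.2, q.2.1.2, q.2.1.1)))
    (hi.comp (g := fun x => ∫⁻ s', φ (x, s') ∂(M.P h x))
      (f := fun q : (X × (Fin h → S × A × B) × S) × (B × A) × S =>
        (q.1.2.2, q.2.1.2, q.2.1.1)) (by fun_prop))
  simp only [lintegral_const, measure_univ, mul_one] at e2
  exact e1.trans e2.symm

theorem IsGenerated.integral_response (hD : D.IsGenerated M Pr) (i : Fin T) {h : ℕ}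
    (hh : h < M.H) {φ : (X × S) × B → ℝ} {K : ℝ} (hφ : Measurable φ) (hK : ∀ q, |φ q| ≤ K) :
    ∫ ω, φ ((D.label i ω, D.s i h ω), D.b i h ω) ∂Pr =
      ∫ ω, ∫ b, φ ((D.label i ω, D.s i h ω), b) ∂(D.response M h (D.label i ω, D.s i h ω)) ∂Pr := by
  have := hD.isMarkovKernel_response h
  have h1 : Measurable fun ω => (D.label i ω, D.s i h ω) :=
    (hD.label_meas i).prodMk (hD.s_meas i h)
  have := Measure.isProbabilityMeasure_map (μ := Pr) h1.aemeasurable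
  have hi : StronglyMeasurable fun x => ∫ b, φ (x, b) ∂(D.response M h x) :=
    hφ.stronglyMeasurable.integral_kernel_prod_right'
  rw [← integral_map (h1.prodMk (hD.b_meas i h)).aemeasurable hφ.aestronglyMeasurable,
    hD.map_response i hh, Measure.integral_compProd (integrable_of_abs_le hφ hK),
    integral_map h1.aemeasurable hi.aestronglyMeasurable]

theorem IsGenerated.integral_transition (hD : D.IsGenerated M Pr) (i : Fin T) {h : ℕ}
    (hh : h < M.H) {φ : (S × A × B) × S → ℝ} {K : ℝ} (hφ : Measurable φ) (hK : ∀ q, |φ q| ≤ K) :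
    ∫ ω, φ (D.sab i h ω, D.s i (h + 1) ω) ∂Pr =
      ∫ ω, ∫ s', φ (D.sab i h ω, s') ∂(M.P h (D.sab i h ω)) ∂Pr := by
  have h1 := hD.measurable_sab i h
  have := Measure.isProbabilityMeasure_map (μ := Pr) h1.aemeasurable
  have hi : StronglyMeasurable fun x => ∫ s', φ (x, s') ∂(M.P h x) :=
    hφ.stronglyMeasurable.integral_kernel_prod_right'
  rw [← integral_map (h1.prodMk (hD.s_meas i (h + 1))).aemeasurable hφ.aestronglyMeasurable,
    hD.map_transition i hh, Measure.integral_compProd (integrable_of_abs_le hφ hK),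
    integral_map h1.aemeasurable hi.aestronglyMeasurable]

end Data

/-! ### Exponential tail bounds -/

/-- Chernoff's bound for a sum of independent variables. -/
theorem measure_sum_ge_le {Ω : Type*} [MeasurableSpace Ω] {Pr : Measure Ω}
    [IsProbabilityMeasure Pr] {T : ℕ} {Y : Fin T → Ω → ℝ} {q : Fin T → ℝ} {K : ℝ}
    (hind : iIndepFun Y Pr) (hY : ∀ i, Measurable (Y i)) (hK : ∀ i ω, |Y i ω| ≤ K)
    (hq : ∀ i, ∫ ω, Real.exp (Y i ω) ∂Pr ≤ Real.exp (-q i)) (ι : ℝ) :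
    Pr {ω | ι - ∑ i, q i ≤ ∑ i, Y i ω} ≤ ENNReal.ofReal (Real.exp (-ι)) := by
  have hm : Measurable fun ω => ∑ i, Y i ω := Finset.measurable_sum _ fun i _ => hY i
  have hi : Integrable (fun ω => Real.exp (1 * ∑ i, Y i ω)) Pr := by
    refine integrable_of_abs_le (K := Real.exp (T * K)) (by fun_prop) fun ω => ?_
    rw [Real.abs_exp, Real.exp_le_exp, one_mul]
    have := Finset.sum_le_sum fun i (_ : i ∈ Finset.univ) => (le_abs_self _).trans (hK i ω)
    simpa using this
  have h1 := measure_ge_le_exp_mul_mgf (ι - ∑ i, q i) zero_le_one hi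
  have h2 : mgf (fun ω => ∑ i, Y i ω) Pr 1 ≤ Real.exp (-∑ i, q i) := by
    have h3 := hind.mgf_sum (t := 1) hY Finset.univ
    have h4 : (∑ i, Y i) = fun ω => ∑ i, Y i ω := by ext ω; simp
    rw [h4] at h3
    rw [h3, ← Finset.sum_neg_distrib, Real.exp_sum]
    refine Finset.prod_le_prod (fun i _ => mgf_nonneg) fun i _ => ?_
    simpa [mgf] using hq i
  rw [← ENNReal.ofReal_toReal (measure_ne_top Pr _)]
  refine ENNReal.ofReal_le_ofReal (h1.trans ?_)
  calc _ ≤ Real.exp (-1 * (ι - ∑ i, q i)) * Real.exp (-∑ i, q i) := by gcongr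
    _ = Real.exp (-ι) := by rw [← Real.exp_add]; congr 1; ring

/-- The conditional exponential moment of an excess squared loss, by Hoeffding's lemma: with
`d = v - g` the excess loss is `d² - 2 d (W - ∫ W)`, and the variance proxy `K²` of `W`
costs only half of the gain from `d²` at the scale `1 / (4 K²)`. -/
theorem integral_exp_neg_excess_le {S : Type*} [MeasurableSpace S] {μ : Measure S}
    [IsProbabilityMeasure μ] {W : S → ℝ} {K u v : ℝ} (hK : 0 < K) (hW : Measurable W)
    (hWK : ∀ s, |W s| ≤ K) (hv : |v - (u + ∫ s, W s ∂μ)| ≤ 2 * K) :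
    ∫ s, Real.exp (-((v - u - W s) ^ 2 - ((u + ∫ s, W s ∂μ) - u - W s) ^ 2) / (4 * K ^ 2)) ∂μ ≤
      1 - (v - (u + ∫ s, W s ∂μ)) ^ 2 / (16 * K ^ 2) := by
  set w := ∫ s, W s ∂μ with hw
  set d := v - (u + w) with hd
  have hsub := hasSubgaussianMGF_of_mem_Icc (μ := μ) (X := W) (a := -K) (b := K)
    hW.aemeasurable (ae_of_all _ fun s => abs_le.1 (hWK s))
  have h1 := hsub.mgf_le (d / (2 * K ^ 2))
  have hc : (((‖K - -K‖₊ / 2) ^ 2 : ℝ≥0) : ℝ) = K ^ 2 := by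
    push_cast
    rw [Real.norm_eq_abs, abs_of_pos (by linarith)]
    ring
  rw [hc, ← hw] at h1
  have h2 : ∀ s, Real.exp (-((v - u - W s) ^ 2 - ((u + w) - u - W s) ^ 2) / (4 * K ^ 2)) =
      Real.exp (-(d ^ 2 / (4 * K ^ 2))) * Real.exp (d / (2 * K ^ 2) * (W s - w)) := fun s => by
    rw [← Real.exp_add]; congr 1; field_simp; rw [hd]; ring
  simp_rw [h2]
  rw [integral_const_mul]
  have h3 : ∫ s, Real.exp (d / (2 * K ^ 2) * (W s - w)) ∂μ ≤ Real.exp (d ^ 2 / (8 * K ^ 2)) := by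
    refine h1.trans (le_of_eq ?_)
    congr 1; field_simp; ring
  set x := d ^ 2 / (8 * K ^ 2) with hx
  have hx0 : 0 ≤ x := by positivity
  have hx1 : x ≤ 1 := by
    rw [hx, div_le_one (by positivity)]
    have := pow_le_pow_left₀ (abs_nonneg _) hv 2
    rw [sq_abs] at this
    nlinarith [sq_nonneg K]
  have h4 : Real.exp (-x) ≤ 1 - x / 2 := by
    have h5 := Real.add_one_le_exp x
    have h6 : Real.exp (-x) * Real.exp x = 1 := by rw [← Real.exp_add]; simp
    have h7 := Real.exp_pos (-x)
    nlinarith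
  calc _ ≤ Real.exp (-(d ^ 2 / (4 * K ^ 2))) * Real.exp x := by gcongr
    _ = Real.exp (-x) := by
      rw [← Real.exp_add]; congr 1; rw [hx]; field_simp; ring
    _ ≤ _ := h4
    _ = _ := by rw [hx]; field_simp; ring

/-! ### Finite nets -/

theorem exists_net {X : Type*} {ρ : X → X → ℝ≥0∞} {K : Set X} {ε : ℝ≥0∞} {N : ℕ∞}
    (h : coveringNumber ρ K ε ≤ N) (hN : N ≠ ⊤) :
    ∃ C : Finset X, (C : Set X) ⊆ K ∧ (∀ x ∈ K, ∃ y ∈ C, ρ x y ≤ ε) ∧ C.card ≤ N.toNat := by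
  have h1 : coveringNumber ρ K ε < N + 1 := h.trans_lt ((ENat.lt_add_one_iff hN).2 le_rfl)
  unfold coveringNumber at h1
  simp only [iInf_lt_iff] at h1
  obtain ⟨C, hC, hlt⟩ := h1
  refine ⟨C, hC.1, hC.2, ?_⟩
  have h2 := (ENat.lt_add_one_iff hN).1 hlt
  rw [← ENat.natCast_toNat hN] at h2
  exact_mod_cast h2

theorem abs_sub_le_of_supDist_le {X : Type*} {f g : X → ℝ} {ε : ℝ} (hε : 0 ≤ ε)
    (h : supDist f g ≤ ENNReal.ofReal ε) (x : X) : |f x - g x| ≤ ε := by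
  have h1 := (le_iSup (fun x => ENNReal.ofReal |f x - g x|) x).trans h
  exact (ENNReal.ofReal_le_ofReal_iff hε).1 h1

theorem ofReal_inv_natCast {T : ℕ} (hT : 0 < T) :
    ((T : ℝ≥0∞))⁻¹ = ENNReal.ofReal ((T : ℝ)⁻¹) := by
  rw [ENNReal.ofReal_inv_of_pos (by exact_mod_cast hT), ENNReal.ofReal_natCast]

/-! ### Concentration of the log-likelihood -/

namespace Data

variable {Ω X S A B Θ : Type*} [MeasurableSpace Ω] [MeasurableSpace X] [MeasurableSpace S]
  [MeasurableSpace A] [MeasurableSpace B] {T : ℕ}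
  {D : Data Ω X S A B T} {F : Classes S A B Θ} {M : Game S A B} {Pr : Measure Ω}

/-- The log-likelihood ratio `log (ν^{π^i, f} / ν^{π^i})(b_h^i | s_h^i)` of trajectory `i`. -/
def dataRatio (D : Data Ω X S A B T) (M : Game S A B) (h : ℕ) (f : S × A × B → ℝ) (i : Fin T)
    (ω : Ω) : ℝ :=
  logRatio M.η M.base (D.policy i ω h) f (M.r h) (D.s i h ω) (D.b i h ω)

/-- The same log-likelihood ratio as a function of the labelled state and the action. -/
def ratioFun (D : Data Ω X S A B T) (M : Game S A B) (h : ℕ) (f : S × A × B → ℝ)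
    (q : (X × S) × B) : ℝ :=
  logRatio M.η M.base (D.beh h) (lift X f) (lift X (M.r h)) q.1 q.2

omit [MeasurableSpace Ω] in
theorem dataRatio_eq (h : ℕ) (f : S × A × B → ℝ) (i : Fin T) (ω : Ω) :
    D.dataRatio M h f i ω = D.ratioFun M h f ((D.label i ω, D.s i h ω), D.b i h ω) := rfl

theorem IsGenerated.measurable_ratioFun (hD : D.IsGenerated M Pr) (h : ℕ) {f : S × A × B → ℝ}
    (hf : IsReward f) : Measurable (D.ratioFun M h f) := by
  have := hD.beh_markov h
  exact measurable_logRatio (measurable_lift hf.1) (measurable_lift (M.r_meas h))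

theorem IsGenerated.abs_ratioFun_le (hD : D.IsGenerated M Pr) (h : ℕ) {f : S × A × B → ℝ}
    (hf : IsReward f) (q : (X × S) × B) : |D.ratioFun M h f q| ≤ 2 * M.η := by
  have := hD.beh_markov h
  exact abs_logRatio_le_two_mul M.η_pos M.one_le_base hf.lift (M.isReward_r h).lift _ _

theorem IsGenerated.measurable_dataRatio (hD : D.IsGenerated M Pr) (h : ℕ) {f : S × A × B → ℝ}
    (hf : IsReward f) (i : Fin T) : Measurable (D.dataRatio M h f i) :=
  (hD.measurable_ratioFun h hf).comp
    (((hD.label_meas i).prodMk (hD.s_meas i h)).prodMk (hD.b_meas i h))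

theorem IsGenerated.abs_dataRatio_le (hD : D.IsGenerated M Pr) (h : ℕ) {f : S × A × B → ℝ}
    (hf : IsReward f) (i : Fin T) (ω : Ω) : |D.dataRatio M h f i ω| ≤ 2 * M.η :=
  hD.abs_ratioFun_le h hf ((D.label i ω, D.s i h ω), D.b i h ω)

variable [IsProbabilityMeasure Pr]

theorem IsGenerated.integrable_dataRatio_sq (hD : D.IsGenerated M Pr) (h : ℕ)
    {f : S × A × B → ℝ} (hf : IsReward f) (i : Fin T) :
    Integrable (fun ω => D.dataRatio M h f i ω ^ 2) Pr :=
  integrable_of_abs_le (K := (2 * M.η) ^ 2) ((hD.measurable_dataRatio h hf i).pow_const 2)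
    fun ω => by rw [abs_pow]; exact pow_le_pow_left₀ (abs_nonneg _) (hD.abs_dataRatio_le h hf i ω) 2

theorem IsGenerated.integral_exp_dataRatio_le (hD : D.IsGenerated M Pr) {h : ℕ} (hh : h < M.H)
    {f : S × A × B → ℝ} (hf : IsReward f) (i : Fin T) :
    ∫ ω, Real.exp (D.dataRatio M h f i ω / 2) ∂Pr ≤
      Real.exp (-((∫ ω, D.dataRatio M h f i ω ^ 2 ∂Pr) / (8 * (1 + M.η) ^ 2))) := by
  have := hD.beh_markov h
  have := hD.isMarkovKernel_response h
  have hη := M.η_pos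
  have hm := hD.measurable_ratioFun h hf
  have hb := hD.abs_ratioFun_le h hf
  have hs : Measurable fun ω => (D.label i ω, D.s i h ω) :=
    (hD.label_meas i).prodMk (hD.s_meas i h)
  have hEb : ∀ q, |Real.exp (D.ratioFun M h f q / 2)| ≤ Real.exp M.η := fun q => by
    rw [Real.abs_exp, Real.exp_le_exp]
    linarith [(le_abs_self _).trans (hb q)]
  have hSb : ∀ q, |D.ratioFun M h f q ^ 2| ≤ (2 * M.η) ^ 2 := fun q => by
    rw [abs_pow]; exact pow_le_pow_left₀ (abs_nonneg _) (hb q) 2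
  have hEm : Measurable fun q => Real.exp (D.ratioFun M h f q / 2) := by fun_prop
  have hSm : Measurable fun q => D.ratioFun M h f q ^ 2 := by fun_prop
  have e1 := hD.integral_response i hh hEm hEb
  have e2 := hD.integral_response i hh hSm hSb
  simp_rw [dataRatio_eq]
  rw [e1, e2]
  have i1 : Integrable (fun ω => ∫ b, Real.exp (D.ratioFun M h f ((D.label i ω, D.s i h ω), b) / 2)
      ∂(D.response M h (D.label i ω, D.s i h ω))) Pr :=
    integrable_of_abs_le (K := Real.exp M.η)
      ((hEm.stronglyMeasurable.integral_kernel_prod_right' (κ := D.response M h)).measurable.comp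
        hs) fun ω => abs_integral_le fun b => hEb _
  have i2 : Integrable (fun ω => ∫ b, D.ratioFun M h f ((D.label i ω, D.s i h ω), b) ^ 2
      ∂(D.response M h (D.label i ω, D.s i h ω))) Pr :=
    integrable_of_abs_le (K := (2 * M.η) ^ 2)
      ((hSm.stronglyMeasurable.integral_kernel_prod_right' (κ := D.response M h)).measurable.comp
        hs) fun ω => abs_integral_le fun b => hSb _
  have h3 : ∀ ω, ∫ b, Real.exp (D.ratioFun M h f ((D.label i ω, D.s i h ω), b) / 2)
      ∂(D.response M h (D.label i ω, D.s i h ω)) ≤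
      1 - (∫ b, D.ratioFun M h f ((D.label i ω, D.s i h ω), b) ^ 2
        ∂(D.response M h (D.label i ω, D.s i h ω))) / (8 * (1 + M.η) ^ 2) := fun ω => by
    have h4 := integral_sq_logRatio_le (ν := D.response M h (D.label i ω, D.s i h ω)) (η := M.η)
      (L := fun b => D.ratioFun M h f ((D.label i ω, D.s i h ω), b))
      (hm.comp measurable_prodMk_left) (fun b => hb _)
      (integral_exp_logRatio M.η_pos M.one_le_base hf.lift (measurable_lift (M.r_meas h)) _)
    rw [le_sub_comm, div_le_iff₀ (by positivity)]
    linarith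
  have h5 := integral_mono i1 ((integrable_const 1).sub (i2.div_const _)) h3
  have h6 : ∀ x : ℝ, 1 - x ≤ Real.exp (-x) := fun x => by
    linarith [Real.add_one_le_exp (-x)]
  refine (h5.trans_eq ?_).trans (h6 _)
  simp only [Pi.sub_apply]
  rw [integral_sub (integrable_const 1) (i2.div_const _), integral_div]
  simp

theorem IsGenerated.measure_dataRatio_tail_le (hD : D.IsGenerated M Pr) {h : ℕ} (hh : h < M.H)
    {f : S × A × B → ℝ} (hf : IsReward f) (ι : ℝ) :
    Pr {ω | ι - ∑ i, (∫ ω', D.dataRatio M h f i ω' ^ 2 ∂Pr) / (8 * (1 + M.η) ^ 2) ≤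
      ∑ i, D.dataRatio M h f i ω / 2} ≤ ENNReal.ofReal (Real.exp (-ι)) := by
  refine measure_sum_ge_le (K := M.η) ?_ (fun i => (hD.measurable_dataRatio h hf i).div_const 2)
    (fun i ω => ?_) (fun i => hD.integral_exp_dataRatio_le hh hf i) ι
  · exact hD.indep.comp
      (fun _ w => D.ratioFun M h f ((w.1, (w.2.1 ⟨h, hh⟩).1), (w.2.1 ⟨h, hh⟩).2.2) / 2)
      fun _ => ((hD.measurable_ratioFun h hf).comp (by fun_prop)).div_const 2
  · have := hD.abs_dataRatio_le h hf i ω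
    rw [abs_div, abs_two]
    linarith

/-- With high probability the log-likelihoods of all parameters satisfy
`∑ L_i ≤ O(ι) - ∑ E[L_i²] / (8 (1 + η)²)`. The sup-norm part of the distance on parameters
moves each log-likelihood by at most `2 / T`. -/
theorem IsGenerated.measure_logLik_uniform (hD : D.IsGenerated M Pr) (hT : 0 < T)
    (hF : F.Admissible M) (hN : F.parCover M (T : ℝ≥0∞)⁻¹ ≠ ⊤) (ι : ℝ) :
    Pr {ω | ∃ h < M.H, ∃ θ ∈ F.par h,
        3 + 2 * ι - (∑ i, ∫ ω', D.dataRatio M h (F.rew h θ) i ω' ^ 2 ∂Pr) / (8 * (1 + M.η) ^ 2) <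
          ∑ i, D.dataRatio M h (F.rew h θ) i ω} ≤
      (M.H * (F.parCover M (T : ℝ≥0∞)⁻¹).toNat : ℕ) * ENNReal.ofReal (Real.exp (-ι)) := by
  have hη := M.η_pos
  have hT' : (1 : ℝ) ≤ T := by exact_mod_cast hT
  have hrew : ∀ h < M.H, ∀ θ ∈ F.par h, IsReward (F.rew h θ) := fun h hh θ hθ =>
    ⟨hF.rew_meas h hh θ hθ, hF.rew_mem h hh θ hθ⟩
  have hnet : ∀ h : Fin M.H, ∃ C : Finset Θ, (C : Set Θ) ⊆ F.par h ∧
      (∀ θ ∈ F.par h, ∃ θ' ∈ C, F.parDist M h θ θ' ≤ (T : ℝ≥0∞)⁻¹) ∧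
      C.card ≤ (F.parCover M (T : ℝ≥0∞)⁻¹).toNat := fun h =>
    exists_net (le_iSup (fun h : Fin M.H => coveringNumber (F.parDist M h) (F.par h) _) h) hN
  choose C hCsub hCnet hCcard using hnet
  have hcover : {ω | ∃ h < M.H, ∃ θ ∈ F.par h,
        3 + 2 * ι - (∑ i, ∫ ω', D.dataRatio M h (F.rew h θ) i ω' ^ 2 ∂Pr) / (8 * (1 + M.η) ^ 2) <
          ∑ i, D.dataRatio M h (F.rew h θ) i ω} ⊆
      ⋃ h ∈ (Finset.univ : Finset (Fin M.H)), ⋃ θ ∈ C h,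
        {ω | ι - ∑ i, (∫ ω', D.dataRatio M h (F.rew h θ) i ω' ^ 2 ∂Pr) / (8 * (1 + M.η) ^ 2) ≤
          ∑ i, D.dataRatio M h (F.rew h θ) i ω / 2} := by
    rintro ω ⟨h, hh, θ, hθ, hlt⟩
    obtain ⟨θ', hθ', hd⟩ := hCnet ⟨h, hh⟩ θ hθ
    simp only [mem_iUnion]
    refine ⟨⟨h, hh⟩, Finset.mem_univ _, θ', hθ', ?_⟩
    have hf := hrew h hh θ hθ
    have hf' := hrew h hh θ' (hCsub ⟨h, hh⟩ hθ')
    -- the rewards are `ε`-close in sup-norm, where `(1 + η) ε = 1 / T`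
    set ε : ℝ := (T : ℝ)⁻¹ / (1 + M.η) with hε
    have hε0 : 0 ≤ ε := by positivity
    have hsup : ∀ x, |F.rew h θ x - F.rew h θ' x| ≤ ε := by
      have h1 := (le_max_left _ _).trans hd
      refine abs_sub_le_of_supDist_le hε0 ?_
      rw [ofReal_inv_natCast hT] at h1
      rw [hε, ENNReal.ofReal_div_of_pos (by positivity),
        ENNReal.le_div_iff_mul_le (Or.inl (by simp; positivity)) (Or.inl ENNReal.ofReal_ne_top),
        mul_comm]
      exact h1
    have hηε : M.η * ε ≤ (T : ℝ)⁻¹ := by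
      rw [hε, mul_div_assoc', div_le_iff₀ (by positivity)]
      nlinarith [inv_pos.2 (zero_lt_one.trans_le hT')]
    have hηε0 : 0 ≤ M.η * ε := by positivity
    have hηε2 : (M.η * ε) ≤ (1 + M.η) * (T : ℝ)⁻¹ := by
      nlinarith [inv_pos.2 (zero_lt_one.trans_le hT')]
    have hclose : ∀ i ω, |D.dataRatio M h (F.rew h θ) i ω - D.dataRatio M h (F.rew h θ') i ω| ≤
        2 * (M.η * ε) := fun i ω => by
      have := hD.beh_markov h
      have h2 := abs_logRatio_le (base := M.base) (α := D.beh h) M.η_pos M.one_le_base hf.lift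
        hf'.lift (fun q => hsup _) (D.label i ω, D.s i h ω) (D.b i h ω)
      rw [← mul_assoc]
      refine le_trans (le_of_eq ?_) h2
      rw [dataRatio_eq, dataRatio_eq, ratioFun, ratioFun, logRatio, logRatio, logRatio]
      congr 1; ring
    have hTsum : ∑ _i : Fin T, (T : ℝ)⁻¹ = 1 := by
      simp; field_simp
    have hs1 : ∑ i, D.dataRatio M h (F.rew h θ) i ω ≤
        ∑ i, D.dataRatio M h (F.rew h θ') i ω + 2 := by
      have : ∑ i, D.dataRatio M h (F.rew h θ) i ω ≤
          ∑ i, (D.dataRatio M h (F.rew h θ') i ω + 2 * (T : ℝ)⁻¹) :=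
        Finset.sum_le_sum fun i _ => by linarith [(le_abs_self _).trans (hclose i ω)]
      rw [Finset.sum_add_distrib, ← Finset.mul_sum, hTsum] at this
      linarith
    have hs2 : ∑ i, ∫ ω', D.dataRatio M h (F.rew h θ) i ω' ^ 2 ∂Pr ≤
        2 * ∑ i, ∫ ω', D.dataRatio M h (F.rew h θ') i ω' ^ 2 ∂Pr + 8 * (1 + M.η) ^ 2 := by
      have h3 : ∀ i, ∫ ω', D.dataRatio M h (F.rew h θ) i ω' ^ 2 ∂Pr ≤
          2 * ∫ ω', D.dataRatio M h (F.rew h θ') i ω' ^ 2 ∂Pr +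
            8 * (1 + M.η) ^ 2 * (T : ℝ)⁻¹ := fun i => by
        have i1 := hD.integrable_dataRatio_sq h hf i
        have i2 := hD.integrable_dataRatio_sq h hf' i
        have h4 := integral_mono i1 ((i2.const_mul 2).add
          (integrable_const (8 * (1 + M.η) ^ 2 * (T : ℝ)⁻¹))) fun ω' => by
            have h5 := pow_le_pow_left₀ (abs_nonneg _) (hclose i ω') 2
            rw [sq_abs] at h5
            have h6 : (M.η * ε) ^ 2 ≤ (1 + M.η) ^ 2 * (T : ℝ)⁻¹ := by
              have h7 := pow_le_pow_left₀ hηε0 hηε2 2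
              have h8 : ((T : ℝ)⁻¹) ^ 2 ≤ (T : ℝ)⁻¹ :=
                pow_le_of_le_one (by positivity) (inv_le_one_of_one_le₀ hT') two_ne_zero
              rw [mul_pow (1 + M.η)] at h7
              exact h7.trans (mul_le_mul_of_nonneg_left h8 (by positivity))
            simp only [Pi.add_apply]
            nlinarith [sq_nonneg (D.dataRatio M h (F.rew h θ) i ω' -
              2 * D.dataRatio M h (F.rew h θ') i ω')]
        simp only [Pi.add_apply] at h4
        rw [integral_add (i2.const_mul 2) (integrable_const _), integral_const_mul] at h4
        simpa using h4
      have h9 := Finset.sum_le_sum fun i (_ : i ∈ Finset.univ) => h3 i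
      rw [Finset.sum_add_distrib, ← Finset.mul_sum, ← Finset.mul_sum, hTsum, mul_one] at h9
      exact h9
    simp only [mem_ofPred_eq]
    rw [← Finset.sum_div, ← Finset.sum_div]
    have h10 := div_le_div_of_nonneg_right hs2 (by positivity : 0 ≤ 8 * (1 + M.η) ^ 2)
    rw [add_div, div_self (by positivity), mul_div_assoc] at h10
    linarith
  refine (measure_mono hcover).trans ((measure_biUnion_finset_le _ _).trans ?_)
  calc _ ≤ ∑ h : Fin M.H, ∑ θ ∈ C h, ENNReal.ofReal (Real.exp (-ι)) := by
        refine Finset.sum_le_sum fun h _ => (measure_biUnion_finset_le _ _).trans ?_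
        exact Finset.sum_le_sum fun θ hθ =>
          hD.measure_dataRatio_tail_le h.2 (hrew h h.2 θ (hCsub h hθ)) ι
    _ ≤ ∑ _h : Fin M.H, ((F.parCover M (T : ℝ≥0∞)⁻¹).toNat : ℝ≥0∞) *
          ENNReal.ofReal (Real.exp (-ι)) := by
        refine Finset.sum_le_sum fun h _ => ?_
        rw [Finset.sum_const, nsmul_eq_mul]
        gcongr
        exact hCcard h
    _ = _ := by
        rw [Finset.sum_const, nsmul_eq_mul]; push_cast; simp [mul_assoc]

end Data

/-! ### Concentration of the Bellman loss -/

section NextValue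

variable {S A B Θ : Type*} [MeasurableSpace S] [MeasurableSpace A] [MeasurableSpace B]
  {F : Classes S A B Θ} {M : Game S A B}

theorem Classes.Admissible.isReward (hF : F.Admissible M) {h : ℕ} (hh : h < M.H) {θ : Θ}
    (hθ : θ ∈ F.par h) : IsReward (F.rew h θ) :=
  ⟨hF.rew_meas h hh θ hθ, hF.rew_mem h hh θ hθ⟩

/-- The value `T_{h+1}^{π, θ} U_{h+1}` of the state after step `h`. -/
def nextValue (F : Classes S A B Θ) (M : Game S A B) (h : ℕ)
    (y : (ℕ → S × A × B → ℝ) × Policy S A B × (ℕ → Θ)) : S → ℝ :=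
  respOp M.η M.base (y.2.1 (h + 1)) (F.rew (h + 1) (y.2.2 (h + 1))) (y.1 (h + 1))

/-- The Bellman image `𝕋_h^{π, θ} U_{h+1}`. -/
def target (F : Classes S A B Θ) (M : Game S A B) (h : ℕ)
    (y : (ℕ → S × A × B → ℝ) × Policy S A B × (ℕ → Θ)) (x : S × A × B) : ℝ :=
  M.u h x + ∫ s', nextValue F M h y s' ∂(M.P h x)

/-- The tuples `(U, π, θ)` of the classes. -/
def Classes.Joint (F : Classes S A B Θ) (M : Game S A B) :
    Set ((ℕ → S × A × B → ℝ) × Policy S A B × (ℕ → Θ)) :=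
  F.Val M ×ˢ F.Pol M ×ˢ F.Par M

theorem nextValue_eq_zero {h : ℕ} (hh : M.H ≤ h + 1)
    {y : (ℕ → S × A × B → ℝ) × Policy S A B × (ℕ → Θ)} (hy : y ∈ F.Joint M) (s : S) :
    nextValue F M h y s = 0 := by
  rw [nextValue, hy.1.2 (h + 1) hh]
  simp [respOp]

theorem measurable_nextValue (hF : F.Admissible M) (h : ℕ)
    {y : (ℕ → S × A × B → ℝ) × Policy S A B × (ℕ → Θ)} (hy : y ∈ F.Joint M) :
    Measurable (nextValue F M h y) := by
  rcases lt_or_ge (h + 1) M.H with hh | hh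
  · have := hF.pol_markov _ hh _ (hy.2.1 _ hh)
    exact measurable_respOp M.η_pos M.one_le_base (hF.isReward hh (hy.2.2 _ hh))
      (hF.val_meas _ hh _ (hy.1.1 _ hh))
  · rw [funext (nextValue_eq_zero hh hy)]
    exact measurable_const

theorem abs_nextValue_le (hF : F.Admissible M) (h : ℕ)
    {y : (ℕ → S × A × B → ℝ) × Policy S A B × (ℕ → Θ)} (hy : y ∈ F.Joint M) (s : S) :
    |nextValue F M h y s| ≤ M.H := by
  rcases lt_or_ge (h + 1) M.H with hh | hh
  · have := hF.pol_markov _ hh _ (hy.2.1 _ hh)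
    exact abs_respOp_le M.η_pos M.one_le_base (hF.isReward hh (hy.2.2 _ hh))
      (hF.val_le _ hh _ (hy.1.1 _ hh)) s
  · rw [nextValue_eq_zero hh hy]
    simp

theorem target_mem (hC : F.Complete M) {h : ℕ} (hh : h < M.H)
    {y : (ℕ → S × A × B → ℝ) × Policy S A B × (ℕ → Θ)} (hy : y ∈ F.Joint M) :
    target F M h y ∈ F.val h :=
  hC y.1 hy.1 y.2.1 hy.2.1 y.2.2 hy.2.2 h hh

/-- Close tuples have close next values; the second term of the bound is the change of the law
`π ⊗ ν` in total variation, tested against a function bounded by `H`. -/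
theorem abs_nextValue_sub_le (hF : F.Admissible M) (h : ℕ)
    {y y' : (ℕ → S × A × B → ℝ) × Policy S A B × (ℕ → Θ)} (hy : y ∈ F.Joint M)
    (hy' : y' ∈ F.Joint M) {ε : ℝ} (hε : 0 ≤ ε) (hd : F.jointDist M h y y' ≤ ENNReal.ofReal ε)
    (s : S) : |nextValue F M h y s - nextValue F M h y' s| ≤ (1 + M.H) * ε := by
  rcases lt_or_ge (h + 1) M.H with hh | hh
  · have hmk := hF.pol_markov _ hh _ (hy.2.1 _ hh)
    have hmk' := hF.pol_markov _ hh _ (hy'.2.1 _ hh)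
    have hH : (0 : ℝ) < M.H := by exact_mod_cast M.H_pos
    have hd2 := (le_max_right _ _).trans hd
    rw [if_pos hh] at hd2
    have hU := abs_sub_le_of_supDist_le hε ((le_max_left _ _).trans hd2)
    have hl := (le_iSup (fun s : S => l1Dist
          (jointResponse M.η M.base (y.2.1 (h + 1)) (F.rew (h + 1) (y.2.2 (h + 1))) s)
          (jointResponse M.η M.base (y'.2.1 (h + 1)) (F.rew (h + 1) (y'.2.2 (h + 1))) s))
            s).trans ((le_max_right _ _).trans hd2)
    unfold nextValue respOp
    have hUm' := hF.val_meas _ hh _ (hy'.1.1 _ hh)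
    have hUb' := hF.val_le _ hh _ (hy'.1.1 _ hh)
    have hj := isMarkovKernel_jointResponse (α := y.2.1 (h + 1)) M.η_pos M.one_le_base
      (hF.isReward hh (hy.2.2 _ hh))
    have hj' := isMarkovKernel_jointResponse (α := y'.2.1 (h + 1)) M.η_pos M.one_le_base
      (hF.isReward hh (hy'.2.2 _ hh))
    set μ := jointResponse M.η M.base (y.2.1 (h + 1)) (F.rew (h + 1) (y.2.2 (h + 1))) s
    set μ' := jointResponse M.η M.base (y'.2.1 (h + 1)) (F.rew (h + 1) (y'.2.2 (h + 1))) s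
    set φ : B × A → ℝ := fun q => y.1 (h + 1) (s, q.2, q.1)
    set φ' : B × A → ℝ := fun q => y'.1 (h + 1) (s, q.2, q.1)
    have hφm : Measurable φ := (hF.val_meas _ hh _ (hy.1.1 _ hh)).comp (by fun_prop)
    have hφb : ∀ q, |φ q| ≤ M.H := fun q => hF.val_le _ hh _ (hy.1.1 _ hh) _
    have hφm' : Measurable φ' := hUm'.comp (by fun_prop)
    have hφb' : ∀ q, |φ' q| ≤ M.H := fun q => hUb' _
    have hpart1 : |∫ q, φ q ∂μ - ∫ q, φ' q ∂μ| ≤ ε := by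
      rw [← integral_sub (integrable_of_abs_le hφm hφb) (integrable_of_abs_le hφm' hφb')]
      exact abs_integral_le fun q => hU _
    have htest : ∀ ψ : B × A → ℝ, Measurable ψ → (∀ q, |ψ q| ≤ M.H) →
        ∫ q, ψ q ∂μ - ∫ q, ψ q ∂μ' ≤ M.H * ε := fun ψ hm hb => by
      have h1 := (le_iSup₂ (f := fun (f : B × A → ℝ) (_ : Measurable f ∧ ∀ x, |f x| ≤ 1) =>
        ENNReal.ofReal (∫ x, f x ∂μ - ∫ x, f x ∂μ')) (fun q => ψ q / M.H)
          ⟨hm.div_const _, fun q => by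
            rw [abs_div, abs_of_pos hH]; exact (div_le_one hH).2 (hb q)⟩).trans hl
      have h2 := (ENNReal.ofReal_le_ofReal_iff hε).1 h1
      rw [integral_div, integral_div, ← sub_div, div_le_iff₀ hH] at h2
      linarith
    have hpart2 : |∫ q, φ' q ∂μ - ∫ q, φ' q ∂μ'| ≤ M.H * ε := by
      rw [abs_le]
      constructor
      · have h3 := htest (fun q => -φ' q) hφm'.neg fun q => by rw [abs_neg]; exact hφb' q
        rw [integral_neg, integral_neg] at h3
        linarith
      · exact htest φ' hφm' hφb'
    have h4 := abs_add_le (∫ q, φ q ∂μ - ∫ q, φ' q ∂μ) (∫ q, φ' q ∂μ - ∫ q, φ' q ∂μ')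
    rw [sub_add_sub_cancel] at h4
    linarith
  · rw [nextValue_eq_zero hh hy, nextValue_eq_zero hh hy']
    simp
    positivity

end NextValue

namespace Data

variable {Ω X S A B Θ : Type*} [MeasurableSpace Ω] [MeasurableSpace X] [MeasurableSpace S]
  [MeasurableSpace A] [MeasurableSpace B] {T : ℕ}
  {D : Data Ω X S A B T} {F : Classes S A B Θ} {M : Game S A B} {Pr : Measure Ω}

/-- The excess `(U_h - u_h - W)² - (𝕋_h U_{h+1} - u_h - W)²` of the squared loss at one transition
from `x` to `s'`, where `W = T_{h+1} U_{h+1}` at `s'`. -/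
def excessFun (F : Classes S A B Θ) (M : Game S A B) (h : ℕ)
    (y : (ℕ → S × A × B → ℝ) × Policy S A B × (ℕ → Θ)) (q : (S × A × B) × S) : ℝ :=
  (y.1 h q.1 - M.u h q.1 - nextValue F M h y q.2) ^ 2 -
    (target F M h y q.1 - M.u h q.1 - nextValue F M h y q.2) ^ 2

/-- The excess squared loss at step `h` of trajectory `i`. -/
def excess (D : Data Ω X S A B T) (F : Classes S A B Θ) (M : Game S A B) (h : ℕ)
    (y : (ℕ → S × A × B → ℝ) × Policy S A B × (ℕ → Θ)) (i : Fin T) (ω : Ω) : ℝ :=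
  excessFun F M h y (D.sab i h ω, D.s i (h + 1) ω)

/-- The Bellman error `U_h - 𝕋_h U_{h+1}` at step `h` of trajectory `i`. -/
def bellmanError (D : Data Ω X S A B T) (F : Classes S A B Θ) (M : Game S A B) (h : ℕ)
    (y : (ℕ → S × A × B → ℝ) × Policy S A B × (ℕ → Θ)) (i : Fin T) (ω : Ω) : ℝ :=
  y.1 h (D.sab i h ω) - target F M h y (D.sab i h ω)

theorem measurable_excessFun (hF : F.Admissible M) (hC : F.Complete M) {h : ℕ} (hh : h < M.H)
    {y : (ℕ → S × A × B → ℝ) × Policy S A B × (ℕ → Θ)} (hy : y ∈ F.Joint M) :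
    Measurable (excessFun F M h y) := by
  have h1 := hF.val_meas _ hh _ (hy.1.1 _ hh)
  have h2 := measurable_nextValue hF h hy
  have h3 := hF.val_meas _ hh _ (target_mem hC hh hy)
  have h4 := M.u_meas h
  unfold excessFun
  fun_prop

theorem abs_bellmanError_le (hF : F.Admissible M) (hC : F.Complete M) {h : ℕ} (hh : h < M.H)
    {y : (ℕ → S × A × B → ℝ) × Policy S A B × (ℕ → Θ)} (hy : y ∈ F.Joint M) (x : S × A × B) :
    |y.1 h x - target F M h y x| ≤ 2 * M.H := by
  have h1 := abs_le.1 (hF.val_le _ hh _ (hy.1.1 _ hh) x)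
  have h2 := abs_le.1 (hF.val_le _ hh _ (target_mem hC hh hy) x)
  rw [abs_le]; constructor <;> linarith [h1.1, h1.2, h2.1, h2.2]

theorem excessFun_eq (h : ℕ) (y : (ℕ → S × A × B → ℝ) × Policy S A B × (ℕ → Θ))
    (q : (S × A × B) × S) :
    excessFun F M h y q = (y.1 h q.1 - target F M h y q.1) *
      (y.1 h q.1 + target F M h y q.1 - 2 * M.u h q.1 - 2 * nextValue F M h y q.2) := by
  unfold excessFun; ring

theorem abs_excess_factor_le (hF : F.Admissible M) (hC : F.Complete M) {h : ℕ} (hh : h < M.H)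
    {y : (ℕ → S × A × B → ℝ) × Policy S A B × (ℕ → Θ)} (hy : y ∈ F.Joint M)
    (q : (S × A × B) × S) :
    |y.1 h q.1 + target F M h y q.1 - 2 * M.u h q.1 - 2 * nextValue F M h y q.2| ≤ 6 * M.H := by
  have hH := M.one_le_H
  have h1 := abs_le.1 (hF.val_le _ hh _ (hy.1.1 _ hh) q.1)
  have h2 := abs_le.1 (hF.val_le _ hh _ (target_mem hC hh hy) q.1)
  have h3 := abs_le.1 (abs_nextValue_le hF h hy q.2)
  have h4 := M.u_mem h q.1
  rw [abs_le]
  constructor <;> linarith [h1.1, h1.2, h2.1, h2.2, h3.1, h3.2, h4.1, h4.2]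

theorem abs_excessFun_le (hF : F.Admissible M) (hC : F.Complete M) {h : ℕ} (hh : h < M.H)
    {y : (ℕ → S × A × B → ℝ) × Policy S A B × (ℕ → Θ)} (hy : y ∈ F.Joint M)
    (q : (S × A × B) × S) : |excessFun F M h y q| ≤ 12 * (M.H : ℝ) ^ 2 := by
  rw [excessFun_eq, abs_mul]
  have := mul_le_mul (abs_bellmanError_le hF hC hh hy q.1) (abs_excess_factor_le hF hC hh hy q)
    (abs_nonneg _) (by positivity)
  linarith

theorem IsGenerated.measurable_bellmanError (hD : D.IsGenerated M Pr) (hF : F.Admissible M)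
    (hC : F.Complete M) {h : ℕ} (hh : h < M.H)
    {y : (ℕ → S × A × B → ℝ) × Policy S A B × (ℕ → Θ)} (hy : y ∈ F.Joint M) (i : Fin T) :
    Measurable (D.bellmanError F M h y i) :=
  ((hF.val_meas _ hh _ (hy.1.1 _ hh)).sub (hF.val_meas _ hh _ (target_mem hC hh hy))).comp
    (hD.measurable_sab i h)

variable [IsProbabilityMeasure Pr]

theorem IsGenerated.integrable_bellmanError_sq (hD : D.IsGenerated M Pr) (hF : F.Admissible M)
    (hC : F.Complete M) {h : ℕ} (hh : h < M.H)
    {y : (ℕ → S × A × B → ℝ) × Policy S A B × (ℕ → Θ)} (hy : y ∈ F.Joint M) (i : Fin T) :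
    Integrable (fun ω => D.bellmanError F M h y i ω ^ 2) Pr :=
  integrable_of_abs_le (K := (2 * (M.H : ℝ)) ^ 2)
    ((hD.measurable_bellmanError hF hC hh hy i).pow_const 2) fun ω => by
      rw [abs_pow]
      exact pow_le_pow_left₀ (abs_nonneg _) (abs_bellmanError_le hF hC hh hy _) 2

theorem IsGenerated.integral_exp_excess_le (hD : D.IsGenerated M Pr) (hF : F.Admissible M)
    (hC : F.Complete M) {h : ℕ} (hh : h < M.H)
    {y : (ℕ → S × A × B → ℝ) × Policy S A B × (ℕ → Θ)} (hy : y ∈ F.Joint M) (i : Fin T) :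
    ∫ ω, Real.exp (-D.excess F M h y i ω / (4 * (M.H : ℝ) ^ 2)) ∂Pr ≤
      Real.exp (-((∫ ω, D.bellmanError F M h y i ω ^ 2 ∂Pr) / (16 * (M.H : ℝ) ^ 2))) := by
  have hH := M.one_le_H
  have hm := measurable_excessFun hF hC hh hy
  have hb := abs_excessFun_le hF hC hh hy
  have hEm : Measurable fun q => Real.exp (-excessFun F M h y q / (4 * (M.H : ℝ) ^ 2)) := by
    fun_prop
  have hEb : ∀ q, |Real.exp (-excessFun F M h y q / (4 * (M.H : ℝ) ^ 2))| ≤ Real.exp 3 :=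
    fun q => by
      rw [Real.abs_exp, Real.exp_le_exp, div_le_iff₀ (by positivity)]
      linarith [(abs_le.1 (hb q)).1]
  have e1 := hD.integral_transition i hh hEm hEb
  have i1 : Integrable (fun ω => ∫ s', Real.exp (-excessFun F M h y (D.sab i h ω, s') /
      (4 * (M.H : ℝ) ^ 2)) ∂(M.P h (D.sab i h ω))) Pr :=
    integrable_of_abs_le (K := Real.exp 3)
      ((hEm.stronglyMeasurable.integral_kernel_prod_right' (κ := M.P h)).measurable.comp
        (hD.measurable_sab i h)) fun ω => abs_integral_le fun b => hEb _
  have i2 := hD.integrable_bellmanError_sq hF hC hh hy i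
  have h3 : ∀ ω, ∫ s', Real.exp (-excessFun F M h y (D.sab i h ω, s') /
      (4 * (M.H : ℝ) ^ 2)) ∂(M.P h (D.sab i h ω)) ≤
      1 - D.bellmanError F M h y i ω ^ 2 / (16 * (M.H : ℝ) ^ 2) := fun ω => by
    have h4 := abs_bellmanError_le hF hC hh hy (D.sab i h ω)
    unfold target at h4
    have h5 := integral_exp_neg_excess_le (μ := M.P h (D.sab i h ω)) (K := M.H)
      (W := nextValue F M h y) (u := M.u h (D.sab i h ω)) (v := y.1 h (D.sab i h ω))
      (by linarith) (measurable_nextValue hF h hy) (abs_nextValue_le hF h hy) h4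
    simpa only [excessFun, bellmanError, target] using h5
  unfold excess
  rw [e1]
  have h5 := integral_mono i1 ((integrable_const 1).sub (i2.div_const _)) h3
  have h6 : ∀ x : ℝ, 1 - x ≤ Real.exp (-x) := fun x => by
    linarith [Real.add_one_le_exp (-x)]
  refine (h5.trans_eq ?_).trans (h6 _)
  simp only [Pi.sub_apply]
  rw [integral_sub (integrable_const 1) (i2.div_const _), integral_div]
  simp

theorem IsGenerated.measure_excess_tail_le (hD : D.IsGenerated M Pr) (hF : F.Admissible M)
    (hC : F.Complete M) {h : ℕ} (hh : h < M.H)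
    {y : (ℕ → S × A × B → ℝ) × Policy S A B × (ℕ → Θ)} (hy : y ∈ F.Joint M) (ι : ℝ) :
    Pr {ω | ι - ∑ i, (∫ ω', D.bellmanError F M h y i ω' ^ 2 ∂Pr) / (16 * (M.H : ℝ) ^ 2) ≤
      ∑ i, -D.excess F M h y i ω / (4 * (M.H : ℝ) ^ 2)} ≤ ENNReal.ofReal (Real.exp (-ι)) := by
  have hH := M.one_le_H
  have hm := measurable_excessFun hF hC hh hy
  refine measure_sum_ge_le (K := 3) ?_ (fun i => ?_) (fun i ω => ?_)
    (fun i => hD.integral_exp_excess_le hF hC hh hy i) ι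
  · -- the state after step `h` is part of the record: it starts step `h + 1` or ends the episode
    by_cases hh' : h + 1 < M.H
    · exact hD.indep.comp (fun _ w => -excessFun F M h y (w.2.1 ⟨h, hh⟩, (w.2.1 ⟨h + 1, hh'⟩).1) /
        (4 * (M.H : ℝ) ^ 2)) fun _ => (hm.comp (by fun_prop)).neg.div_const _
    · have hlast : h + 1 = M.H := by omega
      have := hD.indep.comp (fun _ w => -excessFun F M h y (w.2.1 ⟨h, hh⟩, w.2.2) /
        (4 * (M.H : ℝ) ^ 2)) fun _ => (hm.comp (by fun_prop)).neg.div_const _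
      unfold excess
      rw [hlast]
      exact this
  · exact (hm.comp ((hD.measurable_sab i h).prodMk (hD.s_meas i (h + 1)))).neg.div_const _
  · have := abs_excessFun_le hF hC hh hy (D.sab i h ω, D.s i (h + 1) ω)
    rw [abs_div, abs_neg, abs_of_pos (by positivity : 0 < 4 * (M.H : ℝ) ^ 2),
      div_le_iff₀ (by positivity)]
    unfold excess
    linarith

end Data

namespace Data

variable {Ω X S A B Θ : Type*} [MeasurableSpace Ω] [MeasurableSpace X] [MeasurableSpace S]
  [MeasurableSpace A] [MeasurableSpace B] {T : ℕ}
  {D : Data Ω X S A B T} {F : Classes S A B Θ} {M : Game S A B} {Pr : Measure Ω}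

theorem abs_target_sub_le (hF : F.Admissible M) (h : ℕ)
    {y y' : (ℕ → S × A × B → ℝ) × Policy S A B × (ℕ → Θ)} (hy : y ∈ F.Joint M)
    (hy' : y' ∈ F.Joint M) {ε : ℝ} (hε : 0 ≤ ε) (hd : F.jointDist M h y y' ≤ ENNReal.ofReal ε)
    (x : S × A × B) : |target F M h y x - target F M h y' x| ≤ (1 + M.H) * ε := by
  unfold target
  rw [add_sub_add_left_eq_sub, ← integral_sub
    (integrable_of_abs_le (measurable_nextValue hF h hy) (abs_nextValue_le hF h hy))
    (integrable_of_abs_le (measurable_nextValue hF h hy') (abs_nextValue_le hF h hy'))]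
  exact abs_integral_le fun s => abs_nextValue_sub_le hF h hy hy' hε hd s

variable [IsProbabilityMeasure Pr]

/-- With high probability the excess losses of all tuples satisfy
`∑ Z_i ≥ ∑ E[(U_h - 𝕋_h U_{h+1})²] / 4 - O(H² ι)`. Moving a tuple by `1 / T` changes each
excess loss by at most `32 H² / T` and each squared Bellman error by at most `12 H² / T`. -/
theorem IsGenerated.measure_excess_uniform (hD : D.IsGenerated M Pr) (hT : 0 < T)
    (hF : F.Admissible M) (hC : F.Complete M) (hN : F.jointCover M (T : ℝ≥0∞)⁻¹ ≠ ⊤) (ι : ℝ) :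
    Pr {ω | ∃ h < M.H, ∃ y ∈ F.Joint M, ∑ i, D.excess F M h y i ω <
        (∑ i, ∫ ω', D.bellmanError F M h y i ω' ^ 2 ∂Pr) / 4 - (M.H : ℝ) ^ 2 * (35 + 4 * ι)} ≤
      (M.H * (F.jointCover M (T : ℝ≥0∞)⁻¹).toNat : ℕ) * ENNReal.ofReal (Real.exp (-ι)) := by
  have hH := M.one_le_H
  have hT' : (1 : ℝ) ≤ T := by exact_mod_cast hT
  have hnet : ∀ h : Fin M.H, ∃ C : Finset ((ℕ → S × A × B → ℝ) × Policy S A B × (ℕ → Θ)),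
      (C : Set _) ⊆ F.Joint M ∧
      (∀ y ∈ F.Joint M, ∃ y' ∈ C, F.jointDist M h y y' ≤ (T : ℝ≥0∞)⁻¹) ∧
      C.card ≤ (F.jointCover M (T : ℝ≥0∞)⁻¹).toNat := fun h =>
    exists_net (le_iSup (fun h : Fin M.H => coveringNumber (F.jointDist M h) (F.Joint M) _) h) hN
  choose C hCsub hCnet hCcard using hnet
  have hcover : {ω | ∃ h < M.H, ∃ y ∈ F.Joint M, ∑ i, D.excess F M h y i ω <
        (∑ i, ∫ ω', D.bellmanError F M h y i ω' ^ 2 ∂Pr) / 4 - (M.H : ℝ) ^ 2 * (35 + 4 * ι)} ⊆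
      ⋃ h ∈ (Finset.univ : Finset (Fin M.H)), ⋃ y ∈ C h,
        {ω | ι - ∑ i, (∫ ω', D.bellmanError F M h y i ω' ^ 2 ∂Pr) / (16 * (M.H : ℝ) ^ 2) ≤
          ∑ i, -D.excess F M h y i ω / (4 * (M.H : ℝ) ^ 2)} := by
    rintro ω ⟨h, hh, y, hy, hlt⟩
    obtain ⟨y', hy'C, hd⟩ := hCnet ⟨h, hh⟩ y hy
    have hy' := hCsub ⟨h, hh⟩ hy'C
    simp only [mem_iUnion]
    refine ⟨⟨h, hh⟩, Finset.mem_univ _, y', hy'C, ?_⟩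
    set ε : ℝ := (T : ℝ)⁻¹ with hε
    have hε0 : 0 ≤ ε := by positivity
    rw [ofReal_inv_natCast hT] at hd
    have hV : ∀ x, |y.1 h x - y'.1 h x| ≤ ε :=
      abs_sub_le_of_supDist_le hε0 ((le_max_left _ _).trans hd)
    have hW : ∀ s, |nextValue F M h y s - nextValue F M h y' s| ≤ 2 * M.H * ε := fun s =>
      (abs_nextValue_sub_le hF h hy hy' hε0 hd s).trans (by nlinarith)
    have hg : ∀ x, |target F M h y x - target F M h y' x| ≤ 2 * M.H * ε := fun x =>
      (abs_target_sub_le hF h hy hy' hε0 hd x).trans (by nlinarith)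
    have hdiff : ∀ x, |(y.1 h x - target F M h y x) - (y'.1 h x - target F M h y' x)| ≤
        3 * M.H * ε := fun x => by
      have h1 := abs_le.1 (hV x)
      have h2 := abs_le.1 (hg x)
      have h3 : ε ≤ M.H * ε := by nlinarith
      rw [abs_le]; constructor <;> linarith [h1.1, h1.2, h2.1, h2.2]
    have hTsum : ∑ _i : Fin T, ε = 1 := by
      simp [hε]; field_simp
    have hs1 : ∑ i, D.excess F M h y' i ω ≤ ∑ i, D.excess F M h y i ω + 32 * (M.H : ℝ) ^ 2 := by
      have h4 : ∀ i, D.excess F M h y' i ω ≤ D.excess F M h y i ω + 32 * (M.H : ℝ) ^ 2 * ε :=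
        fun i => by
          unfold excess
          set q := (D.sab i h ω, D.s i (h + 1) ω)
          have h1 := abs_le.1 (hV q.1)
          have h2 := abs_le.1 (hg q.1)
          have h3 := abs_le.1 (hW q.2)
          have h5 := hdiff q.1
          have h6 := abs_excess_factor_le hF hC hh hy' q
          have h7 := abs_bellmanError_le hF hC hh hy q.1
          rw [excessFun_eq, excessFun_eq]
          set d := y.1 h q.1 - target F M h y q.1
          set d' := y'.1 h q.1 - target F M h y' q.1
          set m := y.1 h q.1 + target F M h y q.1 - 2 * M.u h q.1 - 2 * nextValue F M h y q.2
            with hm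
          set m' := y'.1 h q.1 + target F M h y' q.1 - 2 * M.u h q.1 -
            2 * nextValue F M h y' q.2 with hm'
          have h8 : |m - m'| ≤ 7 * M.H * ε := by
            have h3 : ε ≤ M.H * ε := by nlinarith
            rw [hm, hm', abs_le]
            constructor <;> linarith [h1.1, h1.2, h2.1, h2.2, h3]
          have h9 : d' * m' - d * m = -((d - d') * m') - d * (m - m') := by ring
          have h10 : |(d - d') * m'| ≤ (3 * M.H * ε) * (6 * M.H) := by
            rw [abs_mul]; exact mul_le_mul h5 h6 (abs_nonneg _) (by positivity)
          have h11 : |d * (m - m')| ≤ (2 * M.H) * (7 * M.H * ε) := by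
            rw [abs_mul]; exact mul_le_mul h7 h8 (abs_nonneg _) (by positivity)
          nlinarith [(abs_le.1 h10).1, (abs_le.1 h11).1]
      have h9 := Finset.sum_le_sum fun i (_ : i ∈ Finset.univ) => h4 i
      rw [Finset.sum_add_distrib, ← Finset.mul_sum, hTsum, mul_one] at h9
      exact h9
    have hs2 : ∑ i, ∫ ω', D.bellmanError F M h y i ω' ^ 2 ∂Pr ≤
        ∑ i, ∫ ω', D.bellmanError F M h y' i ω' ^ 2 ∂Pr + 12 * (M.H : ℝ) ^ 2 := by
      have h3 : ∀ i, ∫ ω', D.bellmanError F M h y i ω' ^ 2 ∂Pr ≤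
          ∫ ω', D.bellmanError F M h y' i ω' ^ 2 ∂Pr + 12 * (M.H : ℝ) ^ 2 * ε := fun i => by
        have i1 := hD.integrable_bellmanError_sq hF hC hh hy i
        have i2 := hD.integrable_bellmanError_sq hF hC hh hy' i
        have h4 := integral_mono i1 (i2.add
          (integrable_const (12 * (M.H : ℝ) ^ 2 * ε))) fun ω' => by
            have h5 := hdiff (D.sab i h ω')
            have h6 := abs_bellmanError_le hF hC hh hy (D.sab i h ω')
            have h7 := abs_bellmanError_le hF hC hh hy' (D.sab i h ω')
            simp only [Pi.add_apply, bellmanError]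
            set d := y.1 h (D.sab i h ω') - target F M h y (D.sab i h ω')
            set d' := y'.1 h (D.sab i h ω') - target F M h y' (D.sab i h ω')
            have h8 : |d + d'| ≤ 4 * M.H := (abs_add_le _ _).trans (by linarith)
            have h9 : |(d - d') * (d + d')| ≤ (3 * M.H * ε) * (4 * M.H) := by
              rw [abs_mul]; exact mul_le_mul h5 h8 (abs_nonneg _) (by positivity)
            nlinarith [(abs_le.1 h9).2]
        simp only [Pi.add_apply] at h4
        rw [integral_add i2 (integrable_const _)] at h4
        simpa using h4
      have h9 := Finset.sum_le_sum fun i (_ : i ∈ Finset.univ) => h3 i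
      rw [Finset.sum_add_distrib, ← Finset.mul_sum, hTsum, mul_one] at h9
      exact h9
    simp only [mem_ofPred_eq]
    rw [← Finset.sum_div, ← Finset.sum_div, Finset.sum_neg_distrib, sub_le_iff_le_add]
    have h12 : (∑ i, ∫ ω', D.bellmanError F M h y' i ω' ^ 2 ∂Pr) / (16 * (M.H : ℝ) ^ 2) =
        ((∑ i, ∫ ω', D.bellmanError F M h y' i ω' ^ 2 ∂Pr) / 4) / (4 * (M.H : ℝ) ^ 2) := by
      field_simp; ring
    rw [h12, ← add_div, le_div_iff₀ (by positivity)]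
    linarith
  refine (measure_mono hcover).trans ((measure_biUnion_finset_le _ _).trans ?_)
  calc _ ≤ ∑ h : Fin M.H, ∑ y ∈ C h, ENNReal.ofReal (Real.exp (-ι)) := by
        refine Finset.sum_le_sum fun h _ => (measure_biUnion_finset_le _ _).trans ?_
        exact Finset.sum_le_sum fun y hy =>
          hD.measure_excess_tail_le hF hC h.2 (hCsub h hy) ι
    _ ≤ ∑ _h : Fin M.H, ((F.jointCover M (T : ℝ≥0∞)⁻¹).toNat : ℝ≥0∞) *
          ENNReal.ofReal (Real.exp (-ι)) := by
        refine Finset.sum_le_sum fun h _ => ?_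
        rw [Finset.sum_const, nsmul_eq_mul]
        gcongr
        exact hCcard h
    _ = _ := by
        rw [Finset.sum_const, nsmul_eq_mul]; push_cast; simp [mul_assoc]

/-! ### The confidence set on the good event -/

/-- The likelihood half of the good event: no parameter has a log-likelihood much above its
expected deficit. -/
def GoodLik (D : Data Ω X S A B T) (F : Classes S A B Θ) (M : Game S A B) (Pr : Measure Ω)
    (ι : ℝ) (ω : Ω) : Prop :=
  ∀ h < M.H, ∀ θ ∈ F.par h, ∑ i, D.dataRatio M h (F.rew h θ) i ω ≤
    3 + 2 * ι - (∑ i, ∫ ω', D.dataRatio M h (F.rew h θ) i ω' ^ 2 ∂Pr) / (8 * (1 + M.η) ^ 2)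

/-- The Bellman half of the good event: every excess loss dominates a quarter of the expected
squared Bellman error, up to `O(H² ι)`. -/
def GoodLoss (D : Data Ω X S A B T) (F : Classes S A B Θ) (M : Game S A B) (Pr : Measure Ω)
    (ι : ℝ) (ω : Ω) : Prop :=
  ∀ h < M.H, ∀ y ∈ F.Joint M,
    (∑ i, ∫ ω', D.bellmanError F M h y i ω' ^ 2 ∂Pr) / 4 - (M.H : ℝ) ^ 2 * (35 + 4 * ι) ≤
      ∑ i, D.excess F M h y i ω

end Data

namespace Data

variable {Ω X S A B Θ : Type*} [MeasurableSpace Ω] [MeasurableSpace X] [MeasurableSpace S]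
  [MeasurableSpace A] [MeasurableSpace B] {T : ℕ}
  {D : Data Ω X S A B T} {F : Classes S A B Θ} {M : Game S A B} {Pr : Measure Ω}

omit [MeasurableSpace Ω] in
theorem negLogLik_sub (ω : Ω) (h : ℕ) {θ₀ : Θ} (h₀ : F.rew h θ₀ = M.r h) (θ : Θ) :
    D.negLogLik F M ω h θ₀ - D.negLogLik F M ω h θ = ∑ i, D.dataRatio M h (F.rew h θ) i ω := by
  unfold negLogLik dataRatio logRatio responseDensity
  simp only [Real.log_exp, h₀, Finset.sum_sub_distrib]
  ring

theorem IsGenerated.bddBelow_negLogLik (hD : D.IsGenerated M Pr) (hF : F.Admissible M) (ω : Ω)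
    {h : ℕ} (hh : h < M.H) {θ₀ : Θ} (h₀ : F.rew h θ₀ = M.r h) :
    BddBelow (range fun θ : F.par h => D.negLogLik F M ω h θ) := by
  refine ⟨D.negLogLik F M ω h θ₀ - ∑ _i : Fin T, 2 * M.η, ?_⟩
  rintro _ ⟨θ, rfl⟩
  have h1 := negLogLik_sub (D := D) ω h h₀ (θ : Θ)
  have h2 := Finset.sum_le_sum fun i (_ : i ∈ Finset.univ) => (le_abs_self _).trans
    (hD.abs_dataRatio_le h (hF.isReward hh θ.2) i ω)
  linarith

omit [MeasurableSpace Ω] in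
theorem bddBelow_bellmanLoss (ω : Ω) (h : ℕ) (U : S × A × B → ℝ) (θ : ℕ → Θ)
    (π : Policy S A B) : BddBelow (range fun V : F.val h => D.bellmanLoss F M ω h V U θ π) := by
  refine ⟨0, ?_⟩
  rintro _ ⟨V, rfl⟩
  exact Finset.sum_nonneg fun i _ => sq_nonneg _

omit [MeasurableSpace Ω] in
theorem sum_excess_eq (ω : Ω) (h : ℕ) (U : ℕ → S × A × B → ℝ) (π : Policy S A B) (θ : ℕ → Θ) :
    ∑ i, D.excess F M h (U, π, θ) i ω = D.bellmanLoss F M ω h (U h) (U (h + 1)) θ π -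
      D.bellmanLoss F M ω h (target F M h (U, π, θ)) (U (h + 1)) θ π :=
  Finset.sum_sub_distrib _ _

/-- On the good event the true parameter, with the value of any policy under it, belongs to
the confidence set of that policy. -/
theorem mem_confSet {ι β : ℝ} (hβ : 35 + 4 * ι ≤ β) (hι : 0 ≤ ι) {ω : Ω}
    (hlik : D.GoodLik F M Pr ι ω) (hloss : D.GoodLoss F M Pr ι ω) {θ₀ : ℕ → Θ} (hθ₀ : θ₀ ∈ F.Par M)
    (h₀ : ∀ h < M.H, F.rew h (θ₀ h) = M.r h) {π : Policy S A B} (hπ : π ∈ F.Pol M)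
    {U : ℕ → S × A × B → ℝ} (hU : U ∈ F.Val M)
    (hres : ∀ h < M.H, ∀ x, F.residual M π U θ₀ h x = 0) :
    (U, θ₀) ∈ D.confSet F M β ω π := by
  have hη := M.η_pos
  refine ⟨hU, hθ₀, fun h hh => ⟨?_, ?_⟩⟩
  · have : Nonempty (F.par h) := ⟨⟨θ₀ h, hθ₀ h hh⟩⟩
    rw [← sub_le_iff_le_add]
    refine le_ciInf fun θ => ?_
    have h1 := negLogLik_sub (D := D) ω h (h₀ h hh) (θ : Θ)
    have h2 := hlik h hh θ θ.2
    have h3 : 0 ≤ (∑ i, ∫ ω', D.dataRatio M h (F.rew h θ) i ω' ^ 2 ∂Pr) /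
        (8 * (1 + M.η) ^ 2) :=
      div_nonneg (Finset.sum_nonneg fun i _ => integral_nonneg fun ω' => sq_nonneg _)
        (by positivity)
    simp only
    linarith
  · have : Nonempty (F.val h) := ⟨⟨U h, hU.1 h hh⟩⟩
    rw [← sub_le_iff_le_add]
    refine le_ciInf fun V => ?_
    -- the value class is a product, so `U_h` can be replaced by `V` at step `h` alone
    have hU' : Function.update U h V ∈ F.Val M := by
      refine ⟨fun k hk => ?_, fun k hk => ?_⟩
      · by_cases hkh : k = h
        · subst hkh; rw [Function.update_self]; exact V.2
        · rw [Function.update_of_ne hkh]; exact hU.1 k hk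
      · rw [Function.update_of_ne (by omega)]; exact hU.2 k hk
    have h1 := hloss h hh (Function.update U h V, π, θ₀) ⟨hU', hπ, hθ₀⟩
    rw [sum_excess_eq, Function.update_self, Function.update_of_ne (by omega)] at h1
    have htar : target F M h (Function.update U h V, π, θ₀) = U h := by
      funext x
      have h2 := hres h hh x
      rw [Classes.residual, sub_eq_zero] at h2
      rw [h2, target, nextValue]
      simp only
      rw [Function.update_of_ne (by omega)]
      rfl
    rw [htar] at h1
    have h3 : 0 ≤ (∑ i, ∫ ω', D.bellmanError F M h (Function.update U h V, π, θ₀) i ω' ^ 2 ∂Pr) /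
        4 :=
      div_nonneg (Finset.sum_nonneg fun i _ => integral_nonneg fun ω' => sq_nonneg _)
        (by positivity)
    have h4 := mul_le_mul_of_nonneg_left hβ (sq_nonneg (M.H : ℝ))
    simp only
    linarith

/-- On the good event the parameters of a confidence set have a small expected squared
log-likelihood ratio. -/
theorem sum_dataRatio_le_of_mem_confSet (hD : D.IsGenerated M Pr) (hF : F.Admissible M) {ι β : ℝ}
    (hβ : 35 + 4 * ι ≤ β) (hι : 0 ≤ ι) {ω : Ω} (hlik : D.GoodLik F M Pr ι ω) {θ₀ : ℕ → Θ}
    (hθ₀ : θ₀ ∈ F.Par M) (h₀ : ∀ h < M.H, F.rew h (θ₀ h) = M.r h) {π : Policy S A B}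
    {p : (ℕ → S × A × B → ℝ) × (ℕ → Θ)} (hp : p ∈ D.confSet F M β ω π) {h : ℕ} (hh : h < M.H) :
    ∑ i, ∫ ω', D.dataRatio M h (F.rew h (p.2 h)) i ω' ^ 2 ∂Pr ≤ 16 * (1 + M.η) ^ 2 * β := by
  have hη := M.η_pos
  have h1 := negLogLik_sub (D := D) ω h (h₀ h hh) (p.2 h)
  have h2 := hlik h hh _ (hp.2.1 h hh)
  have h3 := (hp.2.2 h hh).1
  have h4 := ciInf_le (hD.bddBelow_negLogLik hF ω hh (h₀ h hh)) ⟨θ₀ h, hθ₀ h hh⟩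
  simp only at h4
  have h5 : (∑ i, ∫ ω', D.dataRatio M h (F.rew h (p.2 h)) i ω' ^ 2 ∂Pr) /
      (8 * (1 + M.η) ^ 2) ≤ 2 * β := by linarith
  rw [div_le_iff₀ (by positivity)] at h5
  linarith

/-- On the good event the values of a confidence set have a small expected squared Bellman error. -/
theorem sum_bellmanError_le_of_mem_confSet (hC : F.Complete M) {ι β : ℝ}
    (hβ : 35 + 4 * ι ≤ β) {ω : Ω} (hloss : D.GoodLoss F M Pr ι ω) {π : Policy S A B}
    (hπ : π ∈ F.Pol M) {p : (ℕ → S × A × B → ℝ) × (ℕ → Θ)} (hp : p ∈ D.confSet F M β ω π)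
    {h : ℕ} (hh : h < M.H) :
    ∑ i, ∫ ω', D.bellmanError F M h (p.1, π, p.2) i ω' ^ 2 ∂Pr ≤ 8 * (M.H : ℝ) ^ 2 * β := by
  have hy : (p.1, π, p.2) ∈ F.Joint M := ⟨hp.1, hπ, hp.2.1⟩
  have h1 := hloss h hh _ hy
  rw [sum_excess_eq] at h1
  have h3 := (hp.2.2 h hh).2
  have h4 := ciInf_le (bddBelow_bellmanLoss (D := D) (M := M) (F := F) ω h (p.1 (h + 1)) p.2 π)
    ⟨_, target_mem hC hh hy⟩
  simp only at h4
  have h5 := mul_le_mul_of_nonneg_left hβ (sq_nonneg (M.H : ℝ))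
  linarith

end Data

/-! ### Decomposition of the value of a policy -/

section Decomposition

variable {S A B Θ : Type*} [MeasurableSpace S] [MeasurableSpace A] [MeasurableSpace B]
  {F : Classes S A B Θ} {M : Game S A B} {π : Policy S A B}

theorem isProbabilityMeasure_stepLaw (h : ℕ) (μ : Measure S) [IsProbabilityMeasure μ]
    (α : Kernel (S × B) A) [IsMarkovKernel α] : IsProbabilityMeasure (M.stepLaw h μ α) := by
  have := isMarkovKernel_jointResponse (α := α) M.η_pos M.one_le_base (M.isReward_r h)
  exact Measure.isProbabilityMeasure_map (by fun_prop)

theorem integral_stepLaw (h : ℕ) (μ : Measure S) [IsProbabilityMeasure μ]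
    (α : Kernel (S × B) A) [IsMarkovKernel α] {ψ : S × A × B → ℝ} {K : ℝ} (hψ : Measurable ψ)
    (hK : ∀ x, |ψ x| ≤ K) :
    ∫ x, ψ x ∂(M.stepLaw h μ α) = ∫ s, respOp M.η M.base α (M.r h) ψ s ∂μ := by
  have := isMarkovKernel_jointResponse (α := α) M.η_pos M.one_le_base (M.isReward_r h)
  unfold Game.stepLaw
  rw [integral_map (by fun_prop) hψ.aestronglyMeasurable,
    Measure.integral_compProd (f := fun q : S × (B × A) => ψ (q.1, q.2.2, q.2.1))
      (integrable_of_abs_le (hψ.comp (by fun_prop)) fun q => hK _)]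
  rfl

theorem integral_stepLaw_of_state_action (h : ℕ) (μ : Measure S) [IsProbabilityMeasure μ]
    (α : Kernel (S × B) A) [IsMarkovKernel α] {φ : S × B → ℝ} {K : ℝ} (hφ : Measurable φ)
    (hK : ∀ q, |φ q| ≤ K) :
    ∫ x, φ (x.1, x.2.2) ∂(M.stepLaw h μ α) =
      ∫ s, ∫ b, φ (s, b) ∂(quantalResponse M.η M.base α (M.r h) s) ∂μ := by
  rw [integral_stepLaw (ψ := fun x => φ (x.1, x.2.2)) h μ α (hφ.comp (by fun_prop)) fun x => hK _]
  refine integral_congr_ae (ae_of_all _ fun s => ?_)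
  simp only
  rw [respOp_eq (U := fun x => φ (x.1, x.2.2)) M.η_pos M.one_le_base (M.isReward_r h)
    (hφ.comp (by fun_prop)) fun x => hK _]
  simp [avgReward]

theorem integral_bind_kernel {Y Z : Type*} [MeasurableSpace Y] [MeasurableSpace Z] (μ : Measure Y)
    [IsProbabilityMeasure μ] (κ : Kernel Y Z) [IsMarkovKernel κ] {φ : Z → ℝ} {K : ℝ}
    (hφ : Measurable φ) (hK : ∀ z, |φ z| ≤ K) :
    ∫ z, φ z ∂(μ.bind κ) = ∫ y, ∫ z, φ z ∂(κ y) ∂μ := by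
  rw [← Measure.snd_compProd, Measure.snd, integral_map (by fun_prop) hφ.aestronglyMeasurable,
    Measure.integral_compProd (f := fun q : Y × Z => φ q.2)
      (integrable_of_abs_le (hφ.comp measurable_snd) fun q => hK _)]

theorem isProbabilityMeasure_stateLaw (hF : F.Admissible M) (hπ : π ∈ F.Pol M) :
    ∀ h ≤ M.H, IsProbabilityMeasure (M.stateLaw π h)
  | 0, _ => M.init_prob
  | h + 1, hh => by
    have := isProbabilityMeasure_stateLaw hF hπ h (by omega)
    have := hF.pol_markov h (by omega) _ (hπ h (by omega))
    have := isProbabilityMeasure_stepLaw (M := M) h (M.stateLaw π h) (π h)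
    unfold Game.stateLaw
    infer_instance

/-- `T_h^{π, θ} U_h`, the value of the state at step `h` under the candidate `(U, θ)`. -/
def stateValue (F : Classes S A B Θ) (M : Game S A B) (π : Policy S A B)
    (U : ℕ → S × A × B → ℝ) (θ : ℕ → Θ) (h : ℕ) : S → ℝ :=
  respOp M.η M.base (π h) (F.rew h (θ h)) (U h)

/-- The error `((T_h^{π, θ} - T_h^π) U_h)(s)` caused by a misspecified response of the follower. -/
def responseError (F : Classes S A B Θ) (M : Game S A B) (π : Policy S A B)
    (U : ℕ → S × A × B → ℝ) (θ : ℕ → Θ) (h : ℕ) (s : S) : ℝ :=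
  stateValue F M π U θ h s - respOp M.η M.base (π h) (M.r h) (U h) s

theorem stateLaw_succ (h : ℕ) :
    M.stateLaw π (h + 1) = (M.occupancy π h).bind (M.P h) := rfl

theorem stateValue_succ (U : ℕ → S × A × B → ℝ) (θ : ℕ → Θ) (h : ℕ) :
    stateValue F M π U θ (h + 1) = nextValue F M h (U, π, θ) := rfl

theorem residual_eq (U : ℕ → S × A × B → ℝ) (θ : ℕ → Θ) (h : ℕ) :
    F.residual M π U θ h = fun x => U h x - target F M h (U, π, θ) x := rfl

theorem integral_stateValue_succ (hF : F.Admissible M) (hC : F.Complete M) (hπ : π ∈ F.Pol M)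
    {U : ℕ → S × A × B → ℝ} (hU : U ∈ F.Val M) {θ : ℕ → Θ} (hθ : θ ∈ F.Par M) {h : ℕ}
    (hh : h < M.H) :
    ∫ s, stateValue F M π U θ h s ∂(M.stateLaw π h) =
      ∫ x, M.u h x ∂(M.occupancy π h) + ∫ x, F.residual M π U θ h x ∂(M.occupancy π h) +
        ∫ s, responseError F M π U θ h s ∂(M.stateLaw π h) +
        ∫ s, stateValue F M π U θ (h + 1) s ∂(M.stateLaw π (h + 1)) := by
  have hμ := isProbabilityMeasure_stateLaw hF hπ h hh.le
  have hα := hF.pol_markov h hh _ (hπ h hh)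
  have hocc : IsProbabilityMeasure (M.occupancy π h) := isProbabilityMeasure_stepLaw h _ _
  have hy : (U, π, θ) ∈ F.Joint M := ⟨hU, hπ, hθ⟩
  have hUm := hF.val_meas h hh _ (hU.1 h hh)
  have hUb := hF.val_le h hh _ (hU.1 h hh)
  have hgm := hF.val_meas h hh _ (target_mem hC hh hy)
  have hgb := hF.val_le h hh _ (target_mem hC hh hy)
  have hf := hF.isReward hh (hθ h hh)
  have iT : Integrable (stateValue F M π U θ h) (M.stateLaw π h) :=
    integrable_of_abs_le (measurable_respOp M.η_pos M.one_le_base hf hUm)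
      (abs_respOp_le M.η_pos M.one_le_base hf hUb)
  have iT0 : Integrable (respOp M.η M.base (π h) (M.r h) (U h)) (M.stateLaw π h) :=
    integrable_of_abs_le (measurable_respOp M.η_pos M.one_le_base (M.isReward_r h) hUm)
      (abs_respOp_le M.η_pos M.one_le_base (M.isReward_r h) hUb)
  have e1 : ∫ s, responseError F M π U θ h s ∂(M.stateLaw π h) =
      ∫ s, stateValue F M π U θ h s ∂(M.stateLaw π h) - ∫ x, U h x ∂(M.occupancy π h) := by
    unfold responseError
    rw [integral_sub iT iT0, Game.occupancy,
      integral_stepLaw h _ _ hUm hUb]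
  have e2 : ∫ s, stateValue F M π U θ (h + 1) s ∂(M.stateLaw π (h + 1)) =
      ∫ x, ∫ s, nextValue F M h (U, π, θ) s ∂(M.P h x) ∂(M.occupancy π h) := by
    rw [stateLaw_succ, stateValue_succ]
    exact integral_bind_kernel (M.occupancy π h) (M.P h) (measurable_nextValue hF h hy)
      (abs_nextValue_le hF h hy)
  have iU : Integrable (U h) (M.occupancy π h) := integrable_of_abs_le hUm hUb
  have ig : Integrable (target F M h (U, π, θ)) (M.occupancy π h) := integrable_of_abs_le hgm hgb
  have iu : Integrable (M.u h) (M.occupancy π h) :=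
    integrable_of_abs_le (K := 1) (M.u_meas h) (IsReward.abs_le_one ⟨M.u_meas h, M.u_mem h⟩)
  have e3 : ∫ x, F.residual M π U θ h x ∂(M.occupancy π h) =
      ∫ x, U h x ∂(M.occupancy π h) - ∫ x, target F M h (U, π, θ) x ∂(M.occupancy π h) := by
    rw [residual_eq, integral_sub iU ig]
  have e4 : ∫ x, ∫ s, nextValue F M h (U, π, θ) s ∂(M.P h x) ∂(M.occupancy π h) =
      ∫ x, target F M h (U, π, θ) x ∂(M.occupancy π h) - ∫ x, M.u h x ∂(M.occupancy π h) := by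
    rw [← integral_sub ig iu]
    refine integral_congr_ae (ae_of_all _ fun x => ?_)
    simp only [target, add_sub_cancel_left]
  rw [e1, e2, e3, e4]
  ring

/-- The candidate value of a policy exceeds its true value by the expected Bellman residuals and
response errors along the true trajectory. -/
theorem integral_stateValue_zero (hF : F.Admissible M) (hC : F.Complete M) (hπ : π ∈ F.Pol M)
    {U : ℕ → S × A × B → ℝ} (hU : U ∈ F.Val M) {θ : ℕ → Θ} (hθ : θ ∈ F.Par M) :
    ∫ s, stateValue F M π U θ 0 s ∂M.init =
      M.J π + ∑ h ∈ Finset.range M.H, (∫ x, F.residual M π U θ h x ∂(M.occupancy π h) +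
        ∫ s, responseError F M π U θ h s ∂(M.stateLaw π h)) := by
  have key : ∀ n ≤ M.H, ∫ s, stateValue F M π U θ 0 s ∂M.init =
      ∑ h ∈ Finset.range n, ∫ x, M.u h x ∂(M.occupancy π h) +
        ∑ h ∈ Finset.range n, (∫ x, F.residual M π U θ h x ∂(M.occupancy π h) +
          ∫ s, responseError F M π U θ h s ∂(M.stateLaw π h)) +
        ∫ s, stateValue F M π U θ n s ∂(M.stateLaw π n) := by
    intro n
    induction n with
    | zero => intro _; simp [Game.stateLaw]
    | succ n ih =>
      intro hn
      rw [ih (by omega), integral_stateValue_succ hF hC hπ hU hθ (by omega : n < M.H),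
        Finset.sum_range_succ, Finset.sum_range_succ]
      ring
  rw [key M.H le_rfl, Game.J]
  have hlast : ∀ s, stateValue F M π U θ M.H s = 0 := fun s => by
    rw [stateValue, hU.2 M.H le_rfl]; simp [respOp]
  simp [hlast]

/-- Under the true parameter and the matching value the decomposition has no error terms. -/
theorem integral_stateValue_eq_J (hF : F.Admissible M) (hC : F.Complete M) (hπ : π ∈ F.Pol M)
    {U : ℕ → S × A × B → ℝ} (hU : U ∈ F.Val M) {θ : ℕ → Θ} (hθ : θ ∈ F.Par M)
    (h₀ : ∀ h < M.H, F.rew h (θ h) = M.r h) (hres : ∀ h < M.H, ∀ x, F.residual M π U θ h x = 0) :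
    ∫ s, stateValue F M π U θ 0 s ∂M.init = M.J π := by
  rw [integral_stateValue_zero hF hC hπ hU hθ, Finset.sum_eq_zero, add_zero]
  intro h hh
  have hh' := Finset.mem_range.1 hh
  simp [hres h hh', responseError, stateValue, h₀ h hh']

theorem abs_integral_stateValue_le (hF : F.Admissible M) (hπ : π ∈ F.Pol M)
    {U : ℕ → S × A × B → ℝ} (hU : U ∈ F.Val M) {θ : ℕ → Θ} (hθ : θ ∈ F.Par M) :
    |∫ s, stateValue F M π U θ 0 s ∂M.init| ≤ M.H := by
  have := hF.pol_markov 0 M.H_pos _ (hπ 0 M.H_pos)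
  exact abs_integral_le fun s => abs_respOp_le M.η_pos M.one_le_base
    (hF.isReward M.H_pos (hθ 0 M.H_pos)) (hF.val_le 0 M.H_pos _ (hU.1 0 M.H_pos)) s

/-- The second moment, along the trajectory of `π`, of the follower's centred reward error
`Υ_h^π (r_h^θ - r_h)`. -/
def upsilonMoment (F : Classes S A B Θ) (M : Game S A B) (π : Policy S A B) (θ : ℕ → Θ)
    (h : ℕ) : ℝ :=
  ∫ x, upsilon M.η M.base (π h) (M.r h) (fun y => F.rew h (θ h) y - M.r h y) x.1 x.2.2 ^ 2
    ∂(M.occupancy π h)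

theorem abs_integral_responseError_le (hF : F.Admissible M) (hπ : π ∈ F.Pol M)
    {U : ℕ → S × A × B → ℝ} (hU : U ∈ F.Val M) {θ : ℕ → Θ} (hθ : θ ∈ F.Par M) {h : ℕ}
    (hh : h < M.H) :
    |∫ s, responseError F M π U θ h s ∂(M.stateLaw π h)| ≤
      M.H * (Real.sqrt (M.η ^ 2 * upsilonMoment F M π θ h) +
        2 * Real.exp (2 * M.η) * (M.η ^ 2 * upsilonMoment F M π θ h)) := by
  have hη := M.η_pos
  have hμ := isProbabilityMeasure_stateLaw hF hπ h hh.le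
  have hα := hF.pol_markov h hh _ (hπ h hh)
  have hocc : IsProbabilityMeasure (M.occupancy π h) := isProbabilityMeasure_stepLaw h _ _
  have hUm := hF.val_meas h hh _ (hU.1 h hh)
  have hUb := hF.val_le h hh _ (hU.1 h hh)
  have hf := hF.isReward hh (hθ h hh)
  have hr := M.isReward_r h
  have hq := isMarkovKernel_quantalResponse (α := π h) M.η_pos M.one_le_base hr
  set φ : S × B → ℝ := fun q => M.η * upsilon M.η M.base (π h) (M.r h)
    (fun y => F.rew h (θ h) y - M.r h y) q.1 q.2 with hφ
  have hφm : Measurable φ :=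
    (measurable_upsilon M.η_pos M.one_le_base hr (hf.1.sub hr.1)).const_mul M.η
  have hφb : ∀ q, |φ q| ≤ 2 * M.η := fun q => by
    have := abs_upsilon_le (α := π h) M.η_pos M.one_le_base hr (hf.abs_sub_le hr) q.1 q.2
    rw [hφ, abs_mul, abs_of_pos hη]
    nlinarith
  have hφ2b : ∀ q, |φ q ^ 2| ≤ (2 * M.η) ^ 2 := fun q => by
    rw [abs_pow]; exact pow_le_pow_left₀ (abs_nonneg _) (hφb q) 2
  have hφab : ∀ q, |(|φ q|)| ≤ 2 * M.η := fun q => by rw [abs_abs]; exact hφb q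
  have hφam : Measurable fun q => |φ q| := hφm.abs
  have hφ2m : Measurable fun q => φ q ^ 2 := hφm.pow_const 2
  have e1 := integral_stepLaw_of_state_action (M := M) h (M.stateLaw π h) (π h) hφam hφab
  have e2 := integral_stepLaw_of_state_action (M := M) h (M.stateLaw π h) (π h) hφ2m hφ2b
  have e3 : ∫ x, φ (x.1, x.2.2) ^ 2 ∂(M.occupancy π h) = M.η ^ 2 * upsilonMoment F M π θ h := by
    rw [upsilonMoment, ← integral_const_mul]
    simp only [hφ, mul_pow]
  have e4 : ∫ x, |φ (x.1, x.2.2)| ∂(M.occupancy π h) ≤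
      Real.sqrt (M.η ^ 2 * upsilonMoment F M π θ h) := by
    rw [← e3]
    refine Real.le_sqrt_of_sq_le ?_
    have := sq_integral_le (μ := M.occupancy π h) (f := fun x => |φ (x.1, x.2.2)|)
      (hφam.comp (g := fun q => |φ q|) (f := fun x : S × A × B => (x.1, x.2.2)) (by fun_prop))
      fun x => hφab _
    simpa only [sq_abs] using this
  have ia : Integrable (fun s => ∫ b, |φ (s, b)| ∂(quantalResponse M.η M.base (π h) (M.r h) s))
      (M.stateLaw π h) :=
    integrable_of_abs_le (K := 2 * M.η)
      (hφam.stronglyMeasurable.integral_kernel_prod_right').measurable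
      fun s => abs_integral_le fun b => hφab _
  have i2 : Integrable (fun s => ∫ b, φ (s, b) ^ 2 ∂(quantalResponse M.η M.base (π h) (M.r h) s))
      (M.stateLaw π h) :=
    integrable_of_abs_le (K := (2 * M.η) ^ 2)
      (hφ2m.stronglyMeasurable.integral_kernel_prod_right').measurable
      fun s => abs_integral_le fun b => hφ2b _
  have hem : Measurable (responseError F M π U θ h) :=
    (measurable_respOp M.η_pos M.one_le_base hf hUm).sub
      (measurable_respOp M.η_pos M.one_le_base hr hUm)
  have hpt : ∀ s, |responseError F M π U θ h s| ≤
      M.H * (∫ b, |φ (s, b)| ∂(quantalResponse M.η M.base (π h) (M.r h) s) +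
        2 * Real.exp (2 * M.η) *
          ∫ b, φ (s, b) ^ 2 ∂(quantalResponse M.η M.base (π h) (M.r h) s)) := fun s =>
    abs_respOp_sub_le M.η_pos M.one_le_base hf hr hUm hUb s
  have heb : ∀ s, |responseError F M π U θ h s| ≤ 2 * M.H := fun s => by
    have h1 := abs_le.1 (abs_respOp_le (α := π h) M.η_pos M.one_le_base hf hUb s)
    have h2 := abs_le.1 (abs_respOp_le (α := π h) M.η_pos M.one_le_base hr hUb s)
    unfold responseError stateValue
    rw [abs_le]; constructor <;> linarith [h1.1, h1.2, h2.1, h2.2]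
  have ie : Integrable (responseError F M π U θ h) (M.stateLaw π h) := integrable_of_abs_le hem heb
  refine abs_integral_le_integral_abs.trans ?_
  have h5 := integral_mono ie.abs ((ia.add (i2.const_mul (2 * Real.exp (2 * M.η)))).const_mul
    (M.H : ℝ)) hpt
  simp only [Pi.add_apply] at h5
  rw [integral_const_mul, integral_add ia (i2.const_mul _), integral_const_mul, ← e1, ← e2] at h5
  have e3' : ∫ x, φ (x.1, x.2.2) ^ 2 ∂(M.stepLaw h (M.stateLaw π h) (π h)) =
    M.η ^ 2 * upsilonMoment F M π θ h := e3
  rw [e3'] at h5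
  refine h5.trans (mul_le_mul_of_nonneg_left ?_ (by positivity))
  have e4' : ∫ x, |φ (x.1, x.2.2)| ∂(M.stepLaw h (M.stateLaw π h) (π h)) ≤
    Real.sqrt (M.η ^ 2 * upsilonMoment F M π θ h) := e4
  linarith

end Decomposition

/-! ### Concentrability -/

namespace Data

variable {Ω X S A B Θ : Type*} [MeasurableSpace Ω] [MeasurableSpace X] [MeasurableSpace S]
  [MeasurableSpace A] [MeasurableSpace B] {T : ℕ}
  {D : Data Ω X S A B T} {F : Classes S A B Θ} {M : Game S A B} {Pr : Measure Ω}

/-- A finite bound on the ratio in `ℝ≥0∞` is a bound on the numerator also when the denominator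
vanishes: then the numerator is `0`, because `x / 0 = ∞` for `x > 0`. -/
theorem le_sq_mul_of_rpow_div_le {a b : ℝ} {C : ℝ≥0∞} (hC : C ≠ ⊤) (ha : 0 ≤ a) (hb : 0 ≤ b)
    (h : (ENNReal.ofReal a / ENNReal.ofReal b) ^ (1 / 2 : ℝ) ≤ C) : a ≤ C.toReal ^ 2 * b := by
  have h1 : ENNReal.ofReal a / ENNReal.ofReal b ≤ C ^ 2 := by
    have := ENNReal.rpow_le_rpow h (by norm_num : (0 : ℝ) ≤ 2)
    rw [← ENNReal.rpow_mul] at this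
    norm_num at this
    exact this
  rw [ENNReal.div_le_iff_le_mul (Or.inr (ENNReal.pow_ne_top hC)) (Or.inl ENNReal.ofReal_ne_top)]
    at h1
  have h2 := ENNReal.toReal_mono
    (ENNReal.mul_ne_top (ENNReal.pow_ne_top hC) ENNReal.ofReal_ne_top) h1
  rwa [ENNReal.toReal_mul, ENNReal.toReal_pow, ENNReal.toReal_ofReal ha,
    ENNReal.toReal_ofReal hb] at h2

theorem integral_residual_sq_le {π : Policy S A B} (hCL : D.CL F M Pr π ≠ ⊤)
    {U : ℕ → S × A × B → ℝ} (hU : U ∈ F.Val M) {θ : ℕ → Θ} (hθ : θ ∈ F.Par M) {h : ℕ}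
    (hh : h < M.H) :
    ∫ x, F.residual M π U θ h x ^ 2 ∂(M.occupancy π h) ≤ (D.CL F M Pr π).toReal ^ 2 *
      ((T : ℝ)⁻¹ * ∑ i : Fin T, ∫ ω, F.residual M π U θ h (D.sab i h ω) ^ 2 ∂Pr) := by
  refine le_sq_mul_of_rpow_div_le hCL (integral_nonneg fun x => sq_nonneg _)
    (mul_nonneg (by positivity)
      (Finset.sum_nonneg fun i _ => integral_nonneg fun ω => sq_nonneg _)) ?_
  unfold CL
  exact (le_iSup (fun h : Fin M.H =>
    (ENNReal.ofReal (∫ x, F.residual M π U θ h x ^ 2 ∂(M.occupancy π h)) /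
      ENNReal.ofReal ((T : ℝ)⁻¹ * ∑ i : Fin T,
        ∫ ω, F.residual M π U θ h (D.sab i h ω) ^ 2 ∂Pr)) ^ (1 / 2 : ℝ)) ⟨h, hh⟩).trans
    ((le_iSup₂ (f := fun θ (_ : θ ∈ F.Par M) => ⨆ h : Fin M.H,
      (ENNReal.ofReal (∫ x, F.residual M π U θ h x ^ 2 ∂(M.occupancy π h)) /
      ENNReal.ofReal ((T : ℝ)⁻¹ * ∑ i : Fin T,
        ∫ ω, F.residual M π U θ h (D.sab i h ω) ^ 2 ∂Pr)) ^ (1 / 2 : ℝ)) θ hθ).trans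
      (le_iSup₂ (f := fun U (_ : U ∈ F.Val M) => ⨆ θ ∈ F.Par M, ⨆ h : Fin M.H,
      (ENNReal.ofReal (∫ x, F.residual M π U θ h x ^ 2 ∂(M.occupancy π h)) /
      ENNReal.ofReal ((T : ℝ)⁻¹ * ∑ i : Fin T,
        ∫ ω, F.residual M π U θ h (D.sab i h ω) ^ 2 ∂Pr)) ^ (1 / 2 : ℝ)) U hU))

theorem upsilonMoment_le {π : Policy S A B} (hCF : D.CF F M Pr π ≠ ⊤) {θ : ℕ → Θ}
    (hθ : θ ∈ F.Par M) {h : ℕ} (hh : h < M.H) :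
    upsilonMoment F M π θ h ≤ (D.CF F M Pr π).toReal ^ 2 *
      ((T : ℝ)⁻¹ * ∑ i : Fin T, ∫ ω, upsilon M.η M.base (D.policy i ω h) (M.r h)
          (fun y => F.rew h (θ h) y - M.r h y) (D.s i h ω) (D.b i h ω) ^ 2 ∂Pr) := by
  refine le_sq_mul_of_rpow_div_le hCF (integral_nonneg fun x => sq_nonneg _)
    (mul_nonneg (by positivity)
      (Finset.sum_nonneg fun i _ => integral_nonneg fun ω => sq_nonneg _)) ?_
  unfold CF
  exact (le_iSup (fun h : Fin M.H =>
    (ENNReal.ofReal (upsilonMoment F M π θ h) /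
      ENNReal.ofReal ((T : ℝ)⁻¹ * ∑ i : Fin T,
        ∫ ω, upsilon M.η M.base (D.policy i ω h) (M.r h)
          (fun y => F.rew h (θ h) y - M.r h y) (D.s i h ω) (D.b i h ω) ^ 2 ∂Pr)) ^ (1 / 2 : ℝ))
        ⟨h, hh⟩).trans
    (le_iSup₂ (f := fun θ (_ : θ ∈ F.Par M) => ⨆ h : Fin M.H,
      (ENNReal.ofReal (upsilonMoment F M π θ h) /
      ENNReal.ofReal ((T : ℝ)⁻¹ * ∑ i : Fin T,
        ∫ ω, upsilon M.η M.base (D.policy i ω h) (M.r h)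
          (fun y => F.rew h (θ h) y - M.r h y) (D.s i h ω) (D.b i h ω) ^ 2 ∂Pr)) ^ (1 / 2 : ℝ))
        θ hθ)

variable [IsProbabilityMeasure Pr]

/-- On the data, `η Υ (r^θ - r)` is the centred log-likelihood ratio, so its second moment is
at most that of the log-likelihood ratio itself. -/
theorem IsGenerated.integral_upsilon_sq_le (hD : D.IsGenerated M Pr) {h : ℕ} (hh : h < M.H)
    {f : S × A × B → ℝ} (hf : IsReward f) (i : Fin T) :
    M.η ^ 2 * ∫ ω, upsilon M.η M.base (D.policy i ω h) (M.r h)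
        (fun y => f y - M.r h y) (D.s i h ω) (D.b i h ω) ^ 2 ∂Pr ≤
      ∫ ω, D.dataRatio M h f i ω ^ 2 ∂Pr := by
  have hη := M.η_pos
  have hβ := hD.beh_markov h
  have hq := hD.isMarkovKernel_response h
  have hr := M.isReward_r h
  have hm := hD.measurable_ratioFun h hf
  have hb := hD.abs_ratioFun_le h hf
  have hs : Measurable fun ω => (D.label i ω, D.s i h ω) :=
    (hD.label_meas i).prodMk (hD.s_meas i h)
  set φ : (X × S) × B → ℝ := fun q => M.η * upsilon M.η M.base (D.beh h) (lift X (M.r h))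
    (fun y => lift X f y - lift X (M.r h) y) q.1 q.2 with hφ
  have hφm : Measurable φ := (measurable_upsilon M.η_pos M.one_le_base hr.lift
    (hf.lift.1.sub hr.lift.1)).const_mul M.η
  have hφb : ∀ q, |φ q| ≤ 2 * M.η := fun q => by
    have := abs_upsilon_le (α := D.beh h) M.η_pos M.one_le_base hr.lift
      (hf.lift.abs_sub_le hr.lift) q.1 q.2
    rw [hφ, abs_mul, abs_of_pos hη]
    nlinarith
  have hφ2b : ∀ q, |φ q ^ 2| ≤ (2 * M.η) ^ 2 := fun q => by
    rw [abs_pow]; exact pow_le_pow_left₀ (abs_nonneg _) (hφb q) 2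
  have hL2b : ∀ q, |D.ratioFun M h f q ^ 2| ≤ (2 * M.η) ^ 2 := fun q => by
    rw [abs_pow]; exact pow_le_pow_left₀ (abs_nonneg _) (hb q) 2
  have hφ2m : Measurable fun q => φ q ^ 2 := hφm.pow_const 2
  have hL2m : Measurable fun q => D.ratioFun M h f q ^ 2 := hm.pow_const 2
  have e0 : M.η ^ 2 * ∫ ω, upsilon M.η M.base (D.policy i ω h) (M.r h)
        (fun y => f y - M.r h y) (D.s i h ω) (D.b i h ω) ^ 2 ∂Pr =
      ∫ ω, φ ((D.label i ω, D.s i h ω), D.b i h ω) ^ 2 ∂Pr := by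
    rw [← integral_const_mul]
    refine integral_congr_ae (ae_of_all _ fun ω => ?_)
    simp only [hφ, mul_pow]
    rw [policy, upsilon_comap (U := fun y => f y - M.r h y) M.η_pos M.one_le_base (D.beh h) hr
      (hf.1.sub hr.1) (hf.abs_sub_le hr)]
    rfl
  rw [e0, hD.integral_response i hh hφ2m hφ2b]
  simp_rw [dataRatio_eq]
  rw [hD.integral_response i hh hL2m hL2b]
  have i1 : Integrable (fun ω => ∫ b, φ ((D.label i ω, D.s i h ω), b) ^ 2
      ∂(D.response M h (D.label i ω, D.s i h ω))) Pr :=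
    integrable_of_abs_le (K := (2 * M.η) ^ 2)
      ((hφ2m.stronglyMeasurable.integral_kernel_prod_right' (κ := D.response M h)).measurable.comp
        hs) fun ω => abs_integral_le fun b => hφ2b _
  have i2 : Integrable (fun ω => ∫ b, D.ratioFun M h f ((D.label i ω, D.s i h ω), b) ^ 2
      ∂(D.response M h (D.label i ω, D.s i h ω))) Pr :=
    integrable_of_abs_le (K := (2 * M.η) ^ 2)
      ((hL2m.stronglyMeasurable.integral_kernel_prod_right' (κ := D.response M h)).measurable.comp
        hs) fun ω => abs_integral_le fun b => hL2b _
  refine integral_mono i1 i2 fun ω => ?_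
  have h1 := integral_sub_mean_sq_le (μ := D.response M h (D.label i ω, D.s i h ω))
    (f := fun b => D.ratioFun M h f ((D.label i ω, D.s i h ω), b))
    (hm.comp measurable_prodMk_left) fun b => hb _
  refine le_trans (le_of_eq ?_) h1
  refine integral_congr_ae (ae_of_all _ fun b => ?_)
  simp only [hφ]
  rw [mul_upsilon_eq M.η_pos M.one_le_base hf.lift hr.lift]
  rfl

end Data

/-! ### Suboptimality of the pessimistic policy -/

section Constants

variable {S A B : Type*} [MeasurableSpace S] [MeasurableSpace A] [MeasurableSpace B]
  (M : Game S A B)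

theorem Game.two_mul_η_le : 2 * M.η ≤ M.η * M.BA := by
  have h1 : 1 ≤ M.base.real univ := by
    have := ENNReal.toReal_mono (measure_ne_top M.base univ) M.one_le_base
    simpa [Measure.real] using this
  have h2 := Real.log_nonneg h1
  have h3 : M.η * M.BA = 2 * Real.log (M.base.real univ) + 2 * M.η := by
    have := M.η_pos.ne'
    unfold Game.BA
    field_simp
  linarith

theorem Game.η_mul_Ceta : M.η * M.Ceta = 1 + M.η * M.BA := by
  have := M.η_pos.ne'
  unfold Game.Ceta
  field_simp

end Constants

namespace Data

variable {Ω X S A B Θ : Type*} [MeasurableSpace Ω] [MeasurableSpace X] [MeasurableSpace S]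
  [MeasurableSpace A] [MeasurableSpace B] {T : ℕ}
  {D : Data Ω X S A B T} {F : Classes S A B Θ} {M : Game S A B} {Pr : Measure Ω}
  [IsProbabilityMeasure Pr]

omit [IsProbabilityMeasure Pr] in
theorem abs_integral_residual_le (hF : F.Admissible M) (hC : F.Complete M)
    {π : Policy S A B} (hπ : π ∈ F.Pol M) (hCL : D.CL F M Pr π ≠ ⊤) {ι β : ℝ}
    (hβ : 35 + 4 * ι ≤ β) (hι : 0 ≤ ι) {ω : Ω} (hloss : D.GoodLoss F M Pr ι ω)
    {p : (ℕ → S × A × B → ℝ) × (ℕ → Θ)} (hp : p ∈ D.confSet F M β ω π) {h : ℕ} (hh : h < M.H) :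
    |∫ x, F.residual M π p.1 p.2 h x ∂(M.occupancy π h)| ≤
      3 * M.H * (D.CL F M Pr π).toReal * Real.sqrt (β / T) := by
  have hβ0 : 0 ≤ β := by linarith
  have hμ := isProbabilityMeasure_stateLaw hF hπ h hh.le
  have hα := hF.pol_markov h hh _ (hπ h hh)
  have hocc : IsProbabilityMeasure (M.occupancy π h) := isProbabilityMeasure_stepLaw h _ _
  have hy : (p.1, π, p.2) ∈ F.Joint M := ⟨hp.1, hπ, hp.2.1⟩
  have hm : Measurable (F.residual M π p.1 p.2 h) := by
    rw [residual_eq]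
    exact (hF.val_meas _ hh _ (hp.1.1 _ hh)).sub (hF.val_meas _ hh _ (target_mem hC hh hy))
  have hb : ∀ x, |F.residual M π p.1 p.2 h x| ≤ 2 * M.H := fun x => by
    rw [residual_eq]
    exact abs_bellmanError_le hF hC hh hy x
  have h1 := sq_integral_le (μ := M.occupancy π h) hm hb
  have h2 := integral_residual_sq_le hCL hp.1 hp.2.1 hh
  have h3 : ∑ i : Fin T, ∫ ω, F.residual M π p.1 p.2 h (D.sab i h ω) ^ 2 ∂Pr ≤
    8 * (M.H : ℝ) ^ 2 * β := by
    rw [residual_eq]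
    exact sum_bellmanError_le_of_mem_confSet hC hβ hloss hπ hp hh
  refine abs_le_of_sq_le_sq ?_ (by positivity)
  refine h1.trans (h2.trans ?_)
  have h4 : (T : ℝ)⁻¹ * ∑ i : Fin T, ∫ ω, F.residual M π p.1 p.2 h (D.sab i h ω) ^ 2 ∂Pr ≤
      9 * (M.H : ℝ) ^ 2 * (β / T) := by
    calc _ ≤ (T : ℝ)⁻¹ * (8 * (M.H : ℝ) ^ 2 * β) := by gcongr
      _ = 8 * (M.H : ℝ) ^ 2 * (β / T) := by ring
      _ ≤ _ := by gcongr; norm_num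
  calc _ ≤ (D.CL F M Pr π).toReal ^ 2 * (9 * (M.H : ℝ) ^ 2 * (β / T)) := by gcongr
    _ = (3 * M.H * (D.CL F M Pr π).toReal) ^ 2 * Real.sqrt (β / T) ^ 2 := by
      rw [Real.sq_sqrt (by positivity)]; ring
    _ = _ := by ring

theorem IsGenerated.upsilonMoment_le_of_mem_confSet (hD : D.IsGenerated M Pr)
    (hF : F.Admissible M) {π : Policy S A B} (hCF : D.CF F M Pr π ≠ ⊤) {ι β : ℝ}
    (hβ : 35 + 4 * ι ≤ β) (hι : 0 ≤ ι) {ω : Ω} (hlik : D.GoodLik F M Pr ι ω) {θ₀ : ℕ → Θ}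
    (hθ₀ : θ₀ ∈ F.Par M) (h₀ : ∀ h < M.H, F.rew h (θ₀ h) = M.r h)
    {p : (ℕ → S × A × B → ℝ) × (ℕ → Θ)} (hp : p ∈ D.confSet F M β ω π) {h : ℕ} (hh : h < M.H) :
    M.η ^ 2 * upsilonMoment F M π p.2 h ≤
      16 * (D.CF F M Pr π).toReal ^ 2 * (1 + M.η) ^ 2 * (β / T) := by
  have h1 := upsilonMoment_le hCF hp.2.1 hh
  have h2 := sum_dataRatio_le_of_mem_confSet hD hF hβ hι hlik hθ₀ h₀ hp hh
  have h3 := Finset.sum_le_sum fun i (_ : i ∈ Finset.univ) =>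
    hD.integral_upsilon_sq_le hh (hF.isReward hh (hp.2.1 h hh)) i
  rw [← Finset.mul_sum] at h3
  set W := ∑ i : Fin T, ∫ ω, upsilon M.η M.base (D.policy i ω h) (M.r h)
          (fun y => F.rew h (p.2 h) y - M.r h y) (D.s i h ω) (D.b i h ω) ^ 2 ∂Pr
  calc _ ≤ M.η ^ 2 * ((D.CF F M Pr π).toReal ^ 2 * ((T : ℝ)⁻¹ * W)) := by gcongr
    _ = (D.CF F M Pr π).toReal ^ 2 * (T : ℝ)⁻¹ * (M.η ^ 2 * W) := by ring
    _ ≤ (D.CF F M Pr π).toReal ^ 2 * (T : ℝ)⁻¹ * (16 * (1 + M.η) ^ 2 * β) := by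
      exact mul_le_mul_of_nonneg_left (h3.trans h2) (by positivity)
    _ = _ := by ring

/-- On the good event the candidates in the confidence set of `π` underestimate `J π` by little. -/
theorem IsGenerated.J_sub_le_of_mem_confSet (hD : D.IsGenerated M Pr)
    (hF : F.Admissible M) (hC : F.Complete M) {π : Policy S A B} (hπ : π ∈ F.Pol M)
    (hCL : D.CL F M Pr π ≠ ⊤) (hCF : D.CF F M Pr π ≠ ⊤) {ι β : ℝ}
    (hβ : 35 + 4 * ι ≤ β) (hι : 0 ≤ ι) {ω : Ω} (hlik : D.GoodLik F M Pr ι ω)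
    (hloss : D.GoodLoss F M Pr ι ω) {θ₀ : ℕ → Θ}
    (hθ₀ : θ₀ ∈ F.Par M) (h₀ : ∀ h < M.H, F.rew h (θ₀ h) = M.r h)
    {p : (ℕ → S × A × B → ℝ) × (ℕ → Θ)} (hp : p ∈ D.confSet F M β ω π) :
    M.J π - ∫ s, stateValue F M π p.1 p.2 0 s ∂M.init ≤
      32 * ((D.CL F M Pr π).toReal * ((M.H : ℝ) ^ 2 * Real.sqrt (β / T)) +
        (D.CF F M Pr π).toReal * ((M.H : ℝ) ^ 2 * (1 + M.η * M.BA) * Real.sqrt (β / T)) +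
        (D.CF F M Pr π).toReal ^ 2 * ((M.H : ℝ) ^ 2 * Real.exp (4 * M.η * M.BA) *
          (M.η * M.Ceta) ^ 3 * (β / T))) := by
  have hη := M.η_pos
  have hβ0 : 0 ≤ β := by linarith
  have hη2 := M.two_mul_η_le
  set cl := (D.CL F M Pr π).toReal
  set cf := (D.CF F M Pr π).toReal with hcf
  have hcf0 : 0 ≤ cf := ENNReal.toReal_nonneg
  set R := 3 * cl * Real.sqrt (β / T) + 4 * cf * (1 + M.η) * Real.sqrt (β / T) +
    32 * Real.exp (2 * M.η) * cf ^ 2 * (1 + M.η) ^ 2 * (β / T) with hR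
  have hterm : ∀ h ∈ Finset.range M.H, -(M.H * R) ≤
      ∫ x, F.residual M π p.1 p.2 h x ∂(M.occupancy π h) +
        ∫ s, responseError F M π p.1 p.2 h s ∂(M.stateLaw π h) := by
    intro h hh
    have hh := Finset.mem_range.1 hh
    have h1 := abs_le.1 (abs_integral_residual_le hF hC hπ hCL hβ hι hloss hp hh)
    have h2 := abs_le.1 (abs_integral_responseError_le hF hπ hp.1 hp.2.1 hh)
    have h3 := hD.upsilonMoment_le_of_mem_confSet hF hCF hβ hι hlik hθ₀ h₀ hp hh
    have h4 : Real.sqrt (M.η ^ 2 * upsilonMoment F M π p.2 h) ≤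
        4 * cf * (1 + M.η) * Real.sqrt (β / T) := by
      refine Real.sqrt_le_iff.2 ⟨by positivity, h3.trans (le_of_eq ?_)⟩
      rw [mul_pow, Real.sq_sqrt (by positivity)]
      ring
    have h5 : Real.sqrt (M.η ^ 2 * upsilonMoment F M π p.2 h) +
        2 * Real.exp (2 * M.η) * (M.η ^ 2 * upsilonMoment F M π p.2 h) ≤
        4 * cf * (1 + M.η) * Real.sqrt (β / T) +
        2 * Real.exp (2 * M.η) * (16 * cf ^ 2 * (1 + M.η) ^ 2 * (β / T)) := by gcongr
    have h6 := mul_le_mul_of_nonneg_left h5 (Nat.cast_nonneg (α := ℝ) M.H)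
    have h7 : (M.H : ℝ) * R = 3 * M.H * cl * Real.sqrt (β / T) +
      M.H * (4 * cf * (1 + M.η) * Real.sqrt (β / T) +
        2 * Real.exp (2 * M.η) * (16 * cf ^ 2 * (1 + M.η) ^ 2 * (β / T))) := by
      rw [hR]; ring
    linarith [h1.1, h2.1]
  have hsum := Finset.sum_le_sum hterm
  rw [Finset.sum_const, Finset.card_range, nsmul_eq_mul] at hsum
  rw [integral_stateValue_zero hF hC hπ hp.1 hp.2.1]
  have hfirst : (1 + M.η) ≤ 1 + M.η * M.BA := by linarith
  have hsecond : Real.exp (2 * M.η) * (1 + M.η) ^ 2 ≤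
      Real.exp (4 * M.η * M.BA) * (M.η * M.Ceta) ^ 3 := by
    have h8 : (1 + M.η) ^ 2 ≤ (M.η * M.Ceta) ^ 3 := by
      rw [M.η_mul_Ceta]
      calc (1 + M.η) ^ 2 ≤ (1 + M.η * M.BA) ^ 2 := by gcongr
        _ ≤ _ := pow_le_pow_right₀ (by linarith) (by norm_num)
    have h9 : Real.exp (2 * M.η) ≤ Real.exp (4 * M.η * M.BA) :=
      Real.exp_le_exp.2 (by linarith)
    exact mul_le_mul h9 h8 (by positivity) (Real.exp_pos _).le
  have hclle : cl * Real.sqrt (β / T) ≥ 0 := mul_nonneg ENNReal.toReal_nonneg (Real.sqrt_nonneg _)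
  have e1 : cf * Real.sqrt (β / T) * (1 + M.η) ≤ cf * Real.sqrt (β / T) * (1 + M.η * M.BA) := by
    gcongr
  have e2 : cf ^ 2 * (β / T) * (Real.exp (2 * M.η) * (1 + M.η) ^ 2) ≤
      cf ^ 2 * (β / T) * (Real.exp (4 * M.η * M.BA) * (M.η * M.Ceta) ^ 3) := by
    gcongr
  have e0 : 0 ≤ cf * Real.sqrt (β / T) * (1 + M.η) := by positivity
  have hfin : R ≤ 32 * (cl * Real.sqrt (β / T) +
      cf * Real.sqrt (β / T) * (1 + M.η * M.BA) +
      cf ^ 2 * (β / T) * (Real.exp (4 * M.η * M.BA) * (M.η * M.Ceta) ^ 3)) := by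
    rw [hR]; linarith
  have hfin2 := mul_le_mul_of_nonneg_left hfin (sq_nonneg (M.H : ℝ))
  linarith

/-- Pessimism: on the good event an output `π̂` is at least as good as `π` up to the amount by
which the confidence set of `π` underestimates `J π`, since `J π̂` is among the values over
which the pessimistic value of `π̂` is an infimum. -/
theorem IsGenerated.J_sub_le_of_isOutput (hD : D.IsGenerated M Pr)
    (hF : F.Admissible M) (hR : F.Realizable M) (hC : F.Complete M) {π π' : Policy S A B}
    (hπ : π ∈ F.Pol M) (hCL : D.CL F M Pr π ≠ ⊤) (hCF : D.CF F M Pr π ≠ ⊤) {ι β : ℝ}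
    (hβ : 35 + 4 * ι ≤ β) (hι : 0 ≤ ι) {ω : Ω} (hlik : D.GoodLik F M Pr ι ω)
    (hloss : D.GoodLoss F M Pr ι ω) (hout : D.IsOutput F M β ω π') :
    M.J π - M.J π' ≤
      32 * ((D.CL F M Pr π).toReal * ((M.H : ℝ) ^ 2 * Real.sqrt (β / T)) +
        (D.CF F M Pr π).toReal * ((M.H : ℝ) ^ 2 * (1 + M.η * M.BA) * Real.sqrt (β / T)) +
        (D.CF F M Pr π).toReal ^ 2 * ((M.H : ℝ) ^ 2 * Real.exp (4 * M.η * M.BA) *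
          (M.η * M.Ceta) ^ 3 * (β / T))) := by
  obtain ⟨⟨θ₀, hθ₀, h₀⟩, hval⟩ := hR
  have hconf : ∀ π ∈ F.Pol M, ∃ p ∈ D.confSet F M β ω π,
      ∫ s, stateValue F M π p.1 p.2 0 s ∂M.init = M.J π := fun π hπ => by
    obtain ⟨U, hU, hres⟩ := hval π hπ θ₀ hθ₀
    exact ⟨(U, θ₀), mem_confSet hβ hι hlik hloss hθ₀ h₀ hπ hU hres,
      integral_stateValue_eq_J hF hC hπ hU hθ₀ h₀ hres⟩
  obtain ⟨p', hp', hJ'⟩ := hconf π' hout.1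
  have h1 : D.pessValue F M β ω π' ≤ M.J π' := by
    rw [← hJ']
    refine ciInf_le (f := fun p : D.confSet F M β ω π' =>
      ∫ s, stateValue F M π' p.1.1 p.1.2 0 s ∂M.init) ⟨-M.H, ?_⟩ ⟨p', hp'⟩
    rintro _ ⟨p, rfl⟩
    exact (abs_le.1 (abs_integral_stateValue_le hF hout.1 p.2.1 p.2.2.1)).1
  obtain ⟨p₀, hp₀, -⟩ := hconf π hπ
  have : Nonempty (D.confSet F M β ω π) := ⟨⟨p₀, hp₀⟩⟩
  have h2 := le_ciInf (f := fun p : D.confSet F M β ω π =>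
      ∫ s, stateValue F M π p.1.1 p.1.2 0 s ∂M.init) fun p =>
    sub_le_comm.1 (hD.J_sub_le_of_mem_confSet hF hC hπ hCL hCF hβ hι hlik hloss hθ₀ h₀ p.2)
  have h3 : _ ≤ D.pessValue F M β ω π := h2
  linarith [hout.2 π hπ]

theorem IsGenerated.ofReal_J_sub_le_of_isOutput (hD : D.IsGenerated M Pr) (hT : 0 < T)
    (hF : F.Admissible M) (hR : F.Realizable M) (hC : F.Complete M) {π π' : Policy S A B}
    (hπ : π ∈ F.Pol M) {ι β : ℝ} (hβ : 35 + 4 * ι ≤ β) (hι : 0 ≤ ι) {ω : Ω}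
    (hlik : D.GoodLik F M Pr ι ω) (hloss : D.GoodLoss F M Pr ι ω)
    (hout : D.IsOutput F M β ω π') :
    ENNReal.ofReal (M.J π - M.J π') ≤
      ENNReal.ofReal 32 *
        (D.CL F M Pr π * ENNReal.ofReal ((M.H : ℝ) ^ 2 * Real.sqrt (β / T)) +
         D.CF F M Pr π * ENNReal.ofReal
          ((M.H : ℝ) ^ 2 * (1 + M.η * M.BA) * Real.sqrt (β / T)) +
         D.CF F M Pr π ^ 2 * ENNReal.ofReal
          ((M.H : ℝ) ^ 2 * Real.exp (4 * M.η * M.BA) * (M.η * M.Ceta) ^ 3 * (β / T))) := by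
  have hη := M.η_pos
  have hη2 := M.two_mul_η_le
  have hH := M.one_le_H
  have hβ0 : 0 < β := by linarith
  have hT' : (0 : ℝ) < T := by exact_mod_cast hT
  have hs : 0 < Real.sqrt (β / T) := Real.sqrt_pos.2 (by positivity)
  have hBA : 0 < 1 + M.η * M.BA := by linarith
  have hCeta : 0 < M.η * M.Ceta := by rw [M.η_mul_Ceta]; exact hBA
  have ha : 0 < (M.H : ℝ) ^ 2 * Real.sqrt (β / T) := by positivity
  have hb : 0 < (M.H : ℝ) ^ 2 * (1 + M.η * M.BA) * Real.sqrt (β / T) := by positivity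
  have hc : 0 < (M.H : ℝ) ^ 2 * Real.exp (4 * M.η * M.BA) * (M.η * M.Ceta) ^ 3 * (β / T) := by
    positivity
  have h32 : ENNReal.ofReal 32 ≠ 0 := by simp
  by_cases hCL : D.CL F M Pr π = ⊤
  · rw [hCL, ENNReal.top_mul (ENNReal.ofReal_pos.2 ha).ne', top_add, top_add, ENNReal.mul_top h32]
    exact le_top
  by_cases hCF : D.CF F M Pr π = ⊤
  · rw [hCF, ENNReal.top_mul (ENNReal.ofReal_pos.2 hb).ne', add_top, top_add, ENNReal.mul_top h32]
    exact le_top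
  refine (ENNReal.ofReal_le_ofReal
    (hD.J_sub_le_of_isOutput hF hR hC hπ hCL hCF hβ hι hlik hloss hout)).trans (le_of_eq ?_)
  have hl0 : 0 ≤ (D.CL F M Pr π).toReal := ENNReal.toReal_nonneg
  have hf0 : 0 ≤ (D.CF F M Pr π).toReal := ENNReal.toReal_nonneg
  have n1 := mul_nonneg hl0 ha.le
  have n2 := mul_nonneg hf0 hb.le
  have n3 := mul_nonneg (sq_nonneg (D.CF F M Pr π).toReal) hc.le
  rw [ENNReal.ofReal_mul (by norm_num), ENNReal.ofReal_add (add_nonneg n1 n2) n3,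
    ENNReal.ofReal_add n1 n2, ENNReal.ofReal_mul hl0, ENNReal.ofReal_mul hf0,
    ENNReal.ofReal_mul (sq_nonneg (D.CF F M Pr π).toReal), ENNReal.ofReal_pow hf0,
    ENNReal.ofReal_toReal hCL, ENNReal.ofReal_toReal hCF]

/-! ### Probability of the good event -/

theorem one_le_toNat_of_coveringNumber_le {X : Type*} {ρ : X → X → ℝ≥0∞} {K : Set X} {ε : ℝ≥0∞}
    {N : ℕ∞} (h : coveringNumber ρ K ε ≤ N) (hN : N ≠ ⊤) (hK : K.Nonempty) : 1 ≤ N.toNat := by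
  obtain ⟨C, -, hC, hcard⟩ := exists_net h hN
  obtain ⟨x, hx⟩ := hK
  obtain ⟨y, hy, -⟩ := hC x hx
  exact (Finset.card_pos.2 ⟨y, hy⟩).trans_le hcard

theorem IsGenerated.measure_not_good_le (hD : D.IsGenerated M Pr) (hT : 0 < T)
    (hF : F.Admissible M) (hC : F.Complete M)
    (hNΘ : F.parCover M (T : ℝ≥0∞)⁻¹ ≠ ⊤) (hNY : F.jointCover M (T : ℝ≥0∞)⁻¹ ≠ ⊤)
    {m n : ℕ} (hm : (F.parCover M (T : ℝ≥0∞)⁻¹).toNat = m)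
    (hn : (F.jointCover M (T : ℝ≥0∞)⁻¹).toNat = n) (hm1 : 1 ≤ m) (hn1 : 1 ≤ n) {δ : ℝ}
    (hδ : 0 < δ) :
    Pr {ω | ¬ (D.GoodLik F M Pr (Real.log (2 * M.H * m * n / δ)) ω ∧
        D.GoodLoss F M Pr (Real.log (2 * M.H * m * n / δ)) ω)} ≤ ENNReal.ofReal δ := by
  set ι := Real.log (2 * M.H * m * n / δ) with hι
  have hH := M.one_le_H
  have hm1' : (1 : ℝ) ≤ m := by exact_mod_cast hm1
  have hn1' : (1 : ℝ) ≤ n := by exact_mod_cast hn1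
  have h1 := hD.measure_logLik_uniform hT hF hNΘ ι
  have h2 := hD.measure_excess_uniform hT hF hC hNY ι
  rw [hm] at h1
  rw [hn] at h2
  refine (measure_mono ?_).trans ((measure_union_le _ _).trans ((add_le_add h1 h2).trans ?_))
  · intro ω hω
    by_contra hcon
    refine hω ⟨fun h hh θ hθ => ?_, fun h hh y hy => ?_⟩
    · by_contra hlt
      exact hcon (Or.inl ⟨h, hh, θ, hθ, not_le.1 hlt⟩)
    · by_contra hlt
      exact hcon (Or.inr ⟨h, hh, y, hy, not_le.1 hlt⟩)
  · have hexp : Real.exp (-ι) = δ / (2 * M.H * m * n) := by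
      rw [Real.exp_neg, hι, Real.exp_log (by positivity), inv_div]
    rw [← add_mul, ← Nat.cast_add, ← ENNReal.ofReal_natCast, ← ENNReal.ofReal_mul (by positivity),
      hexp]
    refine ENNReal.ofReal_le_ofReal ?_
    rw [mul_div_assoc', div_le_iff₀ (by positivity)]
    push_cast
    have h3 : (m : ℝ) + n ≤ 2 * m * n := by nlinarith
    nlinarith [mul_le_mul_of_nonneg_left h3 (by positivity : 0 ≤ M.H * δ)]

end Data

end LeaderFollower

end

theorem mainTheorem2 :
    ∃ c C : ℝ, 0 < c ∧ 0 < C ∧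
      ∀ (S A B Θ X Ω : Type*) [MeasurableSpace S] [MeasurableSpace A] [MeasurableSpace B]
        [MeasurableSpace X] [MeasurableSpace Ω]
        (M : LeaderFollower.Game S A B) (F : LeaderFollower.Classes S A B Θ)
        (_ : F.Admissible M) (_ : F.Realizable M) (_ : F.Complete M)
        (T : ℕ) (_ : 0 < T)
        (Pr : Measure Ω) [IsProbabilityMeasure Pr]
        (D : LeaderFollower.Data Ω X S A B T) (_ : D.IsGenerated M Pr)
        (πstar : LeaderFollower.Policy S A B)
        (_ : πstar ∈ F.Pol M) (_ : ∀ π ∈ F.Pol M, M.J π ≤ M.J πstar)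
        (δ β : ℝ) (_ : 0 < δ) (_ : δ < 1)
        (_ : F.parCover M (T : ℝ≥0∞)⁻¹ ≠ ⊤) (_ : F.jointCover M (T : ℝ≥0∞)⁻¹ ≠ ⊤)
        (_ : c * Real.log (Real.exp 1 * M.H * ((F.parCover M (T : ℝ≥0∞)⁻¹).toNat : ℝ) *
          ((F.jointCover M (T : ℝ≥0∞)⁻¹).toNat : ℝ) / δ) ≤ β),
        Pr {ω | ∃ πhat : LeaderFollower.Policy S A B, D.IsOutput F M β ω πhat ∧
            ¬ (ENNReal.ofReal (M.J πstar - M.J πhat) ≤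
              ENNReal.ofReal C *
                (D.CL F M Pr πstar * ENNReal.ofReal ((M.H : ℝ) ^ 2 * Real.sqrt (β / T)) +
                 D.CF F M Pr πstar * ENNReal.ofReal
                  ((M.H : ℝ) ^ 2 * (1 + M.η * M.BA) * Real.sqrt (β / T)) +
                 D.CF F M Pr πstar ^ 2 * ENNReal.ofReal
                  ((M.H : ℝ) ^ 2 * Real.exp (4 * M.η * M.BA) * (M.η * M.Ceta) ^ 3 * (β / T))))}
          ≤ ENNReal.ofReal δ := by
  -- `35 + 4 ι ≤ 39 log (e H N N / δ)` for `ι = log (2 H N N / δ)`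
  refine ⟨39, 32, by norm_num, by norm_num, ?_⟩
  intro S A B Θ X Ω _ _ _ _ _ M F hF hR hC T hT Pr _ D hD πstar hπ _ δ β hδ hδ1 hNΘ hNY hβ
  obtain ⟨θ₀, hθ₀, -⟩ := hR.1
  obtain ⟨U₀, hU₀, -⟩ := hR.2 πstar hπ θ₀ hθ₀
  obtain ⟨m, hm⟩ : ∃ m, (F.parCover M (T : ℝ≥0∞)⁻¹).toNat = m := ⟨_, rfl⟩
  obtain ⟨n, hn⟩ : ∃ n, (F.jointCover M (T : ℝ≥0∞)⁻¹).toNat = n := ⟨_, rfl⟩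
  have hm1 : 1 ≤ m := hm ▸ LeaderFollower.Data.one_le_toNat_of_coveringNumber_le
    (le_iSup (fun h : Fin M.H => LeaderFollower.coveringNumber (F.parDist M h) (F.par h) _)
      ⟨0, M.H_pos⟩) hNΘ ⟨θ₀ 0, hθ₀ 0 M.H_pos⟩
  have hn1 : 1 ≤ n := hn ▸ LeaderFollower.Data.one_le_toNat_of_coveringNumber_le
    (le_iSup (fun h : Fin M.H => LeaderFollower.coveringNumber (F.jointDist M h)
      (F.Val M ×ˢ F.Pol M ×ˢ F.Par M) _) ⟨0, M.H_pos⟩) hNY ⟨(U₀, πstar, θ₀), hU₀, hπ, hθ₀⟩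
  rw [hm, hn] at hβ
  have hH := M.one_le_H
  have hm1' : (1 : ℝ) ≤ m := by exact_mod_cast hm1
  have hn1' : (1 : ℝ) ≤ n := by exact_mod_cast hn1
  have hq : 1 ≤ M.H * m * n / δ := by
    rw [le_div_iff₀ hδ]
    have h1 : (1 : ℝ) ≤ M.H * m := one_le_mul_of_one_le_of_one_le hH hm1'
    have h2 : (1 : ℝ) ≤ M.H * m * n := one_le_mul_of_one_le_of_one_le h1 hn1'
    linarith
  set ι := Real.log (2 * M.H * m * n / δ) with hι
  have hι0 : 0 ≤ ι := by
    refine Real.log_nonneg ?_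
    have : 2 * M.H * m * n / δ = 2 * (M.H * m * n / δ) := by ring
    rw [this]; linarith
  have hΛ : Real.log (Real.exp 1 * M.H * m * n / δ) = 1 + Real.log (M.H * m * n / δ) := by
    have : Real.exp 1 * M.H * m * n / δ = Real.exp 1 * (M.H * m * n / δ) := by ring
    rw [this, Real.log_mul (Real.exp_pos 1).ne' (by positivity), Real.log_exp]
  have hιΛ : ι ≤ Real.log (Real.exp 1 * M.H * m * n / δ) := by
    refine Real.log_le_log (by positivity) ?_
    have : (2 : ℝ) ≤ Real.exp 1 := by linarith [Real.add_one_le_exp 1]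
    gcongr
  have hβ' : 35 + 4 * ι ≤ β := by
    have := Real.log_nonneg hq
    linarith
  refine (measure_mono ?_).trans (hD.measure_not_good_le hT hF hC hNΘ hNY hm hn hm1 hn1 hδ)
  rintro ω ⟨πhat, hout, hnot⟩ ⟨hlik, hloss⟩
  exact hnot (hD.ofReal_J_sub_le_of_isOutput hT hF hR hC hπ hβ' hι0 hlik hloss hout)
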